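/- Let $p\neq 2$ be a prime and let $\mathbf G$ be a simple simply connected linear algebraic group over $\overline{\mathbb F}_p$ whose root system is of type $\mathsf B_l$, $\mathsf C_l$ ($l\ge 1$, with $\mathsf B_1=\mathsf C_1=\mathsf A_1$) or $\mathsf E_7$. Let $F_0\colon\mathbf G\to\mathbf G$ be a Frobenius endomorphism defining $\mathbf G$ over $\mathbb F_p$, let $m\ge 1$ and $F=F_0^m$. Let $\mathbf G\to\widetilde{\mathbf G}$ be a regular embedding, that is, a closed embedding of algebraic groups into a connected reductive group $\widetilde{\mathbf G}$ with connected centre such that $\widetilde{\mathbf G}=\mathbf G\,\mathrm Z(\widetilde{\mathbf G})$, and assume that $F_0$ extends to a Frobenius endomorphism of $\widetilde{\mathbf G}$ defining it over $\mathbb F_p$, again denoted by $F_0$. Put $G=\mathbf G^F\le\widetilde G=\widetilde{\mathbf G}^F$. Consider pairs $(\delta,F_1)$, where $F_1=F_0^a$ for a positive divisor $a$ of $m$ and where $\delta$ is a non-interior diagonal automorphism of $G$, that is, the conjugation by some element of $\widetilde G\setminus G\,\mathrm C_{\widetilde G}(G)$. Let $\operatorname{Irr}(\widetilde G/G)$ act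 by multiplication on the set $\operatorname{Irr}(\widetilde G)$ of irreducible complex characters. Let $c(\delta,F_1)$ be the number of $\delta F_1$-invariant conjugacy classes of $G$, and let $d(\widetilde G,F_1)$ be the number of $\chi\in\operatorname{Irr}(\widetilde G)$ whose $\operatorname{Irr}(\widetilde G/G)$-orbit is $F_1$-stable and has length $|\widetilde G:G|$. Then the following two statements are equivalent: (1) $c(\delta,F_1)=|\widetilde G:G|^{-1}\,d(\widetilde G,F_1)$ for every pair $(\delta,F_1)$ as above. (2) For every $\chi\in\operatorname{Irr}(G)$ and every pair $(\delta,F_1)$ as above, $\chi^{F_1}=\chi^{\delta}$ implies $\chi=\chi^{F_1}=\chi^{\delta}$. -/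

import Mathlib

open scoped MatrixGroups

noncomputable section

namespace LinAlgGroup

/-! ### Linear algebraic groups: Zariski closed subgroups of `GL n k` -/

section General

variable {k : Type*} [Field k] {n : ℕ}

/-- The index type for the coordinate functions on `GL n k`: the entries of `g` (left summand) and
the entries of `g⁻¹` (right summand). -/
abbrev Coord (n : ℕ) : Type := (Fin n × Fin n) ⊕ (Fin n × Fin n)

/-- The values at `g` of the coordinate functions. -/
def coords (g : GL (Fin n) k) : Coord n → k :=
  Sum.elim (fun ij => (g : Matrix (Fin n) (Fin n) k) ij.1 ij.2)
    (fun ij => ((g⁻¹ : GL (Fin n) k) : Matrix (Fin n) (Fin n) k) ij.1 ij.2)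

/-- The value at `g` of the regular function on `GL n k` given by the polynomial `f` in the entries
of `g` and of `g⁻¹`. -/
def evalReg (f : MvPolynomial (Coord n) k) (g : GL (Fin n) k) : k :=
  MvPolynomial.eval (coords g) f

/-- Zariski closed subsets of `GL n k`. -/
def IsZariskiClosed (S : Set (GL (Fin n) k)) : Prop :=
  ∃ I : Set (MvPolynomial (Coord n) k), S = {g | ∀ f ∈ I, evalReg f g = 0}

/-- Connectedness in the Zariski topology. -/
def IsZariskiConnected (S : Set (GL (Fin n) k)) : Prop :=
  S.Nonempty ∧ ∀ A B : Set (GL (Fin n) k), IsZariskiClosed A → IsZariskiClosed B →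
    S ⊆ A ∪ B → S ∩ (A ∩ B) = ∅ → S ⊆ A ∨ S ⊆ B

/-- `N` is a closed connected normal subgroup of `G`. -/
structure IsClosedConnectedNormal (G N : Subgroup (GL (Fin n) k)) : Prop where
  le : N ≤ G
  closed : IsZariskiClosed (N : Set (GL (Fin n) k))
  connected : IsZariskiConnected (N : Set (GL (Fin n) k))
  normal : ∀ g ∈ G, ∀ x ∈ N, g * x * g⁻¹ ∈ N

/-- Simple algebraic groups: closed, connected, non-commutative, without closed connected normal
subgroups other than `1` and the whole group. -/
structure IsSimpleAlgebraic (G : Subgroup (GL (Fin n) k)) : Prop where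
  closed : IsZariskiClosed (G : Set (GL (Fin n) k))
  connected : IsZariskiConnected (G : Set (GL (Fin n) k))
  noncomm : ∃ g ∈ G, ∃ h ∈ G, g * h ≠ h * g
  simple : ∀ N : Subgroup (GL (Fin n) k), IsClosedConnectedNormal G N → N = ⊥ ∨ N = G

/-- Connected reductive groups: closed, connected, with trivial unipotent radical. -/
structure IsConnectedReductive (G : Subgroup (GL (Fin n) k)) : Prop where
  closed : IsZariskiClosed (G : Set (GL (Fin n) k))
  connected : IsZariskiConnected (G : Set (GL (Fin n) k))
  unipotent_radical : ∀ N : Subgroup (GL (Fin n) k), IsClosedConnectedNormal G N →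
    (∀ x ∈ N, IsNilpotent ((x : Matrix (Fin n) (Fin n) k) - 1)) → N = ⊥

/-- `f` is an isomorphism of the algebraic group `G` onto a closed subgroup of `GL n' k`: it is
given by regular functions, its image is closed, and its inverse is given by regular functions
on the image. -/
structure IsClosedEmbedding {n' : ℕ} (G : Subgroup (GL (Fin n) k)) (f : G →* GL (Fin n') k) :
    Prop where
  regular : ∀ i j, ∃ q : MvPolynomial (Coord n) k, ∀ g : G,
    (f g : Matrix (Fin n') (Fin n') k) i j = evalReg q (g : GL (Fin n) k)
  closed_range : IsZariskiClosed (f.range : Set (GL (Fin n') k))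
  regular_inv : ∀ i j, ∃ q : MvPolynomial (Coord n') k, ∀ g : G,
    ((g : GL (Fin n) k) : Matrix (Fin n) (Fin n) k) i j = evalReg q (f g)

/-- `F` is the Frobenius endomorphism of a rational structure of `G` over the field with `q`
elements: in some closed embedding into a general linear group, it raises all the matrix entries
to the `q`-th power. -/
def IsFrobenius (q : ℕ) (G : Subgroup (GL (Fin n) k)) (F : Monoid.End G) : Prop :=
  ∃ (r : ℕ) (f : G →* GL (Fin r) k), IsClosedEmbedding G f ∧
    ∀ (g : G) (i j : Fin r), (f (F g) : Matrix (Fin r) (Fin r) k) i j =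
      ((f g : Matrix (Fin r) (Fin r) k) i j) ^ q

/-- Regular embeddings `G → Gt`: closed embeddings into a connected reductive group with connected
centre, whose image and the centre generate `Gt` (so that `G` and `Gt` have the same
derived subgroup). -/
structure IsRegularEmbedding {n' : ℕ} (G : Subgroup (GL (Fin n) k)) (Gt : Subgroup (GL (Fin n') k))
    (f : G →* Gt) : Prop where
  reductive : IsConnectedReductive Gt
  embedding : IsClosedEmbedding G (Gt.subtype.comp f)
  connected_center :
    IsZariskiConnected (((Subgroup.center Gt).map Gt.subtype : Subgroup (GL (Fin n') k)) :
      Set (GL (Fin n') k))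
  sup_center : f.range ⊔ Subgroup.center Gt = ⊤

/-- The Lie algebra of the closed subgroup `G`: the tangent space at `1`, that is, the matrices
annihilated by the differentials at `1` of all the polynomials that vanish on `G`. -/
def lieAlgebra (G : Subgroup (GL (Fin n) k)) : Submodule k (Matrix (Fin n) (Fin n) k) where
  carrier := {x | ∀ f : MvPolynomial (Fin n × Fin n) k,
    (∀ g ∈ G, MvPolynomial.eval (fun ij => (g : Matrix (Fin n) (Fin n) k) ij.1 ij.2) f = 0) →
    ∑ ij : Fin n × Fin n, MvPolynomial.eval (fun ab => (1 : Matrix (Fin n) (Fin n) k) ab.1 ab.2)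
      (MvPolynomial.pderiv ij f) * x ij.1 ij.2 = 0}
  add_mem' := by
    intro x y hx hy f hf
    simp only [Matrix.add_apply, mul_add, Finset.sum_add_distrib, hx f hf, hy f hf, add_zero]
  zero_mem' := by
    intro f _
    simp
  smul_mem' := by
    intro c x hx f hf
    have := congrArg (c * ·) (hx f hf)
    simpa [Finset.mul_sum, mul_left_comm] using this

/-! ### Root data -/

/-- The elements `(1 c; 0 1)` of `SL₂`. -/
def slUpper (c : k) : SL(2, k) := ⟨!![1, c; 0, 1], by simp [Matrix.det_fin_two]⟩

/-- The elements `(1 0; c 1)` of `SL₂`. -/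
def slLower (c : k) : SL(2, k) := ⟨!![1, 0; c, 1], by simp [Matrix.det_fin_two]⟩

/-- The elements `diag(s, s⁻¹)` of `SL₂`. -/
def slDiag (s : kˣ) : SL(2, k) :=
  ⟨!![(s : k), 0; 0, ((s⁻¹ : kˣ) : k)], by simp [Matrix.det_fin_two]⟩

/-- The (split) torus over `k` with character group `X`. -/
abbrev SplitTorus (k : Type*) [Field k] (X : Type*) [AddCommGroup X] : Type _ :=
  Multiplicative X →* kˣ

/-- The value of the character `x` at an element of the torus. -/
def charValue {X : Type*} [AddCommGroup X] (t : SplitTorus k X) (x : X) : k :=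
  (t (Multiplicative.ofAdd x) : k)

/-- For `y` in the dual lattice, the value at `s` of the cocharacter `y`: the torus element on which
each character `x` takes the value `s ^ ⟨x, y⟩`. -/
def cocharValue {ι X Y : Type*} [AddCommGroup X] [AddCommGroup Y] (P : RootDatum ι X Y) (y : Y)
    (s : kˣ) : SplitTorus k X where
  toFun x := s ^ P.toLinearMap (Multiplicative.toAdd x) y
  map_one' := by simp
  map_mul' a b := by simp [zpow_add]

/-- `(X, Φ, Y, Φ^∨) = P` is the root datum of the group `G` with respect to a torus `T` of `G`.
* `torus` is an isomorphism of algebraic groups from the torus with character group `X` onto `T`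
  (it identifies `X` with the characters of `T`, and `Y` with the cocharacters).
* For each root `α`, `sl α : SL₂ → G` is a morphism of algebraic groups such that
  `c ↦ sl α (1 c; 0 1)` and `c ↦ sl α (1 0; c 1)` are root homomorphisms for `α` and `-α`
  and such that `s ↦ sl α (diag(s, s⁻¹))` is the coroot of `α`.
* The Lie algebra of `G` is spanned by the one of `T` and, for each root `α`, by the nonzero
  derivative `rootVector α` at `0` of the root homomorphism. So `T` is a maximal torus and the roots
  are precisely the nonzero weights of `T` on the Lie algebra. -/
structure HasRootDatum (G : Subgroup (GL (Fin n) k)) {ι X Y : Type*} [AddCommGroup X]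
    [AddCommGroup Y] (P : RootDatum ι X Y) where
  torus : SplitTorus k X →* GL (Fin n) k
  torus_mem : ∀ t, torus t ∈ G
  torus_regular : ∀ a b, ∃ c : X →₀ k, ∀ t,
    (torus t : Matrix (Fin n) (Fin n) k) a b = c.sum fun x r => r * charValue t x
  torus_regular_inv : ∀ x : X, ∃ q : MvPolynomial (Coord n) k, ∀ t,
    charValue t x = evalReg q (torus t)
  sl : ι → SL(2, k) →* GL (Fin n) k
  sl_mem : ∀ α g, sl α g ∈ G
  sl_regular : ∀ α a b, ∃ q : MvPolynomial (Fin 2 × Fin 2) k, ∀ g : SL(2, k),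
    (sl α g : Matrix (Fin n) (Fin n) k) a b = MvPolynomial.eval (fun ij => g.1 ij.1 ij.2) q
  sl_diag : ∀ α s, sl α (slDiag s) = torus (cocharValue P (P.coroot α) s)
  torus_upper : ∀ α t c, torus t * sl α (slUpper c) * (torus t)⁻¹ =
    sl α (slUpper (charValue t (P.root α) * c))
  torus_lower : ∀ α t c, torus t * sl α (slLower c) * (torus t)⁻¹ =
    sl α (slLower (charValue t (-P.root α) * c))
  /-- the root homomorphism of `α`, as a matrix of polynomials -/
  rootPoly : ι → Matrix (Fin n) (Fin n) (Polynomial k)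
  rootPoly_eval : ∀ α c, (sl α (slUpper c) : Matrix (Fin n) (Fin n) k) =
    (rootPoly α).map (Polynomial.eval c)
  rootVector_ne_zero : ∀ α, (rootPoly α).map (fun f => f.coeff 1) ≠ 0
  lieAlgebra_eq : lieAlgebra G = lieAlgebra torus.range ⊔
    Submodule.span k (Set.range fun α => (rootPoly α).map (fun f => f.coeff 1))

end General

/-- The Cartan matrix of the root datum `P`, for some base and some numbering of its elements,
is `A`. -/
def HasCartanMatrix {ι X Y : Type*} [AddCommGroup X] [AddCommGroup Y] (P : RootDatum ι X Y)
    {l : ℕ} (A : Matrix (Fin l) (Fin l) ℤ) : Prop :=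
  ∃ (b : P.Base) (e : Fin l ≃ b.support), ∀ i j, P.pairing (e i) (e j) = A i j

/-- The root system of `P` has type `B_l` or `C_l` (for some `l ≥ 1`, where `B₁ = C₁ = A₁`)
or `E₇`. -/
def IsTypeBCE7 {ι X Y : Type*} [AddCommGroup X] [AddCommGroup Y] (P : RootDatum ι X Y) : Prop :=
  (∃ l : ℕ, 1 ≤ l ∧ HasCartanMatrix P (CartanMatrix.B l)) ∨
  (∃ l : ℕ, 1 ≤ l ∧ HasCartanMatrix P (CartanMatrix.C l)) ∨
  HasCartanMatrix P CartanMatrix.E₇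

/-- The root datum of a simply connected group: the coroots generate the cocharacter lattice. -/
def IsSimplyConnectedDatum {ι X Y : Type*} [AddCommGroup X] [AddCommGroup Y]
    (P : RootDatum ι X Y) : Prop :=
  Submodule.span ℤ (Set.range P.coroot) = ⊤

/-! ### Fixed points of endomorphisms -/

/-- The group of fixed points of the endomorphism `F`. -/
def fixedPts {H : Type*} [Group H] (F : Monoid.End H) : Subgroup H where
  carrier := {g | F g = g}
  one_mem' := map_one F
  mul_mem' {a b} ha hb := by
    have ha : F a = a := ha
    have hb : F b = b := hb
    change F (a * b) = a * b
    rw [map_mul, ha, hb]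
  inv_mem' {a} ha := by
    have ha : F a = a := ha
    change F a⁻¹ = a⁻¹
    rw [map_inv, ha]

/-- The homomorphism that `F ^ a` induces on the fixed points of `F ^ m`. -/
def powHom {H : Type*} [Group H] (F : Monoid.End H) (a m : ℕ) :
    fixedPts (F ^ m) →* fixedPts (F ^ m) where
  toFun g := ⟨(F ^ a) g, by
    have hg : (F ^ m) (g : H) = g := g.2
    change (F ^ m * F ^ a) (g : H) = (F ^ a) g
    rw [← pow_add, add_comm, pow_add]
    change (F ^ a) ((F ^ m) (g : H)) = (F ^ a) g
    rw [hg]⟩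
  map_one' := by ext; simp
  map_mul' x y := by ext; simp

theorem powHom_bijective {H : Type*} [Group H] (F : Monoid.End H) {a m : ℕ} (hm : 0 < m)
    (ha : a ∣ m) : Function.Bijective (powHom F a m) := by
  obtain ⟨c, rfl⟩ := ha
  obtain ⟨d, rfl⟩ : ∃ d, c = d + 1 := ⟨c - 1, by
    rcases Nat.eq_zero_or_pos c with rfl | h
    · simp at hm
    · omega⟩
  have h1 : F ^ (a * (d + 1)) = F ^ (a * d) * F ^ a := by rw [← pow_add]; ring_nf
  have h2 : F ^ (a * (d + 1)) = F ^ a * F ^ (a * d) := by rw [← pow_add]; ring_nf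
  constructor
  · intro x y hxy
    have hx : (F ^ (a * (d + 1))) (x : H) = x := x.2
    have hy : (F ^ (a * (d + 1))) (y : H) = y := y.2
    have h : (F ^ a) (x : H) = (F ^ a) (y : H) := congrArg Subtype.val hxy
    apply Subtype.ext
    have key : ∀ z : H, (F ^ (a * (d + 1))) z = (F ^ (a * d)) ((F ^ a) z) := by
      intro z
      rw [h1]
      rfl
    rw [← hx, ← hy, key, key, h]
  · intro y
    have hy : (F ^ (a * (d + 1))) (y : H) = y := y.2
    refine ⟨powHom F (a * d) _ y, Subtype.ext ?_⟩
    change (F ^ a * F ^ (a * d)) (y : H) = y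
    rw [← h2]
    exact hy

/-- For `a ∣ m`, the automorphism that `F ^ a` induces on the fixed points of `F ^ m`. -/
def powAut {H : Type*} [Group H] (F : Monoid.End H) {a m : ℕ} (hm : 0 < m) (ha : a ∣ m) :
    MulAut (fixedPts (F ^ m)) :=
  MulEquiv.ofBijective (powHom F a m) (powHom_bijective F hm ha)

/-! ### Characters of finite groups -/

/-- The set of irreducible complex characters of `H`. -/
def Irr (H : Type*) [Group H] : Set (H → ℂ) :=
  {χ | ∃ (V : Type) (_ : AddCommGroup V) (_ : Module ℂ V) (_ : FiniteDimensional ℂ V)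
    (ρ : Representation ℂ H V), ρ.IsIrreducible ∧ ρ.character = χ}

/-- The character `χ ^ σ`, with `χ ^ σ (σ g) = χ g`. -/
def conjChar {H : Type*} [Group H] (χ : H → ℂ) (σ : MulAut H) : H → ℂ :=
  fun g => χ (σ⁻¹ g)

/-- The number of `σ`-invariant conjugacy classes of `H`. -/
def invariantClasses {H : Type*} [Group H] (σ : MulAut H) : ℕ :=
  Nat.card {C : ConjClasses H // ConjClasses.map (σ : H →* H) C = C}

/-- The orbit of `χ` under multiplication with the linear characters of `H / N`. -/
def linOrbit {H : Type*} [Group H] (N : Subgroup H) (χ : H → ℂ) : Set (H → ℂ) :=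
  {ψ | ∃ μ : H →* ℂˣ, N ≤ μ.ker ∧ ψ = fun g => (μ g : ℂ) * χ g}

/-- The number of irreducible characters of `H` that lie in a `σ`-stable `Irr (H / N)`-orbit of
length `|H : N|`. -/
def stableFullOrbitChars {H : Type*} [Group H] (N : Subgroup H) (σ : MulAut H) : ℕ :=
  Nat.card {χ : H → ℂ // χ ∈ Irr H ∧ (linOrbit N χ).ncard = N.index ∧
    (fun ψ => conjChar ψ σ) '' linOrbit N χ = linOrbit N χ}

/-! ### The finite groups and diagonal automorphisms -/

section Finite

variable {A B : Type*} [Group A] [Group B]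

/-- The image of the fixed points of `F` under `f : A → B`, as a subgroup of the fixed points
of `Ft`. -/
def finiteImage (f : A →* B) (F : Monoid.End A) (Ft : Monoid.End B) : Subgroup (fixedPts Ft) :=
  ((fixedPts F).map f).subgroupOf (fixedPts Ft)

/-- `δ` is a non-interior diagonal automorphism of `A^F`: it is induced by conjugation with an element
of `B^Ft` outside `A^F C(A^F)`, where `A^F` is viewed inside `B^Ft` through `f`. -/
def IsNoninteriorDiagonal (f : A →* B) (F : Monoid.End A) (Ft : Monoid.End B)
    (δ : MulAut (fixedPts F)) : Prop :=
  ∃ x : fixedPts Ft,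
    x ∉ finiteImage f F Ft ⊔ Subgroup.centralizer (finiteImage f F Ft : Set (fixedPts Ft)) ∧
    ∀ g : fixedPts F, f (δ g : A) = (x : B) * f (g : A) * (x : B)⁻¹

end Finite

end LinAlgGroup

end

/-! Let `A = G^F` and let `H` be the fixed points of the larger group. Let `N` be the image of `A`
in `H`, and `Z` the fixed points in the centre of the larger algebraic group. Everything rests on
one fact: `N Z` has index at most two in `H`. Given this, the equivalence holds for each pair `(δ,
F₁)` separately, by character theory.

The automorphism `δ` is conjugation by some `x` outside `N Z`, so `δ²` fixes all irreducible
characters. Brauer's permutation lemma (`invariantClasses_eq_card`) then identifies `c(δ, F₁)` with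
the size of the set `S` of all `χ` in `Irr A` such that `χ^F₁ = χ^δ`. On the other side, a linear
character of `H / N` that fixes some `ψ` in `Irr H` is trivial on `N Z`, so stabilizers have order
at most two. The order of the stabilizer is the norm of the restriction of `ψ`. If `ψ` lies over an
`H`-invariant `χ`, this norm is the square `e²` of a multiplicity, so `e = 1` and `χ` extends
(`exists_irr_comp_eq`). Restriction therefore matches the orbits of full length with the invariant
characters of `A`. Invariance under `H` is invariance under `δ`, because `H` is the union of `N Z`
and `N Z x`. Thus `d / |H : N|` is the size of the set `E` of all `χ` fixed by both `F₁` and `δ`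
(`stableFullOrbitChars_eq`). Always `E ⊆ S`, so equal cardinality means `S ⊆ E`, which is the second
statement (`invariantClasses_eq_iff`).

For the index, write an element of `H` as `g z` with `g` in `G` and `z` central. Then `g⁻¹ F(g)`
lies in the centre of `G`, and if that centre has at most one nontrivial element, any two elements
outside `N Z` agree modulo `N Z` (`mul_inv_mem_range_sup_fixedCenter`). To bound the centre, one
shows that a central element lies in the torus and is killed by all roots
(`exists_torus_eq_of_forall_commute`). As the simple coroots form a basis of the cocharacter
lattice, such torus elements are the solutions in `kˣ` of the linear system of the Cartan matrix.
For types `B`, `C` and `E₇` a solution is determined by one `ε` with `ε² = 1`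
(`torus_eq_of_root_eq_one`).

That the torus contains the centre comes from density of the big cell `U⁻ T U⁺`: polynomials
vanishing there vanish on `G` (`eval_eq_zero_of_curves`). Regular functions on the connected group
`G` form a domain, and a nonzero one has at `1` a leading form that is not identically zero on the
tangent space. So it cannot vanish along curves realizing all tangent vectors, and the big cell
supplies these because the Lie algebra is spanned by the torus and the root vectors. In a basis of
weight vectors, suitable minors on the big cell depend on the torus factor only. The resulting
polynomial identities force elements that commute with the torus into it. -/

namespace LinAlgGroup

/-! ### Irreducible characters of finite groups -/

section Characters

open Representation MonoidAlgebra

variable {H : Type} [Group H] [Finite H]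

/-- The scalar product of functions on a finite group for which the irreducible characters are
orthonormal. It is bilinear, and agrees with the usual sesquilinear one on characters. -/
noncomputable def charInner (f g : H → ℂ) : ℂ :=
  let _ := Fintype.ofFinite H
  (Nat.card H : ℂ)⁻¹ * ∑ h, f h * g h⁻¹

theorem charInner_eq [Fintype H] (f g : H → ℂ) :
    charInner f g = (Nat.card H : ℂ)⁻¹ * ∑ h, f h * g h⁻¹ := by
  unfold charInner
  congr!

theorem natCard_ne_zero' : (Nat.card H : ℂ) ≠ 0 := by
  exact_mod_cast (Nat.card_pos (α := H)).ne'

theorem charInner_comm (f g : H → ℂ) : charInner f g = charInner g f := by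
  let _ := Fintype.ofFinite H
  rw [charInner_eq, charInner_eq, ← Equiv.sum_comp (Equiv.inv H)]
  simp [mul_comm]

theorem charInner_sum_left {ι : Type*} (s : Finset ι) (f : ι → H → ℂ) (g : H → ℂ) :
    charInner (∑ i ∈ s, f i) g = ∑ i ∈ s, charInner (f i) g := by
  let _ := Fintype.ofFinite H
  simp only [charInner_eq, ← Finset.mul_sum, Finset.sum_apply, Finset.sum_mul]
  rw [Finset.sum_comm]

theorem charInner_smul_left (c : ℂ) (f g : H → ℂ) :
    charInner (c • f) g = c * charInner f g := by
  let _ := Fintype.ofFinite H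
  simp only [charInner_eq, Pi.smul_apply, smul_eq_mul, Finset.mul_sum]
  refine Finset.sum_congr rfl fun h _ => by ring

theorem irr_orthonormal {χ ψ : H → ℂ} (hχ : χ ∈ Irr H) (hψ : ψ ∈ Irr H) [Decidable (χ = ψ)] :
    charInner χ ψ = if χ = ψ then 1 else 0 := by
  let _ := Fintype.ofFinite H
  let _ : Invertible (Nat.card H : ℂ) := invertibleOfNonzero natCard_ne_zero'
  have self : ∀ (V : Type) [AddCommGroup V] [Module ℂ V] [FiniteDimensional ℂ V]
      (ρ : Representation ℂ H V) [ρ.IsIrreducible], charInner ρ.character ρ.character = 1 := by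
    intro V _ _ _ ρ _
    rw [charInner_eq, char_orthonormal ρ ρ, if_pos ⟨Representation.Equiv.refl ρ⟩]
  obtain ⟨V, _, _, _, ρ, hρ, rfl⟩ := hχ
  obtain ⟨W, _, _, _, σ, hσ, rfl⟩ := hψ
  split_ifs with h
  · rw [← h]; exact self V ρ
  · rw [charInner_eq, char_orthonormal ρ σ, if_neg]
    rintro ⟨e⟩
    exact h (char_iso e).symm

theorem irr_linearIndependent :
    LinearIndependent ℂ (fun χ : Irr H => (χ : H → ℂ)) := by
  classical
  rw [linearIndependent_iff']
  intro s g hg i hi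
  have := congrArg (charInner · (i : H → ℂ)) hg
  simp only [charInner_sum_left, charInner_smul_left] at this
  rw [Finset.sum_eq_single i] at this
  · rw [irr_orthonormal i.2 i.2] at this
    have h0 : charInner (0 : H → ℂ) i = 0 := by
      let _ := Fintype.ofFinite H
      simp [charInner_eq]
    rw [h0] at this
    simpa using this
  · intro j _ hj
    rw [irr_orthonormal j.2 i.2, if_neg (fun h => hj (Subtype.ext h)), mul_zero]
  · exact fun h => absurd hi h

instance : Finite (Irr H) := (irr_linearIndependent (H := H)).finite

noncomputable instance : Fintype (Irr H) := Fintype.ofFinite _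

/-- Class functions: functions that are constant on conjugacy classes. -/
def IsClassFun {H : Type*} [Group H] (f : H → ℂ) : Prop := ∀ g h : H, f (g * h * g⁻¹) = f h

omit [Finite H] in
theorem isClassFun_irr {χ : H → ℂ} (hχ : χ ∈ Irr H) : IsClassFun χ := by
  obtain ⟨V, _, _, _, ρ, hρ, rfl⟩ := hχ
  exact fun g h => char_conj ρ h g

/-- Schur's lemma: since `f` is a class function the operator commutes with `ρ`, hence is a scalar.
Its trace is a multiple of the vanishing scalar product, and the dimension is nonzero in `ℂ`. -/
theorem sum_smul_eq_zero_of_orthogonal [Fintype H] {f : H → ℂ} (hf : IsClassFun f)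
    {V : Type} [AddCommGroup V] [Module ℂ V] [FiniteDimensional ℂ V]
    (ρ : Representation ℂ H V) [hρ : ρ.IsIrreducible]
    (h0 : charInner f ρ.character = 0) : ∑ h, f h • ρ h⁻¹ = 0 := by
  let T : IntertwiningMap ρ ρ :=
    { toLinearMap := ∑ h, f h • ρ h⁻¹
      isIntertwining' := by
        intro g
        ext v
        simp only [LinearMap.comp_apply, LinearMap.sum_apply, LinearMap.smul_apply, map_sum,
          map_smul]
        rw [← Equiv.sum_comp (MulAut.conj g).toEquiv]
        refine Finset.sum_congr rfl fun h _ => ?_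
        simp only [MulEquiv.toEquiv_eq_coe, EquivLike.coe_coe, MulAut.conj_apply, hf g h]
        congr 1
        simp only [← Module.End.mul_apply, ← map_mul]
        congr 2
        group }
  obtain ⟨c, hc⟩ := IsIrreducible.algebraMap_intertwiningMap_bijective_of_isAlgClosed.2 T
  have hT : (∑ h, f h • ρ h⁻¹ : V →ₗ[ℂ] V) = c • LinearMap.id := by
    change T.toLinearMap = _
    rw [← hc]
    rfl
  have htr : LinearMap.trace ℂ V (∑ h, f h • ρ h⁻¹) = 0 := by
    rw [map_sum]
    simp only [map_smul, smul_eq_mul]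
    rw [charInner_eq] at h0
    exact (mul_eq_zero.1 h0).resolve_left (inv_ne_zero natCard_ne_zero')
  rw [hT] at htr ⊢
  rw [map_smul, LinearMap.trace_id, smul_eq_mul, mul_eq_zero] at htr
  have : c = 0 := by
    refine htr.resolve_right ?_
    have : Nontrivial V := by
      have := IsSimpleModule.nontrivial ℂ[H] ρ.asModule
      exact this
    exact_mod_cast (Module.finrank_pos (R := ℂ) (M := V)).ne'
  rw [this, zero_smul]

/-- The same vanishing for simple modules over the group algebra, the form in which Maschke's
theorem can be applied to the regular module. -/
theorem groupAlgebra_smul_eq_zero [Fintype H] {f : H → ℂ} (hf : IsClassFun f)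
    (h0 : ∀ χ ∈ Irr H, charInner f χ = 0) (M : Type) [AddCommGroup M] [Module ℂ[H] M]
    [hS : IsSimpleModule ℂ[H] M] (v : M) :
    (∑ h, MonoidAlgebra.single h⁻¹ (f h) : ℂ[H]) • v = 0 := by
  let _ : Module ℂ M := Module.compHom M (algebraMap ℂ ℂ[H])
  have : IsScalarTower ℂ ℂ[H] M := ⟨fun c a x => by
    rw [Algebra.smul_def, mul_smul]
    rfl⟩
  have hsingle : ∀ (h : H) (c : ℂ), MonoidAlgebra.single h c = c • MonoidAlgebra.single h (1 : ℂ) :=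
    fun h c => by rw [MonoidAlgebra.smul_single, smul_eq_mul, mul_one]
  let ρ : Representation ℂ H M :=
    { toFun := fun h =>
        { toFun := fun x => MonoidAlgebra.single h (1 : ℂ) • x
          map_add' := fun x y => smul_add _ x y
          map_smul' := fun c x => by
            rw [RingHom.id_apply, ← algebraMap_smul ℂ[H] c x, ← mul_smul, ← Algebra.commutes,
              mul_smul, algebraMap_smul] }
      map_one' := by
        ext x
        exact one_smul ℂ[H] x
      map_mul' := fun g h => by
        ext x
        change MonoidAlgebra.single (g * h) (1 : ℂ) • x =
          MonoidAlgebra.single g (1 : ℂ) • MonoidAlgebra.single h (1 : ℂ) • x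
        rw [← mul_smul, MonoidAlgebra.single_mul_single, one_mul] }
  have hρ : ρ.IsIrreducible := by
    have hM : Nontrivial M := IsSimpleModule.nontrivial ℂ[H] M
    refine { exists_pair_ne := ⟨⊥, ⊤, fun h => ?_⟩, eq_bot_or_eq_top := fun W => ?_ }
    · obtain ⟨x, hx⟩ := exists_ne (0 : M)
      have : x ∈ (⊤ : Subrepresentation ρ).toSubmodule := Submodule.mem_top
      rw [← h] at this
      exact hx this
    · let W' : Submodule ℂ[H] M :=
        { W.toSubmodule.toAddSubmonoid with
          smul_mem' := fun a x hx => by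
            induction a using MonoidAlgebra.induction_linear with
            | zero => rw [zero_smul]; exact W.toSubmodule.zero_mem
            | add a b ha hb => rw [add_smul]; exact W.toSubmodule.add_mem ha hb
            | single h c =>
              rw [hsingle, smul_assoc]
              exact W.toSubmodule.smul_mem c (W.apply_mem_toSubmodule h hx) }
      refine (eq_bot_or_eq_top W').imp (fun h => ?_) fun h => ?_
      · apply Subrepresentation.toSubmodule_injective
        ext x
        exact SetLike.ext_iff.1 h x
      · apply Subrepresentation.toSubmodule_injective
        ext x
        exact SetLike.ext_iff.1 h x
  have : FiniteDimensional ℂ M := Module.Finite.trans ℂ[H] M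
  have hz := sum_smul_eq_zero_of_orthogonal hf ρ (h0 _ ⟨_, _, _, inferInstance, ρ, hρ, rfl⟩)
  have h1 := congrArg (fun T => T v) hz
  simp only [LinearMap.sum_apply, LinearMap.smul_apply, LinearMap.zero_apply] at h1
  rw [Finset.sum_smul, ← h1]
  refine Finset.sum_congr rfl fun h _ => ?_
  rw [hsingle, smul_assoc]
  rfl

/-- By Maschke's theorem the regular module is generated by simple submodules, each killed by `a`.
Hence `a = a * 1 = 0`, and the coefficients of `a` are the values of `f`. -/
theorem eq_zero_of_orthogonal {f : H → ℂ} (hf : IsClassFun f)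
    (h0 : ∀ χ ∈ Irr H, charInner f χ = 0) : f = 0 := by
  classical
  let _ := Fintype.ofFinite H
  have : NeZero (Nat.card H : ℂ) := ⟨natCard_ne_zero'⟩
  set a : ℂ[H] := ∑ h, MonoidAlgebra.single h⁻¹ (f h) with ha
  have key : ∀ S : Submodule ℂ[H] ℂ[H], IsSimpleModule ℂ[H] S → ∀ v ∈ S, a • v = 0 :=
    fun S hS v hv => congrArg Subtype.val (groupAlgebra_smul_eq_zero hf h0 S ⟨v, hv⟩)
  have hall : ∀ v : ℂ[H], a • v = 0 := by
    let K : Submodule ℂ[H] ℂ[H] := sSup {S | IsSimpleModule ℂ[H] S}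
    have hK : K = ⊤ := IsSemisimpleModule.sSup_simples_eq_top ℂ[H] ℂ[H]
    intro v
    have hv : v ∈ K := hK ▸ Submodule.mem_top
    simp only [K, sSup_eq_iSup'] at hv
    induction hv using Submodule.iSup_induction' with
    | mem S x hx => exact key S S.2 x hx
    | zero => exact smul_zero _
    | add x y _ _ hx hy => rw [smul_add, hx, hy, add_zero]
  have h1 := hall 1
  rw [smul_eq_mul, mul_one] at h1
  funext h
  have h2 := congrArg (fun b : ℂ[H] => b.coeff h⁻¹) h1
  simpa [ha, Finsupp.single_apply, Finset.sum_ite_eq'] using h2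

theorem classFun_expansion {f : H → ℂ} (hf : IsClassFun f) :
    f = ∑ χ : Irr H, charInner f χ • (χ : H → ℂ) := by
  classical
  let _ := Fintype.ofFinite H
  rw [← sub_eq_zero]
  apply eq_zero_of_orthogonal
  · intro g h
    simp only [Pi.sub_apply, Finset.sum_apply, Pi.smul_apply, hf g h]
    congr 1
    exact Finset.sum_congr rfl fun χ _ => by rw [isClassFun_irr χ.2]
  · intro ψ hψ
    have hsub : ∀ u v : H → ℂ, charInner (u - v) ψ = charInner u ψ - charInner v ψ := by
      intro u v
      simp [charInner_eq, sub_mul, mul_sub]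
    rw [hsub, charInner_sum_left, Finset.sum_eq_single ⟨ψ, hψ⟩]
    · rw [charInner_smul_left, irr_orthonormal hψ hψ]
      simp
    · intro χ _ hχ
      rw [charInner_smul_left, irr_orthonormal χ.2 hψ, if_neg (fun h => hχ (Subtype.ext h)),
        mul_zero]
    · simp

theorem charInner_parseval {f : H → ℂ} (hf : IsClassFun f) (g : H → ℂ) :
    charInner f g = ∑ χ : Irr H, charInner f χ * charInner χ g := by
  conv_lhs => rw [classFun_expansion hf]
  simp [charInner_sum_left, charInner_smul_left]

end Characters

/-! ### Operations on irreducible characters, second orthogonality and Brauer's permutation lemma -/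

section CharacterOperations

open Representation

/-- The multiplicity is the dimension of a space of intertwining maps. -/
theorem charInner_comp_natCast {A H : Type} [Group A] [Finite A] [Group H] (i : A →* H)
    {ψ : H → ℂ} {χ : A → ℂ} (hψ : ψ ∈ Irr H) (hχ : χ ∈ Irr A) :
    ∃ e : ℕ, charInner (ψ ∘ i) χ = e := by
  let _ := Fintype.ofFinite A
  let _ : Invertible (Nat.card A : ℂ) := invertibleOfNonzero natCard_ne_zero'
  obtain ⟨V, _, _, _, ρ, hρ, rfl⟩ := hψ
  obtain ⟨W, _, _, _, σ, hσ, rfl⟩ := hχ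
  refine ⟨Module.finrank ℂ (IntertwiningMap σ (ρ.comp i)), ?_⟩
  rw [charInner_eq, ← card_inv_mul_sum_char_mul_char_eq_finrank]
  rfl

/-- Irreducibility only depends on the family of stable subspaces. -/
theorem isIrreducible_of_invariant_iff {G H V : Type*} [Group G] [Group H] [AddCommGroup V]
    [Module ℂ V] {ρ : Representation ℂ H V} {σ : Representation ℂ G V}
    (h : ∀ W : Submodule ℂ V, (∀ g, ∀ v ∈ W, ρ g v ∈ W) ↔ (∀ g, ∀ v ∈ W, σ g v ∈ W))
    (hρ : ρ.IsIrreducible) : σ.IsIrreducible := by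
  let e : Subrepresentation ρ ≃o Subrepresentation σ :=
    { toFun := fun W => ⟨W.toSubmodule, fun g v hv =>
        (h W.toSubmodule).1 (fun g v hv => W.apply_mem_toSubmodule g hv) g v hv⟩
      invFun := fun W => ⟨W.toSubmodule, fun g v hv =>
        (h W.toSubmodule).2 (fun g v hv => W.apply_mem_toSubmodule g hv) g v hv⟩
      left_inv := fun _ => rfl
      right_inv := fun _ => rfl
      map_rel_iff' := Iff.rfl }
  exact e.symm.isSimpleOrder

theorem conjChar_mem_irr {H : Type} [Group H] {χ : H → ℂ} (hχ : χ ∈ Irr H) (σ : MulAut H) :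
    conjChar χ σ ∈ Irr H := by
  obtain ⟨V, _, _, _, ρ, hρ, rfl⟩ := hχ
  refine ⟨V, _, _, inferInstance, ρ.comp (σ⁻¹ : MulAut H).toMonoidHom, ?_, rfl⟩
  refine isIrreducible_of_invariant_iff (fun W => ⟨fun h g v hv => h _ v hv, fun h g v hv => ?_⟩)
    (ρ := ρ) hρ
  have := h (σ g) v hv
  rwa [show (ρ.comp (σ⁻¹ : MulAut H).toMonoidHom) (σ g) = ρ (σ⁻¹ (σ g)) from rfl,
    MulAut.inv_apply_self] at this

theorem mul_mem_irr {H : Type} [Group H] {χ : H → ℂ} (hχ : χ ∈ Irr H) (μ : H →* ℂˣ) :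
    (fun g => (μ g : ℂ) * χ g) ∈ Irr H := by
  obtain ⟨V, _, _, _, ρ, hρ, rfl⟩ := hχ
  let σ : Representation ℂ H V :=
    { toFun := fun g => (μ g : ℂ) • ρ g
      map_one' := by simp
      map_mul' := fun g h => by
        ext v
        simp [mul_smul, smul_comm (μ h : ℂ)] }
  refine ⟨V, _, _, inferInstance, σ, ?_, ?_⟩
  · refine isIrreducible_of_invariant_iff
      (fun W => ⟨fun h g v hv => W.smul_mem _ (h _ v hv), fun h g v hv => ?_⟩) hρ
    have h1 : ρ g v = ((μ g)⁻¹ : ℂˣ) • σ g v := by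
      change ρ g v = ((μ g)⁻¹ : ℂˣ) • ((μ g : ℂ) • ρ g v)
      rw [Units.smul_def, smul_smul, Units.inv_mul, one_smul]
    rw [h1, Units.smul_def]
    exact W.smul_mem _ (h g v hv)
  · funext g
    change LinearMap.trace ℂ V ((μ g : ℂ) • ρ g) = _
    rw [map_smul]
    rfl

theorem irr_one_ne_zero {H : Type} [Group H] {χ : H → ℂ} (hχ : χ ∈ Irr H) : χ 1 ≠ 0 := by
  obtain ⟨V, _, _, _, ρ, hρ, rfl⟩ := hχ
  have : Nontrivial V := by
    have := IsSimpleModule.nontrivial (MonoidAlgebra ℂ H) ρ.asModule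
    exact this
  rw [char_one]
  exact_mod_cast (Module.finrank_pos (R := ℂ) (M := V)).ne'

/-- A central element acts by a nonzero scalar in an irreducible representation. -/
theorem irr_apply_ne_zero_of_mem_center {H : Type} [Group H] {χ : H → ℂ} (hχ : χ ∈ Irr H) {z : H}
    (hz : z ∈ Subgroup.center H) : χ z ≠ 0 := by
  have h1 := irr_one_ne_zero hχ
  obtain ⟨V, _, _, _, ρ, hρ, rfl⟩ := hχ
  let T : IntertwiningMap ρ ρ :=
    { toLinearMap := ρ z
      isIntertwining' := fun g => by
        rw [← Module.End.mul_eq_comp, ← Module.End.mul_eq_comp, ← map_mul, ← map_mul,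
          Subgroup.mem_center_iff.1 hz g] }
  obtain ⟨c, hc⟩ := IsIrreducible.algebraMap_intertwiningMap_bijective_of_isAlgClosed.2 T
  have hT : ρ z = c • LinearMap.id := by
    change T.toLinearMap = _
    rw [← hc]
    rfl
  have hc0 : c ≠ 0 := by
    rintro rfl
    rw [zero_smul] at hT
    apply h1
    rw [← mul_inv_cancel z, character, map_mul, hT, zero_mul, map_zero]
  rw [character, hT, map_smul, LinearMap.trace_id, smul_eq_mul]
  refine mul_ne_zero hc0 ?_
  rwa [char_one] at h1

/-- The second orthogonality relation. -/
theorem sum_irr_mul_irr_inv {H : Type} [Group H] [Finite H] (a b : H) [Decidable (IsConj b a)] :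
    ∑ χ : Irr H, (χ : H → ℂ) a * (χ : H → ℂ) b⁻¹ =
      if IsConj b a then (Nat.card H : ℂ) / Nat.card {h : H // IsConj b h} else 0 := by
  classical
  let _ := Fintype.ofFinite H
  -- The indicator function of the class of `b`; the relation is its expansion in irreducible
  -- characters, evaluated at `a`.
  let f : H → ℂ := fun h => if IsConj b h then 1 else 0
  have hf : IsClassFun f := by
    intro g h
    have : IsConj b (g * h * g⁻¹) ↔ IsConj b h :=
      ⟨fun H => H.trans (isConj_iff.2 ⟨g⁻¹, by group⟩), fun H => H.trans (isConj_iff.2 ⟨g, rfl⟩)⟩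
    simp only [f, this]
  have hcard : (Nat.card {h : H // IsConj b h} : ℂ) ≠ 0 := by
    have : Nonempty {h : H // IsConj b h} := ⟨⟨b, IsConj.refl b⟩⟩
    exact_mod_cast (Nat.card_pos (α := {h : H // IsConj b h})).ne'
  have hin : ∀ χ : Irr H, charInner f χ =
      (Nat.card H : ℂ)⁻¹ * (Nat.card {h : H // IsConj b h} * (χ : H → ℂ) b⁻¹) := by
    intro χ
    rw [charInner_eq]
    congr 1
    simp only [f, ite_mul, one_mul, zero_mul]
    rw [← Finset.sum_filter, Finset.sum_congr rfl (g := fun _ => (χ : H → ℂ) b⁻¹),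
      Finset.sum_const, nsmul_eq_mul]
    · rw [Nat.card_eq_fintype_card, Fintype.card_subtype]
    · intro h hh
      obtain ⟨c, rfl⟩ := isConj_iff.1 (Finset.mem_filter.1 hh).2
      rw [← isClassFun_irr χ.2 c b⁻¹]
      group
  have h1 := congrFun (classFun_expansion hf) a
  simp only [Finset.sum_apply, Pi.smul_apply, smul_eq_mul, hin] at h1
  have h2 : ∑ χ : Irr H, (χ : H → ℂ) a * (χ : H → ℂ) b⁻¹ =
      (Nat.card H : ℂ) / Nat.card {h : H // IsConj b h} * f a := by
    rw [h1, Finset.mul_sum]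
    refine Finset.sum_congr rfl fun χ _ => ?_
    field_simp [natCard_ne_zero' (H := H)]
  rw [h2]
  simp [f]

/-- Brauer's permutation lemma. -/
theorem invariantClasses_eq_card {H : Type} [Group H] [Finite H] (σ : MulAut H) :
    invariantClasses σ = Nat.card {χ : Irr H // conjChar (χ : H → ℂ) σ = χ} := by
  classical
  let _ := Fintype.ofFinite H
  let _ : Fintype (ConjClasses H) := Fintype.ofFinite _
  -- Both counts equal the sum of `1 / |class of h|` over the `h` conjugate to `σ⁻¹ h`. For
  -- characters this is first and then second orthogonality; for classes, each invariant class
  -- contributes exactly `1`.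
  have h1 : (Nat.card {χ : Irr H // conjChar (χ : H → ℂ) σ = χ} : ℂ) =
      ∑ χ : Irr H, charInner (conjChar (χ : H → ℂ) σ) χ := by
    rw [Nat.card_eq_fintype_card, Fintype.card_subtype, Finset.card_filter, Nat.cast_sum]
    refine Finset.sum_congr rfl fun χ _ => ?_
    rw [irr_orthonormal (conjChar_mem_irr χ.2 σ) χ.2]
    simp
  have h2 : ∑ χ : Irr H, charInner (conjChar (χ : H → ℂ) σ) χ =
      ∑ h : H, if IsConj h (σ⁻¹ h) then (Nat.card {g : H // IsConj h g} : ℂ)⁻¹ else 0 := by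
    simp only [charInner_eq, ← Finset.mul_sum]
    rw [Finset.sum_comm, Finset.mul_sum]
    refine Finset.sum_congr rfl fun h _ => ?_
    rw [show ∑ χ : Irr H, conjChar (χ : H → ℂ) σ h * (χ : H → ℂ) h⁻¹ =
      ∑ χ : Irr H, (χ : H → ℂ) (σ⁻¹ h) * (χ : H → ℂ) h⁻¹ from rfl, sum_irr_mul_irr_inv]
    split_ifs
    · field_simp [natCard_ne_zero' (H := H)]
    · simp
  have h3 : ∀ h : H, IsConj h (σ⁻¹ h) ↔
      ConjClasses.map (σ : H →* H) (ConjClasses.mk h) = ConjClasses.mk h := by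
    intro h
    change _ ↔ ConjClasses.mk (σ h) = ConjClasses.mk h
    rw [ConjClasses.mk_eq_mk_iff_isConj, isConj_comm]
    refine ⟨fun hh => ?_, fun hh => ?_⟩
    · have := (σ : H →* H).map_isConj hh
      simp only [MonoidHom.coe_coe, MulAut.apply_inv_self] at this
      exact this.symm
    · have := ((σ⁻¹ : MulAut H) : H →* H).map_isConj hh
      simp only [MonoidHom.coe_coe, MulAut.inv_apply_self] at this
      exact this.symm
  have h4 : (invariantClasses σ : ℂ) =
      ∑ h : H, if IsConj h (σ⁻¹ h) then (Nat.card {g : H // IsConj h g} : ℂ)⁻¹ else 0 := by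
    rw [invariantClasses, Nat.card_eq_fintype_card, Fintype.card_subtype, Finset.card_filter,
      Nat.cast_sum, ← Finset.sum_fiberwise _ (fun h : H => ConjClasses.mk h)]
    refine Finset.sum_congr rfl fun C _ => ?_
    obtain ⟨b, rfl⟩ := ConjClasses.exists_rep C
    have hb : ∀ h ∈ Finset.univ.filter (fun h : H => ConjClasses.mk h = ConjClasses.mk b),
        (if IsConj h (σ⁻¹ h) then (Nat.card {g : H // IsConj h g} : ℂ)⁻¹ else 0) =
        if IsConj b (σ⁻¹ b) then (Nat.card {g : H // IsConj b g} : ℂ)⁻¹ else 0 := by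
      intro h hh
      have hh' := (Finset.mem_filter.1 hh).2
      have hc : IsConj h b := ConjClasses.mk_eq_mk_iff_isConj.1 hh'
      have : ∀ g, IsConj h g ↔ IsConj b g := fun g => ⟨hc.symm.trans, hc.trans⟩
      simp only [h3, hh', this]
    rw [Finset.sum_congr rfl hb, Finset.sum_const, nsmul_eq_mul]
    simp only [h3]
    have hcard : (Nat.card {h : H // IsConj b h} : ℂ) ≠ 0 := by
      have : Nonempty {h : H // IsConj b h} := ⟨⟨b, IsConj.refl b⟩⟩
      exact_mod_cast (Nat.card_pos (α := {h : H // IsConj b h})).ne'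
    have hcard' : (Finset.univ.filter (fun h : H => ConjClasses.mk h = ConjClasses.mk b)).card =
        Nat.card {h : H // IsConj b h} := by
      rw [Nat.card_eq_fintype_card, Fintype.card_subtype]
      simp only [ConjClasses.mk_eq_mk_iff_isConj, isConj_comm]
    rw [hcard']
    split_ifs
    · rw [mul_inv_cancel₀ hcard]; simp
    · simp
  have := h4.trans (h1.trans h2).symm
  exact_mod_cast this

end CharacterOperations

/-! ### Clifford theory for a normal subgroup with abelian quotient -/

section Clifford

/-- The linear characters of `H` that are trivial on `N`. -/
abbrev LinChar {H : Type} [Group H] (N : Subgroup H) : Type := {μ : H →* ℂˣ // N ≤ μ.ker}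

section LinChar

variable {H : Type} [Group H] [Finite H] (N : Subgroup H) [N.Normal]

/-- The linear characters of `H` trivial on `N` are those of `H ⧸ N`. -/
def linCharEquiv : LinChar N ≃ (H ⧸ N →* ℂˣ) where
  toFun μ := QuotientGroup.lift N μ.1 μ.2
  invFun ν := ⟨ν.comp (QuotientGroup.mk' N), fun n hn => by
    rw [MonoidHom.mem_ker, MonoidHom.comp_apply, QuotientGroup.mk'_apply,
      (QuotientGroup.eq_one_iff n).2 hn, map_one]⟩
  left_inv μ := by
    ext
    rfl
  right_inv ν := by
    ext h
    rfl

variable {N} (hcomm : ∀ x y : H, x * y * x⁻¹ * y⁻¹ ∈ N)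
include hcomm

/-- The commutative group structure on `H ⧸ N` if `N` contains the commutators. -/
@[reducible] def quotientCommGroup : CommGroup (H ⧸ N) where
  mul_comm a b := by
    induction a using QuotientGroup.induction_on
    induction b using QuotientGroup.induction_on
    rename_i x y
    rw [← QuotientGroup.mk_mul, ← QuotientGroup.mk_mul, eq_comm, QuotientGroup.eq]
    have := hcomm x⁻¹ y⁻¹
    have h2 := Subgroup.Normal.conj_mem ‹N.Normal› _ this (x * y)
    have h3 := Subgroup.Normal.conj_mem ‹N.Normal› _ h2 (y * x)⁻¹
    convert h3 using 1
    group

theorem finite_linChar : Finite (LinChar N) := by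
  let _ := quotientCommGroup hcomm
  have hc := CommGroup.card_monoidHom_of_hasEnoughRootsOfUnity (H ⧸ N) ℂ
  have : Finite (H ⧸ N →* ℂˣ) := Nat.finite_of_card_ne_zero (by rw [hc]; exact Nat.card_pos.ne')
  exact Finite.of_equiv _ (linCharEquiv N).symm

theorem natCard_linChar : Nat.card (LinChar N) = N.index := by
  let _ := quotientCommGroup hcomm
  rw [Nat.card_congr (linCharEquiv N),
    CommGroup.card_monoidHom_of_hasEnoughRootsOfUnity (H ⧸ N) ℂ, Subgroup.index]

theorem sum_linChar [Fintype (LinChar N)] (h : H) [Decidable (h ∈ N)] :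
    ∑ μ : LinChar N, (μ.1 h : ℂ) = if h ∈ N then (N.index : ℂ) else 0 := by
  split_ifs with hh
  · rw [← natCard_linChar hcomm, Nat.card_eq_fintype_card]
    rw [Finset.sum_congr rfl (g := fun _ => (1 : ℂ))]
    · simp
    · intro μ _
      rw [MonoidHom.mem_ker.1 (μ.2 hh), Units.val_one]
  · let _ := quotientCommGroup hcomm
    obtain ⟨φ, hφ⟩ := CommGroup.exists_apply_ne_one_of_hasEnoughRootsOfUnity (H ⧸ N) ℂ
      (a := (h : H ⧸ N)) (by rwa [Ne, QuotientGroup.eq_one_iff])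
    set ν : LinChar N := (linCharEquiv N).symm φ with hν
    have hνh : ν.1 h ≠ 1 := hφ
    let e : LinChar N ≃ LinChar N :=
      { toFun := fun μ => ⟨ν.1 * μ.1, fun n hn => by
          rw [MonoidHom.mem_ker, MonoidHom.mul_apply, MonoidHom.mem_ker.1 (μ.2 hn),
            MonoidHom.mem_ker.1 (ν.2 hn), one_mul]⟩
        invFun := fun μ => ⟨ν.1⁻¹ * μ.1, fun n hn => by
          rw [MonoidHom.mem_ker, MonoidHom.mul_apply, MonoidHom.mem_ker.1 (μ.2 hn),
            MonoidHom.inv_apply, MonoidHom.mem_ker.1 (ν.2 hn), inv_one, one_mul]⟩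
        left_inv := fun μ => Subtype.ext (inv_mul_cancel_left ν.1 μ.1)
        right_inv := fun μ => Subtype.ext (mul_inv_cancel_left ν.1 μ.1) }
    -- Translation by a linear character `ν` with `ν h ≠ 1` permutes the summands and multiplies the
    -- sum by `ν h`, so the sum vanishes.
    have h1 : ∑ μ : LinChar N, (μ.1 h : ℂ) = (ν.1 h : ℂ) * ∑ μ : LinChar N, (μ.1 h : ℂ) := by
      conv_lhs => rw [← Equiv.sum_comp e]
      rw [Finset.mul_sum]
      rfl
    have h2 : ((ν.1 h : ℂ) - 1) * ∑ μ : LinChar N, (μ.1 h : ℂ) = 0 := by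
      rw [sub_mul, one_mul, ← h1, sub_self]
    refine (mul_eq_zero.1 h2).resolve_left fun h3 => hνh ?_
    exact Units.ext (sub_eq_zero.1 h3)

end LinChar

section Restriction

variable {A H : Type} [Group A] [Finite A] [Group H] [Finite H] {i : A →* H}
  (hi : Function.Injective i)
include hi

omit [Finite A] [Finite H] in
theorem card_mul_index_range : Nat.card A * i.range.index = Nat.card H := by
  rw [← Subgroup.card_mul_index i.range]
  congr 1
  exact Nat.card_congr (MonoidHom.ofInjective hi).toEquiv

/-- Frobenius reciprocity for the extension by zero of a function. -/
theorem charInner_extend (χ : A → ℂ) (g : H → ℂ) :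
    charInner (Function.extend i χ 0) g = (i.range.index : ℂ)⁻¹ * charInner χ (g ∘ i) := by
  let _ := Fintype.ofFinite H
  let _ := Fintype.ofFinite A
  rw [charInner_eq, charInner_eq, ← card_mul_index_range hi, Nat.cast_mul, mul_inv, mul_assoc,
    mul_left_comm]
  congr 2
  rw [← Finset.sum_subset (Finset.subset_univ (Finset.univ.map ⟨i, hi⟩))]
  · rw [Finset.sum_map]
    refine Finset.sum_congr rfl fun a _ => ?_
    simp [hi.extend_apply]
  · intro h _ hh
    rw [Function.extend_apply', Pi.zero_apply, zero_mul]
    rintro ⟨a, rfl⟩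
    exact hh (by simp)

omit [Finite A] [Finite H] in
theorem isClassFun_extend [i.range.Normal] {χ : A → ℂ}
    (hinv : ∀ (h : H) (a b : A), i b = h * i a * h⁻¹ → χ b = χ a) :
    IsClassFun (Function.extend i χ 0) := by
  intro g h
  by_cases hh : h ∈ i.range
  · obtain ⟨a, rfl⟩ := hh
    obtain ⟨b, hb⟩ := Subgroup.Normal.conj_mem ‹i.range.Normal› (i a) ⟨a, rfl⟩ g
    rw [← hb, hi.extend_apply, hi.extend_apply, hinv g a b hb]
  · have hh' : g * h * g⁻¹ ∉ i.range := by
      intro hc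
      have := Subgroup.Normal.conj_mem ‹i.range.Normal› _ hc g⁻¹
      simp only [inv_inv, mul_assoc, inv_mul_cancel, mul_one, inv_mul_cancel_left] at this
      exact hh this
    rw [Function.extend_apply' _ _ _ hh, Function.extend_apply' _ _ _ hh']
    rfl

omit hi [Finite A] [Finite H] in
theorem isClassFun_comp {ψ : H → ℂ} (hψ : ψ ∈ Irr H) : IsClassFun (ψ ∘ i) := by
  intro g h
  simp only [Function.comp_apply, map_mul, map_inv]
  exact isClassFun_irr hψ _ _

/-- The scalar product of restrictions counts the linear characters that relate the two
characters. -/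
theorem charInner_comp_comp [i.range.Normal] (hcomm : ∀ x y : H, x * y * x⁻¹ * y⁻¹ ∈ i.range)
    {ψ ψ' : H → ℂ} (hψ : ψ ∈ Irr H) (hψ' : ψ' ∈ Irr H) :
    charInner (ψ ∘ i) (ψ' ∘ i) =
      Nat.card {μ : LinChar i.range // (fun g => (μ.1 g : ℂ) * ψ g) = ψ'} := by
  classical
  have := finite_linChar hcomm
  let _ := Fintype.ofFinite (LinChar i.range)
  let _ := Fintype.ofFinite H
  let _ := Fintype.ofFinite A
  -- Orthonormality makes this sum the required count. Summing over `μ` first instead gives the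
  -- index times the indicator function of the image of `A`, that is, the scalar product over `A`.
  have h1 : ∑ μ : LinChar i.range, charInner (fun g => (μ.1 g : ℂ) * ψ g) ψ' =
      Nat.card {μ : LinChar i.range // (fun g => (μ.1 g : ℂ) * ψ g) = ψ'} := by
    rw [Nat.card_eq_fintype_card, Fintype.card_subtype, Finset.card_filter, Nat.cast_sum]
    refine Finset.sum_congr rfl fun μ _ => ?_
    rw [irr_orthonormal (mul_mem_irr hψ μ.1) hψ']
    simp
  rw [← h1]
  simp only [charInner_eq, ← Finset.mul_sum]
  rw [Finset.sum_comm]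
  simp only [← Finset.sum_mul]
  simp only [sum_linChar hcomm]
  rw [← card_mul_index_range hi, Nat.cast_mul, mul_inv, mul_assoc]
  congr 1
  have hidx : (i.range.index : ℂ) ≠ 0 := by
    exact_mod_cast Subgroup.index_ne_zero_of_finite
  rw [eq_inv_mul_iff_mul_eq₀ hidx,
    ← Finset.sum_subset (Finset.subset_univ (Finset.univ.map ⟨i, hi⟩))]
  · rw [Finset.sum_map, Finset.mul_sum]
    refine Finset.sum_congr rfl fun a _ => ?_
    simp [mul_assoc]
  · intro h _ hh
    rw [if_neg, zero_mul, zero_mul]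
    rintro ⟨a, rfl⟩
    exact hh (by simp)

omit hi [Finite H] in
-- The norm is a sum of squares of natural multiplicities; if it is `1`, exactly one constituent
-- occurs, with multiplicity one.
theorem comp_mem_irr_of_charInner_eq_one {ψ : H → ℂ} (hψ : ψ ∈ Irr H)
    (h1 : charInner (ψ ∘ i) (ψ ∘ i) = 1) : ψ ∘ i ∈ Irr A := by
  classical
  choose e he using fun χ : Irr A => charInner_comp_natCast i hψ χ.2
  have hsum : ∑ χ : Irr A, e χ * e χ = 1 := by
    have := charInner_parseval (isClassFun_comp (i := i) hψ) (ψ ∘ i)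
    rw [h1] at this
    have h2 : ∀ χ : Irr A, charInner (χ : A → ℂ) (ψ ∘ i) = e χ := fun χ => by
      rw [charInner_comm, he]
    simp only [he, h2] at this
    exact_mod_cast this.symm
  have hex : ∃ χ : Irr A, e χ ≠ 0 := by
    by_contra hne
    push Not at hne
    simp [hne] at hsum
  obtain ⟨χ, hχ⟩ := hex
  have hle : ∑ χ' ∈ Finset.univ.erase χ, e χ' * e χ' + e χ * e χ = 1 := by
    rw [Finset.sum_erase_add _ _ (Finset.mem_univ χ), hsum]
  have hpos : 1 ≤ e χ * e χ := Nat.mul_pos (Nat.pos_of_ne_zero hχ) (Nat.pos_of_ne_zero hχ)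
  have hχ1 : e χ = 1 := by
    have : e χ * e χ = 1 := by omega
    exact Nat.eq_one_of_mul_eq_one_right this
  have hzero : ∑ χ' ∈ Finset.univ.erase χ, e χ' * e χ' = 0 := by omega
  have heq : ψ ∘ i = χ := by
    rw [classFun_expansion (isClassFun_comp (i := i) hψ), Finset.sum_eq_single χ]
    · rw [he, hχ1, Nat.cast_one, one_smul]
    · intro χ' _ hne
      have := Finset.sum_eq_zero_iff.1 hzero χ' (Finset.mem_erase.2 ⟨hne, Finset.mem_univ _⟩)
      rw [he, mul_self_eq_zero.1 this, Nat.cast_zero, zero_smul]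
    · simp
  rw [heq]
  exact χ.2

variable [i.range.Normal] {χ : A → ℂ} (hχ : χ ∈ Irr A)
  (hinv : ∀ (h : H) (a b : A), i b = h * i a * h⁻¹ → χ b = χ a)
include hχ hinv

/-- An invariant irreducible character is a constituent of the restriction of an irreducible
character. -/
theorem exists_irr_charInner_ne_zero : ∃ ψ ∈ Irr H, charInner (ψ ∘ i) χ ≠ 0 := by
  by_contra hne
  push Not at hne
  have h0 : Function.extend i χ 0 = 0 := by
    apply eq_zero_of_orthogonal (isClassFun_extend hi hinv)
    intro ψ hψ
    rw [charInner_extend hi, charInner_comm, hne ψ hψ, mul_zero]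
  apply irr_one_ne_zero hχ
  have := congrFun h0 (i 1)
  rwa [hi.extend_apply] at this

/-- Clifford's theorem for an invariant character. -/
theorem charInner_comp_eq_zero_of_ne {ψ : H → ℂ} (hψ : ψ ∈ Irr H)
    (hψχ : charInner (ψ ∘ i) χ ≠ 0) {χ' : A → ℂ} (hχ' : χ' ∈ Irr A) (hne : χ' ≠ χ) :
    charInner (ψ ∘ i) χ' = 0 := by
  classical
  have hidx : (i.range.index : ℂ) ≠ 0 := by
    exact_mod_cast Subgroup.index_ne_zero_of_finite
  -- The extensions by zero of `χ` and `χ'` are orthogonal. Expanding the one of `χ`, a class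
  -- function by invariance, gives a vanishing sum of products of natural multiplicities; so for
  -- each `φ` one of the two multiplicities is zero.
  have h0 : charInner (Function.extend i χ 0) (Function.extend i χ' 0) = 0 := by
    rw [charInner_extend hi, Function.extend_comp hi, irr_orthonormal hχ hχ', if_neg hne.symm,
      mul_zero]
  rw [charInner_parseval (isClassFun_extend hi hinv)] at h0
  choose e he using fun φ : Irr H => charInner_comp_natCast i φ.2 hχ
  choose e' he' using fun φ : Irr H => charInner_comp_natCast i φ.2 hχ'
  have h1 : ∀ φ : Irr H, charInner (Function.extend i χ 0) φ *
      charInner (φ : H → ℂ) (Function.extend i χ' 0) =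
      ((i.range.index : ℂ)⁻¹ * (i.range.index : ℂ)⁻¹) * ((e φ * e' φ : ℕ) : ℂ) := by
    intro φ
    rw [charInner_comm (φ : H → ℂ), charInner_extend hi, charInner_extend hi, charInner_comm χ,
      charInner_comm χ', he, he', Nat.cast_mul]
    ring
  simp only [h1, ← Finset.mul_sum] at h0
  have h2 := (mul_eq_zero.1 h0).resolve_left
    (mul_ne_zero (inv_ne_zero hidx) (inv_ne_zero hidx))
  rw [← Nat.cast_sum, Nat.cast_eq_zero, Finset.sum_eq_zero_iff] at h2
  have h3 := h2 ⟨ψ, hψ⟩ (Finset.mem_univ _)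
  rw [he ⟨ψ, hψ⟩, Nat.cast_ne_zero] at hψχ
  rw [he' ⟨ψ, hψ⟩, (Nat.mul_eq_zero.1 h3).resolve_left hψχ, Nat.cast_zero]

/-- An invariant irreducible character extends if the stabilizers in the group of linear characters
have at most two elements. -/
theorem exists_irr_comp_eq (hcomm : ∀ x y : H, x * y * x⁻¹ * y⁻¹ ∈ i.range)
    (hstab : ∀ ψ ∈ Irr H,
      Nat.card {μ : LinChar i.range // (fun g => (μ.1 g : ℂ) * ψ g) = ψ} ≤ 2) :
    ∃ ψ ∈ Irr H, ψ ∘ i = χ := by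
  classical
  obtain ⟨ψ, hψ, hne⟩ := exists_irr_charInner_ne_zero hi hχ hinv
  obtain ⟨e, he⟩ := charInner_comp_natCast i hψ hχ
  -- By Clifford's theorem `χ` is the only constituent. The norm `e²` of the restriction is then the
  -- order of the stabilizer of `ψ`, which is at most `2`, so `e = 1`.
  have heq : ψ ∘ i = (e : ℂ) • χ := by
    rw [classFun_expansion (isClassFun_comp (i := i) hψ), Finset.sum_eq_single ⟨χ, hχ⟩]
    · rw [he]
    · intro χ' _ hχ'
      rw [charInner_comp_eq_zero_of_ne hi hχ hinv hψ hne χ'.2 (fun h => hχ' (Subtype.ext h)),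
        zero_smul]
    · simp
  have hsq : charInner (ψ ∘ i) (ψ ∘ i) = ((e * e : ℕ) : ℂ) := by
    conv_lhs => rw [heq, charInner_smul_left, charInner_comm, charInner_smul_left,
      irr_orthonormal hχ hχ, if_pos rfl]
    push_cast
    ring
  rw [charInner_comp_comp hi hcomm hψ hψ, Nat.cast_inj] at hsq
  have h2 := hsq ▸ hstab ψ hψ
  have he0 : e ≠ 0 := by
    rintro rfl
    exact hne (by rw [he, Nat.cast_zero])
  have he1 : e = 1 := by
    have : e < 2 := by nlinarith
    omega
  exact ⟨ψ, hψ, by rw [heq, he1, Nat.cast_one, one_smul]⟩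

end Restriction

end Clifford

/-! ### The counting argument when `N Z` has index at most two -/

section IndexTwo

variable {A H : Type} [Group A] [Finite A] [Group H] [Finite H] {i : A →* H}
  (hi : Function.Injective i) [i.range.Normal]
  (hcomm : ∀ x y : H, x * y * x⁻¹ * y⁻¹ ∈ i.range)
  {Z : Subgroup H} (hZ : Z ≤ Subgroup.center H)
  (hindex : ∀ x y : H, x ∉ i.range ⊔ Z → y ∉ i.range ⊔ Z → x * y⁻¹ ∈ i.range ⊔ Z)

omit [Finite A] in
include hcomm in
theorem subsingleton_of_orbit_ncard {ψ : H → ℂ}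
    (h : (linOrbit i.range ψ).ncard = i.range.index) (μ : LinChar i.range)
    (hμ : (fun g => (μ.1 g : ℂ) * ψ g) = ψ) : μ.1 = 1 := by
  have := finite_linChar hcomm
  let F : LinChar i.range → H → ℂ := fun μ g => (μ.1 g : ℂ) * ψ g
  have hrange : linOrbit i.range ψ = F '' Set.univ := by
    ext φ
    simp only [linOrbit, Set.mem_ofPred_eq, Set.image_univ, Set.mem_range, F]
    exact ⟨fun ⟨μ, h1, h2⟩ => ⟨⟨μ, h1⟩, h2.symm⟩, fun ⟨μ, h⟩ => ⟨μ.1, μ.2, h.symm⟩⟩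
  rw [hrange, ← natCard_linChar hcomm, ← Set.ncard_univ] at h
  have hinj := (Set.ncard_image_iff Set.finite_univ).1 h
  have h1 : μ = ⟨1, fun n _ => by simp⟩ := by
    apply hinj (Set.mem_univ _) (Set.mem_univ _)
    simp only [F, hμ]
    simp
  rw [h1]

include hi hcomm in
theorem injective_linChar_mul {ψ : H → ℂ} (hψ : ψ ∈ Irr H)
    (h1 : charInner (ψ ∘ i) (ψ ∘ i) = 1) :
    Function.Injective fun (μ : LinChar i.range) (g : H) => (μ.1 g : ℂ) * ψ g := by
  have := finite_linChar hcomm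
  rw [charInner_comp_comp hi hcomm hψ hψ, Nat.cast_eq_one, Nat.card_eq_one_iff_unique] at h1
  obtain ⟨⟨hs⟩, -⟩ := h1
  intro μ ν hμν
  have h2 : (fun g => ((ν.1⁻¹ * μ.1) g : ℂ) * ψ g) = ψ := by
    funext g
    have : (μ.1 g : ℂ) * ψ g = (ν.1 g : ℂ) * ψ g := congrFun hμν g
    rw [MonoidHom.mul_apply, Units.val_mul, mul_assoc, this, ← mul_assoc, MonoidHom.inv_apply,
      Units.inv_mul, one_mul]
  have h3 := hs ⟨⟨ν.1⁻¹ * μ.1, fun n hn => by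
    rw [MonoidHom.mem_ker, MonoidHom.mul_apply, MonoidHom.mem_ker.1 (μ.2 hn),
      MonoidHom.inv_apply, MonoidHom.mem_ker.1 (ν.2 hn), inv_one, one_mul]⟩, h2⟩
    ⟨⟨1, fun n _ => by simp⟩, by simp⟩
  have h4 : ν.1⁻¹ * μ.1 = 1 := congrArg (fun a => a.1.1) h3
  exact Subtype.ext (inv_mul_eq_one.1 h4).symm

include hi hcomm in
-- Both conditions say that the stabilizer of `ψ` among the linear characters is trivial: its order
-- is the norm of the restriction.
theorem orbit_ncard_iff {ψ : H → ℂ} (hψ : ψ ∈ Irr H) :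
    (linOrbit i.range ψ).ncard = i.range.index ↔ charInner (ψ ∘ i) (ψ ∘ i) = 1 := by
  have := finite_linChar hcomm
  constructor
  · intro h
    rw [charInner_comp_comp hi hcomm hψ hψ, Nat.cast_eq_one, Nat.card_eq_one_iff_unique]
    refine ⟨⟨fun μ ν => ?_⟩, ⟨⟨⟨1, fun n _ => by simp⟩, by simp⟩⟩⟩
    apply Subtype.ext
    apply Subtype.ext
    rw [subsingleton_of_orbit_ncard hcomm h μ.1 μ.2, subsingleton_of_orbit_ncard hcomm h ν.1 ν.2]
  · intro h
    have hinj := injective_linChar_mul hi hcomm hψ h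
    rw [← natCard_linChar hcomm, ← Set.ncard_univ, ← Set.ncard_image_of_injective _ hinj]
    congr 1
    ext φ
    simp only [linOrbit, Set.mem_ofPred_eq, Set.image_univ, Set.mem_range]
    exact ⟨fun ⟨μ, h1, h2⟩ => ⟨⟨μ, h1⟩, h2.symm⟩, fun ⟨μ, h⟩ => ⟨μ.1, μ.2, h.symm⟩⟩

omit [Finite A] [i.range.Normal] in
include hZ hindex in
-- A linear character fixing `ψ` is trivial on the image of `A` by definition, and on `Z` because
-- `ψ` does not vanish at central elements. So it factors through a quotient of order at most two.
theorem card_stabilizer_le_two {ψ : H → ℂ} (hψ : ψ ∈ Irr H) :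
    Nat.card {μ : LinChar i.range // (fun g => (μ.1 g : ℂ) * ψ g) = ψ} ≤ 2 := by
  classical
  set S := {μ : LinChar i.range // (fun g => (μ.1 g : ℂ) * ψ g) = ψ}
  have htriv : ∀ μ : S, ∀ x ∈ i.range ⊔ Z, μ.1.1 x = 1 := by
    intro μ x hx
    have hle : i.range ⊔ Z ≤ μ.1.1.ker := by
      refine sup_le μ.1.2 fun z hz => ?_
      have h1 := congrFun μ.2 z
      have h2 := irr_apply_ne_zero_of_mem_center hψ (hZ hz)
      exact Units.ext (mul_right_cancel₀ h2 (by rw [h1, Units.val_one, one_mul]))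
    exact hle hx
  by_cases hex : ∃ x, x ∉ i.range ⊔ Z
  · obtain ⟨x, hx⟩ := hex
    have hinj : Function.Injective fun μ : S => decide (μ.1.1 x = 1) := by
      intro μ ν hμν
      have hsq : ∀ μ : S, (μ.1.1 x : ℂ) = 1 ∨ (μ.1.1 x : ℂ) = -1 := by
        intro μ
        have h1 := htriv μ _ (hindex x x⁻¹ hx (fun h => hx (by simpa using h)))
        rw [inv_inv, map_mul] at h1
        have h2 := congrArg Units.val h1
        rw [Units.val_mul, Units.val_one] at h2
        exact mul_self_eq_one_iff.1 h2
      have hxx : μ.1.1 x = ν.1.1 x := by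
        have h3 : μ.1.1 x = 1 ↔ ν.1.1 x = 1 := by simpa using hμν
        by_cases h4 : μ.1.1 x = 1
        · rw [h4, h3.1 h4]
        · have h5 : ν.1.1 x ≠ 1 := fun h => h4 (h3.2 h)
          apply Units.ext
          rw [(hsq μ).resolve_left fun h => h4 (Units.ext h),
            (hsq ν).resolve_left fun h => h5 (Units.ext h)]
      apply Subtype.ext
      apply Subtype.ext
      ext y
      by_cases hy : y ∈ i.range ⊔ Z
      · rw [htriv μ y hy, htriv ν y hy]
      · have h6 := hindex y x hy hx
        have h7 : ∀ μ : S, μ.1.1 y = μ.1.1 x := by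
          intro μ
          have := htriv μ _ h6
          rwa [map_mul, map_inv, mul_inv_eq_one] at this
        rw [h7, h7, hxx]
    simpa using Nat.card_le_card_of_injective _ hinj
  · push Not at hex
    have : Subsingleton S := ⟨fun μ ν => by
      apply Subtype.ext
      apply Subtype.ext
      ext y
      rw [htriv μ y (hex y), htriv ν y (hex y)]⟩
    exact (Finite.card_le_one_iff_subsingleton.2 this).trans one_le_two

variable {σ : MulAut A} {τ : MulAut H} (hστ : ∀ a, i (σ a) = τ (i a))

omit [Finite A] [Finite H] [i.range.Normal] in
include hστ in
theorem comp_inv_apply (a : A) : i (σ⁻¹ a) = τ⁻¹ (i a) := by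
  rw [MulAut.inv_apply, MulAut.inv_apply, MulEquiv.eq_symm_apply, ← hστ, ← MulAut.inv_apply,
    MulAut.apply_inv_self]

include hi hcomm hστ in
-- If `ψ` restricts irreducibly, its orbit consists of the irreducible characters with the same
-- restriction. Hence `τ` stabilizes the orbit exactly when `σ` fixes the restriction.
theorem orbit_stable_iff {ψ : H → ℂ} (hψ : ψ ∈ Irr H)
    (h1 : charInner (ψ ∘ i) (ψ ∘ i) = 1) :
    (fun φ => conjChar φ τ) '' linOrbit i.range ψ = linOrbit i.range ψ ↔
      conjChar (ψ ∘ i) σ = ψ ∘ i := by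
  have hres : conjChar ψ τ ∘ i = conjChar (ψ ∘ i) σ := by
    funext a
    simp only [Function.comp_apply, conjChar, comp_inv_apply hστ]
  have hcancel : ∀ μ : H →* ℂˣ, i.range ≤ μ.ker → (fun g => (μ g : ℂ) * ψ g) ∘ i = ψ ∘ i := by
    intro μ hμ
    funext a
    simp only [Function.comp_apply]
    rw [MonoidHom.mem_ker.1 (hμ ⟨a, rfl⟩), Units.val_one, one_mul]
  constructor
  · intro h
    have hmem : conjChar ψ τ ∈ linOrbit i.range ψ := by
      rw [← h]
      exact ⟨ψ, ⟨1, fun n _ => by simp, by simp⟩, rfl⟩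
    obtain ⟨μ, hμ, h2⟩ := hmem
    rw [← hres, h2, hcancel μ hμ]
  · intro h
    rw [h] at hres
    have h2 : charInner (ψ ∘ i) (conjChar ψ τ ∘ i) = 1 := by rw [hres, h1]
    have := finite_linChar hcomm
    rw [charInner_comp_comp hi hcomm hψ (conjChar_mem_irr hψ τ), Nat.cast_eq_one,
      Nat.card_eq_one_iff_unique] at h2
    obtain ⟨-, ⟨⟨μ, hμ⟩⟩⟩ := h2
    have hfin : (linOrbit i.range ψ).Finite := by
      refine (Set.finite_range fun (μ : LinChar i.range) (g : H) => (μ.1 g : ℂ) * ψ g).subset ?_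
      rintro φ ⟨μ, h1, h2⟩
      exact ⟨⟨μ, h1⟩, h2.symm⟩
    have hinj : Function.Injective fun φ : H → ℂ => conjChar φ τ := by
      intro φ φ' hφ
      funext g
      have := congrFun hφ (τ g)
      simpa only [conjChar, MulAut.inv_apply_self] using this
    refine Set.eq_of_subset_of_ncard_le ?_ (Set.ncard_image_of_injective _ hinj).ge hfin
    rintro _ ⟨_, ⟨ν, hν, rfl⟩, rfl⟩
    refine ⟨ν.comp (τ⁻¹ : MulAut H).toMonoidHom * μ.1, fun n hn => ?_, ?_⟩
    · have h3 : (τ⁻¹ : MulAut H) n ∈ i.range := by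
        obtain ⟨a, rfl⟩ := hn
        exact ⟨σ⁻¹ a, comp_inv_apply hστ a⟩
      rw [MonoidHom.mem_ker, MonoidHom.mul_apply, MonoidHom.mem_ker.1 (μ.2 hn), mul_one]
      exact MonoidHom.mem_ker.1 (hν h3)
    · funext g
      have := congrFun hμ g
      simp only [conjChar] at this
      simp only [conjChar, ← this]
      rw [MonoidHom.mul_apply, Units.val_mul, ← mul_assoc]
      rfl

include hi hcomm hZ hindex hστ in
/-- The number of characters in stable orbits of full length. -/
theorem stableFullOrbitChars_eq :
    stableFullOrbitChars i.range τ = i.range.index * Nat.card {χ : A → ℂ // χ ∈ Irr A ∧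
      (∀ (h : H) (a b : A), i b = h * i a * h⁻¹ → χ b = χ a) ∧ conjChar χ σ = χ} := by
  set E := {χ : A → ℂ // χ ∈ Irr A ∧
      (∀ (h : H) (a b : A), i b = h * i a * h⁻¹ → χ b = χ a) ∧ conjChar χ σ = χ}
  classical
  choose ext hext hcomp using fun χ : E => exists_irr_comp_eq hi χ.2.1 χ.2.2.1 hcomm
    fun ψ hψ => card_stabilizer_le_two hZ hindex hψ
  have hmulcomp : ∀ (χ : E) (μ : LinChar i.range),
      (fun g => (μ.1 g : ℂ) * ext χ g) ∘ i = χ.1 := by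
    intro χ μ
    rw [← hcomp χ]
    funext a
    simp only [Function.comp_apply]
    rw [MonoidHom.mem_ker.1 (μ.2 ⟨a, rfl⟩), Units.val_one, one_mul]
  have hone : ∀ χ : E, charInner χ.1 χ.1 = 1 := fun χ => by
    rw [irr_orthonormal χ.2.1 χ.2.1, if_pos rfl]
  rw [← natCard_linChar hcomm, mul_comm, ← Nat.card_prod, stableFullOrbitChars]
  symm
  -- With one extension chosen for each invariant `χ`, every other irreducible character with
  -- restriction `χ` is a unique multiple of it by a linear character of the quotient.
  let Φ : E × LinChar i.range → {χ : H → ℂ // χ ∈ Irr H ∧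
      (linOrbit i.range χ).ncard = i.range.index ∧
      (fun ψ => conjChar ψ τ) '' linOrbit i.range χ = linOrbit i.range χ} := fun x =>
    ⟨fun g => (x.2.1 g : ℂ) * ext x.1 g, by
      have hirr := mul_mem_irr (hext x.1) x.2.1
      have h1 : charInner ((fun g => (x.2.1 g : ℂ) * ext x.1 g) ∘ i)
          ((fun g => (x.2.1 g : ℂ) * ext x.1 g) ∘ i) = 1 := by
        rw [hmulcomp x.1 x.2, hone]
      refine ⟨hirr, (orbit_ncard_iff hi hcomm hirr).2 h1,
        (orbit_stable_iff hi hcomm hστ hirr h1).2 ?_⟩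
      rw [hmulcomp x.1 x.2, x.1.2.2.2]⟩
  refine Nat.card_congr (Equiv.ofBijective Φ ⟨?_, ?_⟩)
  · rintro ⟨χ, μ⟩ ⟨χ', μ'⟩ h
    have h1 : (fun g => (μ.1 g : ℂ) * ext χ g) = fun g => (μ'.1 g : ℂ) * ext χ' g :=
      congrArg Subtype.val h
    have h2 : χ = χ' := by
      apply Subtype.ext
      rw [← hmulcomp χ μ, ← hmulcomp χ' μ', h1]
    subst h2
    have h3 := injective_linChar_mul hi hcomm (hext χ) (by rw [hcomp, hone]) h1
    rw [h3]
  · rintro ⟨ψ, hψ, hfull, hstable⟩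
    have h1 := (orbit_ncard_iff hi hcomm hψ).1 hfull
    have h2 := (orbit_stable_iff hi hcomm hστ hψ h1).1 hstable
    let χ : E := ⟨ψ ∘ i, comp_mem_irr_of_charInner_eq_one hψ h1, fun h a b hab => by
      simp only [Function.comp_apply, hab]
      exact isClassFun_irr hψ h (i a), h2⟩
    have h3 : charInner (ext χ ∘ i) (ψ ∘ i) = 1 := by
      rw [hcomp]
      exact hone χ
    have := finite_linChar hcomm
    rw [charInner_comp_comp hi hcomm (hext χ) hψ, Nat.cast_eq_one,
      Nat.card_eq_one_iff_unique] at h3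
    obtain ⟨-, ⟨⟨μ, hμ⟩⟩⟩ := h3
    exact ⟨(χ, μ), Subtype.ext hμ⟩

include hi hcomm hZ hindex hστ in
/-- For a diagonal automorphism `δ` given by an element outside `i.range ⊔ Z`, the equality of the
number of `δ σ`-invariant classes with the normalized number of characters in stable full orbits
means that `χ ^ σ = χ ^ δ` only holds if `χ` is invariant under both. -/
theorem invariantClasses_eq_iff (δ : MulAut A) {x : H} (hx : x ∉ i.range ⊔ Z)
    (hδ : ∀ a, i (δ a) = x * i a * x⁻¹) :
    (invariantClasses (δ * σ) : ℚ) = (i.range.index : ℚ)⁻¹ * stableFullOrbitChars i.range τ ↔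
      ∀ χ ∈ Irr A, conjChar χ σ = conjChar χ δ → χ = conjChar χ σ ∧ χ = conjChar χ δ := by
  have hinner : ∀ h ∈ i.range ⊔ Z, ∀ a b : A, i b = h * i a * h⁻¹ → IsConj a b := by
    intro h hh a b hab
    obtain ⟨_, ⟨c, rfl⟩, z, hz, rfl⟩ := Subgroup.mem_sup_of_normal_left.1 hh
    refine isConj_iff.2 ⟨c, hi ?_⟩
    have hz' := Subgroup.mem_center_iff.1 (hZ hz) (i a)
    rw [hab, map_mul, map_mul, map_inv, mul_inv_rev,
      show i c * z * i a * (z⁻¹ * (i c)⁻¹) = i c * (z * i a) * z⁻¹ * (i c)⁻¹ by group, ← hz']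
    group
  have hclass : ∀ χ ∈ Irr A, ∀ a b : A, IsConj a b → χ a = χ b := by
    intro χ hχ a b hab
    obtain ⟨c, rfl⟩ := isConj_iff.1 hab
    exact (isClassFun_irr hχ c a).symm
  -- The square of `x` falls into the subgroup of index two, so `δ²` acts on `A` like an inner
  -- automorphism and `δ⁻¹` can be replaced by `δ` inside characters.
  have hx2 : x * x ∈ i.range ⊔ Z := by
    have := hindex x x⁻¹ hx (fun h => hx (by simpa using h))
    rwa [inv_inv] at this
  have hδδ : ∀ χ ∈ Irr A, ∀ a, χ (δ (δ a)) = χ a := by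
    intro χ hχ a
    refine (hclass χ hχ _ _ (hinner _ hx2 _ _ ?_)).symm
    rw [hδ, hδ]
    group
  have hδinv : ∀ χ ∈ Irr A, ∀ a, χ (δ⁻¹ a) = χ (δ a) := by
    intro χ hχ a
    conv_rhs => rw [← MulAut.apply_inv_self _ δ a, hδδ χ hχ]
  have hleft : ∀ χ ∈ Irr A, conjChar χ (δ * σ) = χ ↔ conjChar χ σ = conjChar χ δ := by
    intro χ hχ
    rw [funext_iff, funext_iff]
    simp only [conjChar, mul_inv_rev, MulAut.mul_apply, hδinv χ hχ]
    constructor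
    · intro h a
      rw [← h (δ a), MulAut.inv_apply_self]
    · intro h a
      rw [h, MulAut.apply_inv_self]
  -- Elements of `i.range ⊔ Z` fix every irreducible character of `A`, and all remaining elements
  -- differ from `x` by one of these; so invariance under `x` alone suffices.
  have hright : ∀ χ ∈ Irr A,
      (∀ (h : H) (a b : A), i b = h * i a * h⁻¹ → χ b = χ a) ↔ χ = conjChar χ δ := by
    intro χ hχ
    constructor
    · intro h
      funext a
      rw [conjChar, hδinv χ hχ]
      exact (h x a (δ a) (hδ a)).symm
    · intro h y a b hab
      by_cases hy : y ∈ i.range ⊔ Z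
      · exact (hclass χ hχ _ _ (hinner y hy a b hab)).symm
      · have h1 := hindex y x hy hx
        rw [congrFun h a, conjChar, hδinv χ hχ]
        refine (hclass χ hχ _ _ (hinner _ h1 _ _ ?_)).symm
        rw [hab, hδ]
        group
  -- The two counts are the sizes of `S` and of its subset `E`. As `S` is finite, equal size amounts
  -- to `S ⊆ E`.
  set S : Set (A → ℂ) := {χ | χ ∈ Irr A ∧ conjChar χ σ = conjChar χ δ}
  set E : Set (A → ℂ) := {χ | χ ∈ Irr A ∧ χ = conjChar χ σ ∧ χ = conjChar χ δ}
  have hES : E ⊆ S := fun χ h => ⟨h.1, h.2.1.symm.trans h.2.2⟩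
  have hSfin : S.Finite := (Set.toFinite (Irr A)).subset fun χ h => h.1
  have hc : invariantClasses (δ * σ) = S.ncard := by
    rw [invariantClasses_eq_card, ← Nat.card_coe_set_eq]
    refine Nat.card_congr
      { toFun := fun χ => ⟨χ.1.1, χ.1.2, (hleft _ χ.1.2).1 χ.2⟩
        invFun := fun χ => ⟨⟨χ.1, χ.2.1⟩, (hleft _ χ.2.1).2 χ.2.2⟩
        left_inv := fun _ => rfl
        right_inv := fun _ => rfl }
  have hd : stableFullOrbitChars i.range τ = i.range.index * E.ncard := by
    rw [stableFullOrbitChars_eq hi hcomm hZ hindex hστ, ← Nat.card_coe_set_eq]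
    congr 1
    refine Nat.card_congr
      { toFun := fun χ => ⟨χ.1, χ.2.1, χ.2.2.2.symm, (hright _ χ.2.1).1 χ.2.2.1⟩
        invFun := fun χ => ⟨χ.1, χ.2.1, (hright _ χ.2.1).2 χ.2.2.2, χ.2.2.1.symm⟩
        left_inv := fun _ => rfl
        right_inv := fun _ => rfl }
  have hidx : (i.range.index : ℚ) ≠ 0 := by
    exact_mod_cast Subgroup.index_ne_zero_of_finite
  rw [hc, hd, Nat.cast_mul, inv_mul_cancel_left₀ hidx, Nat.cast_inj]
  constructor
  · intro h χ hχ hχ'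
    have : E = S := Set.eq_of_subset_of_ncard_le hES h.le hSfin
    have hmem : χ ∈ E := this ▸ (⟨hχ, hχ'⟩ : χ ∈ S)
    exact hmem.2
  · intro h
    congr 1
    exact Set.Subset.antisymm (fun χ hχ => ⟨hχ.1, h χ hχ.1 hχ.2⟩) hES

end IndexTwo

/-! ### Fixed points in a group generated by a subgroup and the centre -/

section FixedPoints

variable {A B : Type} [Group A] [Group B] {f : A →* B} (hf : Function.Injective f)
  {F : Monoid.End A} {Ft : Monoid.End B} (hext : ∀ g, f (F g) = Ft (f g))
  (hsup : f.range ⊔ Subgroup.center B = ⊤)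

/-- The homomorphism that `f` induces on fixed points. -/
def fixedPtsHom (hext : ∀ g, f (F g) = Ft (f g)) : fixedPts F →* fixedPts Ft where
  toFun g := ⟨f (g : A), by
    have hg : F (g : A) = g := g.2
    change Ft (f (g : A)) = f (g : A)
    rw [← hext, hg]⟩
  map_one' := Subtype.ext (map_one f)
  map_mul' x y := Subtype.ext (map_mul f (x : A) y)

theorem range_fixedPtsHom : (fixedPtsHom hext).range = finiteImage f F Ft := by
  ext x
  simp only [MonoidHom.mem_range, finiteImage, Subgroup.mem_subgroupOf, Subgroup.mem_map]
  exact ⟨fun ⟨g, h⟩ => ⟨g, g.2, congrArg Subtype.val h⟩, fun ⟨g, hg, h⟩ => ⟨⟨g, hg⟩, Subtype.ext h⟩⟩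

include hf in
theorem fixedPtsHom_injective : Function.Injective (fixedPtsHom hext) := fun _ _ h =>
  Subtype.ext (hf (congrArg Subtype.val h))

include hf in
theorem mem_range_fixedPtsHom {x : fixedPts Ft} (hx : (x : B) ∈ f.range) :
    x ∈ (fixedPtsHom hext).range := by
  obtain ⟨g, hg⟩ := hx
  have hx : Ft (x : B) = x := x.2
  refine ⟨⟨g, hf ?_⟩, Subtype.ext hg⟩
  rw [hext, hg, hx]

include hsup in
theorem exists_mul_center (x : B) : ∃ g, ∃ z ∈ Subgroup.center B, f g * z = x := by
  have hx : x ∈ f.range ⊔ Subgroup.center B := hsup ▸ Subgroup.mem_top x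
  obtain ⟨_, ⟨g, rfl⟩, z, hz, h⟩ := Subgroup.mem_sup_of_normal_right.1 hx
  exact ⟨g, z, hz, h⟩

include hf hsup in
theorem normal_range_fixedPtsHom : (fixedPtsHom hext).range.Normal := by
  refine ⟨fun n hn x => mem_range_fixedPtsHom hf hext ?_⟩
  obtain ⟨a, rfl⟩ := hn
  obtain ⟨g, z, hz, hx⟩ := exists_mul_center hsup (x : B)
  have hz' := Subgroup.mem_center_iff.1 hz (f a)
  refine ⟨g * a * g⁻¹, ?_⟩
  change f (g * a * g⁻¹) = (x : B) * f a * (x : B)⁻¹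
  rw [← hx, map_mul, map_mul, map_inv,
    show f g * z * f a * (f g * z)⁻¹ = f g * (z * f a) * z⁻¹ * (f g)⁻¹ by group, ← hz']
  group

include hf hsup in
-- Central factors drop out of commutators, so a commutator in `B` comes from one in `A`; being
-- fixed by `Ft`, it comes from a fixed point of `F`.
theorem commutator_mem_range_fixedPtsHom (x y : fixedPts Ft) :
    x * y * x⁻¹ * y⁻¹ ∈ (fixedPtsHom hext).range := by
  refine mem_range_fixedPtsHom hf hext ?_
  obtain ⟨g, z, hz, hx⟩ := exists_mul_center hsup (x : B)
  obtain ⟨h, w, hw, hy⟩ := exists_mul_center hsup (y : B)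
  rw [Subgroup.mem_center_iff] at hz hw
  refine ⟨g * h * g⁻¹ * h⁻¹, ?_⟩
  change f (g * h * g⁻¹ * h⁻¹) = (x : B) * y * (x : B)⁻¹ * (y : B)⁻¹
  rw [← hx, ← hy, map_mul, map_mul, map_mul, map_inv, map_inv,
    show f g * z * (f h * w) * (f g * z)⁻¹ * (f h * w)⁻¹ =
      f g * (z * (f h * w)) * z⁻¹ * (f g)⁻¹ * (w⁻¹ * (f h)⁻¹) by group, ← hz,
    show f g * (f h * w * z) * z⁻¹ * (f g)⁻¹ * (w⁻¹ * (f h)⁻¹) =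
      f g * f h * (w * (f g)⁻¹) * (w⁻¹ * (f h)⁻¹) by group, ← hw]
  group

/-- The fixed points in the centre of the ambient group. -/
def fixedCenter (Ft : Monoid.End B) : Subgroup (fixedPts Ft) :=
  (Subgroup.center B).subgroupOf (fixedPts Ft)

theorem fixedCenter_le_center : fixedCenter Ft ≤ Subgroup.center (fixedPts Ft) := by
  intro z hz
  rw [Subgroup.mem_center_iff]
  intro g
  exact Subtype.ext (Subgroup.mem_center_iff.1 hz g)

include hf hext hsup in
/-- If the centre of `A` has at most one nontrivial element, then the subgroup generated by the
fixed points of `A` and of the centre of `B` has index at most two in the fixed points of `B`. -/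
theorem mul_inv_mem_range_sup_fixedCenter (hFt : Function.Surjective Ft)
    (hcenter : ∀ z ∈ Subgroup.center A, ∀ w ∈ Subgroup.center A, z ≠ 1 → w ≠ 1 → z = w)
    (x y : fixedPts Ft) (hx : x ∉ (fixedPtsHom hext).range ⊔ fixedCenter Ft)
    (hy : y ∉ (fixedPtsHom hext).range ⊔ fixedCenter Ft) :
    x * y⁻¹ ∈ (fixedPtsHom hext).range ⊔ fixedCenter Ft := by
  have hnormal := normal_range_fixedPtsHom hf hext hsup
  have key : ∀ (x : fixedPts Ft) (g : A) (z : B), z ∈ Subgroup.center B → f g * z = x →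
      F g = g → x ∈ (fixedPtsHom hext).range ⊔ fixedCenter Ft := by
    intro x g z hz hxz hg
    have h1 : f g ∈ fixedPts Ft := by
      change Ft (f g) = f g
      rw [← hext, hg]
    have h2 : z ∈ fixedPts Ft := by
      have : z = (f g)⁻¹ * x := by rw [← hxz, inv_mul_cancel_left]
      rw [this]
      exact mul_mem (inv_mem h1) x.2
    refine Subgroup.mem_sup_of_normal_left.2 ⟨⟨f g, h1⟩, ⟨⟨g, hg⟩, rfl⟩, ⟨z, h2⟩, hz, ?_⟩
    exact Subtype.ext hxz
  -- As `f g * z` is fixed, `f (g⁻¹ * F g) = z * (Ft z)⁻¹`. Surjectivity of `Ft` makes `Ft z`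
  -- central, and injectivity of `f` transports centrality back to `A`.
  have central : ∀ (x : fixedPts Ft) (g : A) (z : B), z ∈ Subgroup.center B → f g * z = x →
      g⁻¹ * F g ∈ Subgroup.center A := by
    intro x g z hz hxz
    have hx' : Ft (x : B) = x := x.2
    have hFz : Ft z ∈ Subgroup.center B := by
      rw [Subgroup.mem_center_iff]
      intro b
      obtain ⟨c, rfl⟩ := hFt b
      rw [← map_mul, Subgroup.mem_center_iff.1 hz, map_mul]
    have h1 : f (g⁻¹ * F g) = z * (Ft z)⁻¹ := by
      rw [← hxz, map_mul] at hx'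
      rw [map_mul, map_inv, hext, eq_mul_inv_iff_mul_eq, mul_assoc, hx', inv_mul_cancel_left]
    rw [Subgroup.mem_center_iff]
    intro a
    apply hf
    rw [map_mul f a, map_mul f _ a, h1]
    exact Subgroup.mem_center_iff.1 (mul_mem hz (inv_mem hFz)) (f a)
  obtain ⟨g, z, hz, hxz⟩ := exists_mul_center hsup (x : B)
  obtain ⟨h, w, hw, hyw⟩ := exists_mul_center hsup (y : B)
  -- If either of `g⁻¹ * F g` and `h⁻¹ * F h` were trivial, `x` or `y` would lie in the subgroup. So
  -- both are the unique nontrivial central element, which cancels in `F (g * h⁻¹)`.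
  have hc := hcenter _ (central x g z hz hxz) _ (central y h w hw hyw)
    (fun h1 => hx (key x g z hz hxz (inv_mul_eq_one.1 h1).symm))
    (fun h1 => hy (key y h w hw hyw (inv_mul_eq_one.1 h1).symm))
  refine key _ (g * h⁻¹) (z * w⁻¹) (mul_mem hz (inv_mem hw)) ?_ ?_
  · change _ = (x : B) * (y : B)⁻¹
    have hz' := Subgroup.mem_center_iff.1 (mul_mem hz (inv_mem hw)) (f h)⁻¹
    rw [← hxz, ← hyw, map_mul, map_inv, mul_inv_rev, mul_assoc, hz']
    group
  · have h1 : F g = g * (g⁻¹ * F g) := by group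
    have h2 : F h = h * (h⁻¹ * F h) := by group
    rw [map_mul, map_inv, h1, h2, hc]
    group

end FixedPoints

/-! ### Surjectivity and finite fixed points of Frobenius endomorphisms -/

section Frobenius

variable {p : ℕ} [Fact p.Prime] {n : ℕ} {G : Subgroup (GL (Fin n) (AlgebraicClosure (ZMod p)))}
  {F : Monoid.End G}

theorem IsClosedEmbedding.injective {k : Type*} [Field k] {n n' : ℕ} {G : Subgroup (GL (Fin n) k)}
    {f : G →* GL (Fin n') k} (hf : IsClosedEmbedding G f) : Function.Injective f := by
  intro g h hgh
  apply Subtype.ext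
  apply Units.ext
  ext i j
  obtain ⟨q, hq⟩ := hf.regular_inv i j
  rw [hq, hq, hgh]

/-- Finitely many algebraic elements generate a finite field. -/
theorem exists_pow_eq_of_finite {ι : Type*} [Finite ι] (x : ι → AlgebraicClosure (ZMod p)) :
    ∃ j, 0 < j ∧ ∀ i, x i ^ p ^ j = x i := by
  let K := IntermediateField.adjoin (ZMod p) (Set.range x)
  have : FiniteDimensional (ZMod p) K :=
    IntermediateField.finiteDimensional_adjoin fun y _ => Algebra.IsIntegral.isIntegral y
  have : Finite K := Module.finite_of_finite (ZMod p)
  have := Fintype.ofFinite K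
  refine ⟨Module.finrank (ZMod p) K, Module.finrank_pos, fun i => ?_⟩
  have h := FiniteField.pow_card (⟨x i, IntermediateField.subset_adjoin _ _ ⟨i, rfl⟩⟩ : K)
  rw [Module.card_eq_pow_finrank (K := ZMod p) (V := K), ZMod.card] at h
  exact congrArg Subtype.val h

theorem IsFrobenius.pow (hF : IsFrobenius p G F) : ∃ (r : ℕ)
    (f : G →* GL (Fin r) (AlgebraicClosure (ZMod p))), Function.Injective f ∧
    ∀ (m : ℕ) (g : G) (i j : Fin r),
      (f ((F ^ m) g) : Matrix (Fin r) (Fin r) (AlgebraicClosure (ZMod p))) i j =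
      ((f g : Matrix (Fin r) (Fin r) (AlgebraicClosure (ZMod p))) i j) ^ p ^ m := by
  obtain ⟨r, f, hf, h⟩ := hF
  refine ⟨r, f, hf.injective, fun m => ?_⟩
  induction m with
  | zero => simp
  | succ m ih =>
    intro g i j
    rw [pow_succ']
    change (f (F ((F ^ m) g)) : Matrix (Fin r) (Fin r) (AlgebraicClosure (ZMod p))) i j = _
    rw [h, ih, ← pow_mul, pow_succ]

/-- The matrix entries of an element `g` lie in a finite field, so some positive power of `F` fixes
`g`; the preceding power provides a preimage. -/
theorem IsFrobenius.surjective_pow (hF : IsFrobenius p G F) (m : ℕ) :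
    Function.Surjective (F ^ m) := by
  suffices h : Function.Surjective F by
    induction m with
    | zero => exact fun x => ⟨x, rfl⟩
    | succ m ih =>
      rw [pow_succ']
      exact h.comp ih
  obtain ⟨r, f, hf, h⟩ := hF.pow
  intro g
  obtain ⟨j, hj, hpow⟩ := exists_pow_eq_of_finite fun ij : Fin r × Fin r =>
    (f g : Matrix (Fin r) (Fin r) (AlgebraicClosure (ZMod p))) ij.1 ij.2
  obtain ⟨j, rfl⟩ := Nat.exists_eq_add_of_lt hj
  refine ⟨(F ^ (0 + j)) g, hf (Units.ext ?_)⟩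
  ext a b
  change (f ((F * F ^ (0 + j)) g) :
    Matrix (Fin r) (Fin r) (AlgebraicClosure (ZMod p))) a b = _
  rw [← pow_succ', h, hpow (a, b)]

/-- The matrix entries of a fixed point are roots of the nonzero polynomial `X ^ p ^ m - X`. -/
theorem IsFrobenius.finite_fixedPts (hF : IsFrobenius p G F) {m : ℕ} (hm : 0 < m) :
    Finite (fixedPts (F ^ m)) := by
  obtain ⟨r, f, hf, h⟩ := hF.pow
  let k := AlgebraicClosure (ZMod p)
  have hfin : Finite {x : k // x ^ p ^ m = x} := by
    have hp := (Fact.out : p.Prime).one_lt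
    have hne : (Polynomial.X ^ p ^ m - Polynomial.X : Polynomial k) ≠ 0 :=
      FiniteField.X_pow_card_pow_sub_X_ne_zero k hm.ne' hp
    refine ((Polynomial.X ^ p ^ m - Polynomial.X : Polynomial k).rootSet_finite k).subset ?_
    intro x hx
    rw [Polynomial.mem_rootSet]
    refine ⟨hne, ?_⟩
    change x ^ p ^ m = x at hx
    simpa [sub_eq_zero] using hx
  let φ : fixedPts (F ^ m) → Fin r × Fin r → {x : k // x ^ p ^ m = x} := fun g ij =>
    ⟨(f g : Matrix (Fin r) (Fin r) k) ij.1 ij.2, by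
      have hg : (F ^ m) (g : G) = g := g.2
      rw [← h, hg]⟩
  refine Finite.of_injective φ fun g g' hgg' => Subtype.ext (hf (Units.ext ?_))
  ext a b
  exact congrArg Subtype.val (congrFun hgg' (a, b))

end Frobenius

/-! ### Leading forms and the tangent space at a point -/

section Tangent

open MvPolynomial

theorem prod_pow_sub_prod_pow_mem {ι S : Type*} [CommRing S] (m : Ideal S) {u v : ι → S}
    (hu : ∀ i, u i ∈ m) (huv : ∀ i, u i - v i ∈ m ^ 2) (d : ι →₀ ℕ) :
    (d.prod fun i a => u i ^ a) ∈ m ^ d.degree ∧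
      (d.prod fun i a => u i ^ a) - (d.prod fun i a => v i ^ a) ∈ m ^ (d.degree + 1) := by
  have hv : ∀ i, v i ∈ m := fun i => by
    have := m.sub_mem (hu i) (Ideal.pow_le_self two_ne_zero (huv i))
    rwa [sub_sub_cancel] at this
  have mul : ∀ (a a' b b' : S) (s t : ℕ), a ∈ m ^ s → a - a' ∈ m ^ (s + 1) → b ∈ m ^ t →
      b - b' ∈ m ^ (t + 1) → a * b ∈ m ^ (s + t) ∧ a * b - a' * b' ∈ m ^ (s + t + 1) := by
    intro a a' b b' s t ha haa hb hbb
    refine ⟨by rw [pow_add]; exact Ideal.mul_mem_mul ha hb, ?_⟩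
    have hb' : b' ∈ m ^ t := by
      have := (m ^ t).sub_mem hb (Ideal.pow_le_pow_right t.le_succ hbb)
      rwa [sub_sub_cancel] at this
    have h : a * b - a' * b' = a * (b - b') + (a - a') * b' := by ring
    rw [h]
    refine Ideal.add_mem _ ?_ ?_
    · rw [add_assoc, pow_add]
      exact Ideal.mul_mem_mul ha hbb
    · rw [add_right_comm, pow_add]
      exact Ideal.mul_mem_mul haa hb'
  have hsingle : ∀ (i : ι) (a : ℕ), u i ^ a ∈ m ^ a ∧ u i ^ a - v i ^ a ∈ m ^ (a + 1) := by
    intro i a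
    induction a with
    | zero => simp
    | succ a ih =>
      rw [pow_succ (u i), pow_succ (v i)]
      exact mul _ _ _ _ a 1 ih.1 ih.2 (by simpa using hu i) (huv i)
  induction d using Finsupp.induction_linear with
  | zero => simp
  | single i a => simpa using hsingle i a
  | add d e hd he =>
    rw [Finsupp.prod_add_index' (by simp) (by simp [pow_add]),
      Finsupp.prod_add_index' (by simp) (by simp [pow_add]), map_add]
    exact mul _ _ _ _ _ _ hd.1 hd.2 he.1 he.2

/-- A form of degree `r` in elements of `m` changes only in order `r + 1` when its arguments change
in order two. -/
theorem aeval_sub_aeval_mem {k ι S : Type*} [Field k] [CommRing S] [Algebra k S] (m : Ideal S)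
    {u v : ι → S} (hu : ∀ i, u i ∈ m) (huv : ∀ i, u i - v i ∈ m ^ 2) {r : ℕ}
    {P : MvPolynomial ι k} (hP : P.IsHomogeneous r) :
    aeval u P - aeval v P ∈ m ^ (r + 1) := by
  rw [P.as_sum, map_sum, map_sum, ← Finset.sum_sub_distrib]
  refine Ideal.sum_mem _ fun d hd => ?_
  rw [aeval_monomial, aeval_monomial, ← mul_sub]
  refine Ideal.mul_mem_left _ _ ?_
  have hdr : d.degree = r := by
    by_contra h
    exact (mem_support_iff.1 hd) (hP.coeff_eq_zero h)
  rw [← hdr]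
  exact (prod_pow_sub_prod_pow_mem m hu huv d).2

theorem aeval_mem_pow {k ι S : Type*} [Field k] [CommRing S] [Algebra k S] (m : Ideal S)
    {u : ι → S} (hu : ∀ i, u i ∈ m) {r : ℕ} {P : MvPolynomial ι k}
    (hP : P ∈ idealOfVars ι k ^ r) : aeval u P ∈ m ^ r := by
  have h1 : (idealOfVars ι k).map (aeval u : MvPolynomial ι k →ₐ[k] S) ≤ m := by
    rw [Ideal.map_span, Ideal.span_le]
    rintro _ ⟨_, ⟨i, rfl⟩, rfl⟩
    simpa using hu i
  have h2 := Ideal.mem_map_of_mem (aeval u : MvPolynomial ι k →ₐ[k] S) hP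
  rw [Ideal.map_pow] at h2
  exact Ideal.pow_right_mono h1 r h2

/-- The linear part of a polynomial, as a linear form. -/
noncomputable def linearPart {k ι : Type*} [Field k] [Fintype ι] :
    MvPolynomial ι k →ₗ[k] Module.Dual k (ι → k) where
  toFun h := ∑ i, coeff (Finsupp.single i 1) h • LinearMap.proj i
  map_add' f g := by simp [add_smul, Finset.sum_add_distrib]
  map_smul' c f := by simp [mul_smul, Finset.smul_sum]

theorem linearPart_apply {k ι : Type*} [Field k] [Fintype ι] (h : MvPolynomial ι k) (x : ι → k) :
    linearPart h x = ∑ i, coeff (Finsupp.single i 1) h * x i := by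
  simp [linearPart]

/-- Two polynomials with the same constant and linear terms agree up to order two. -/
theorem sub_mem_sq {k ι : Type*} [Field k] {f g : MvPolynomial ι k}
    (h0 : coeff 0 f = coeff 0 g)
    (h1 : ∀ i, coeff (Finsupp.single i 1) f = coeff (Finsupp.single i 1) g) :
    f - g ∈ idealOfVars ι k ^ 2 := by
  rw [mem_pow_idealOfVars_iff']
  intro d hd
  rw [coeff_sub, sub_eq_zero]
  have : d.degree = 0 ∨ d.degree = 1 := by omega
  rcases this with h | h
  · rw [Finsupp.degree_eq_zero_iff] at h
    rw [h, h0]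
  · obtain ⟨i, hi⟩ : ∃ i, d i ≠ 0 := by
      by_contra hne
      push Not at hne
      rw [show d = 0 from Finsupp.ext hne] at h
      simp at h
    obtain ⟨e, rfl⟩ := le_iff_exists_add.1
      (Finsupp.single_le_iff.2 (Nat.one_le_iff_ne_zero.2 hi))
    rw [map_add, Finsupp.degree_single] at h
    rw [(Finsupp.degree_eq_zero_iff e).1 (by omega), add_zero]
    exact h1 i

/-- A polynomial outside the prime ideal `I` of polynomials vanishing at `0` has, modulo `I`, a
leading form that does not vanish identically on the tangent space. -/
theorem exists_leading_form {k ι : Type*} [Field k] [Infinite k] [Fintype ι]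
    (I : Ideal (MvPolynomial ι k)) [hI : I.IsPrime] (h0 : ∀ h ∈ I, coeff 0 h = 0)
    {f : MvPolynomial ι k} (hf : f ∉ I) :
    ∃ (r : ℕ) (P Q h : MvPolynomial ι k) (x : ι → k), P.IsHomogeneous r ∧
      Q ∈ idealOfVars ι k ^ (r + 1) ∧ h ∈ I ∧ f = P + Q + h ∧
      (∀ g ∈ I, linearPart g x = 0) ∧ eval x P ≠ 0 := by
  classical
  set M := idealOfVars ι k with hM
  set m : Ideal (MvPolynomial ι k ⧸ I) := M.map (Ideal.Quotient.mk I) with hm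
  have hpow : ∀ (r : ℕ) (g : MvPolynomial ι k), Ideal.Quotient.mk I g ∈ m ^ r →
      ∃ g' ∈ M ^ r, g - g' ∈ I := by
    intro r g hg
    rw [hm, ← Ideal.map_pow, Ideal.mem_map_iff_of_surjective _ Ideal.Quotient.mk_surjective] at hg
    obtain ⟨g', hg', h⟩ := hg
    exact ⟨g', hg', Ideal.Quotient.eq.1 h.symm⟩
  have hmtop : m ≠ ⊤ := by
    intro htop
    have h1 : Ideal.Quotient.mk I 1 ∈ m ^ 1 := by rw [htop]; simp
    obtain ⟨g, hg, hgI⟩ := hpow 1 1 h1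
    have h2 := h0 _ hgI
    rw [coeff_sub, (mem_pow_idealOfVars_iff' 1 g).1 hg 0 (by simp)] at h2
    simp at h2
  -- Krull's intersection theorem in the Noetherian domain of functions: a nonzero function has
  -- finite order of vanishing at the point.
  have hex : ∃ r, Ideal.Quotient.mk I f ∉ m ^ r := by
    by_contra hall
    push Not at hall
    apply hf
    rw [← Ideal.Quotient.eq_zero_iff_mem]
    have : Ideal.Quotient.mk I f ∈ ⨅ r, m ^ r := (Submodule.mem_iInf _).2 hall
    rwa [Ideal.iInf_pow_eq_bot_of_isDomain m hmtop] at this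
  obtain ⟨r, hr1, hr2⟩ : ∃ r, Ideal.Quotient.mk I f ∈ m ^ r ∧
      Ideal.Quotient.mk I f ∉ m ^ (r + 1) := by
    have h1 := Nat.find_spec hex
    rcases hr : Nat.find hex with _ | r
    · rw [hr] at h1
      simp at h1
    · refine ⟨r, ?_, hr ▸ h1⟩
      by_contra h2
      have := Nat.find_min' hex h2
      omega
  obtain ⟨f', hf', hff'⟩ := hpow r f hr1
  set P := homogeneousComponent r f' with hP
  have hPhom : P.IsHomogeneous r := homogeneousComponent_isHomogeneous r f'
  have hQ : f' - P ∈ M ^ (r + 1) := by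
    rw [mem_pow_idealOfVars_iff'] at hf' ⊢
    intro d hd
    rw [coeff_sub, hP, coeff_homogeneousComponent]
    split_ifs with h
    · exact sub_self _
    · rw [hf' d (by omega), sub_zero]
  -- Otherwise `P` vanishes on the tangent space `W`. Substituting the linear projection `v` onto
  -- `W` kills `P`, while each `X i` agrees with `v i` modulo `I` up to order two; so `P`, and with
  -- it `f`, would have order greater than `r`.
  by_contra hno
  push Not at hno
  have hvan : ∀ x : ι → k, (∀ g ∈ I, linearPart g x = 0) → eval x P = 0 := fun x hx =>
    hno r P (f' - P) (f - f') x hPhom hQ hff' (by ring) hx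
  set D : Submodule k (Module.Dual k (ι → k)) := (I.restrictScalars k).map linearPart with hD
  set W : Submodule k (ι → k) := D.dualCoannihilator with hW
  have hWmem : ∀ x : ι → k, x ∈ W ↔ ∀ g ∈ I, linearPart g x = 0 := by
    intro x
    rw [hW, Submodule.mem_dualCoannihilator]
    constructor
    · intro h g hg
      exact h _ ⟨g, hg, rfl⟩
    · rintro h _ ⟨g, hg, rfl⟩
      exact h g hg
  obtain ⟨W', hW'⟩ := Submodule.exists_isCompl W
  let π : (ι → k) →ₗ[k] (ι → k) := W.subtype ∘ₗ W.projectionOnto W' hW'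
  have hπmem : ∀ x, π x ∈ W := fun x => (W.projectionOnto W' hW' x).2
  have hπW : ∀ x ∈ W, π x = x := fun x hx => by
    have := Submodule.projectionOnto_apply_left hW' ⟨x, hx⟩
    simp only [π, LinearMap.comp_apply, this]
    rfl
  let v : ι → MvPolynomial ι k := fun i => ∑ j, C (π (Pi.single j 1) i) * X j
  have hveval : ∀ (x : ι → k) (i : ι), eval x (v i) = π x i := by
    intro x i
    have : π x = ∑ j, x j • π (Pi.single j 1) := by
      conv_lhs => rw [pi_eq_sum_univ' x, map_sum]
      simp
    rw [this]
    simp [v, Finset.sum_apply, mul_comm]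
  have hvP : aeval v P = 0 := by
    apply MvPolynomial.funext
    intro x
    have h1 : eval x (aeval v P) = eval (π x) P := by
      rw [← MvPolynomial.coe_aeval_eq_eval, ← MvPolynomial.coe_aeval_eq_eval, RingHom.coe_coe,
        RingHom.coe_coe, MvPolynomial.comp_aeval_apply]
      congr 2
      funext i
      rw [← hveval x i]
      rfl
    rw [h1, hvan _ ((hWmem _).1 (hπmem x)), map_zero]
  have hcoeffv : ∀ i j, coeff (Finsupp.single j 1) (v i) = π (Pi.single j 1) i := by
    intro i j
    simp only [v, coeff_sum, coeff_C_mul, coeff_X]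
    rw [Finset.sum_eq_single j]
    · simp
    · intro j' _ hj'
      rw [if_neg, mul_zero]
      intro h
      exact hj' (Finsupp.single_left_injective one_ne_zero h)
    · simp
  have hcoeffv0 : ∀ i, coeff 0 (v i) = 0 := by
    intro i
    simp [v, coeff_sum, coeff_C_mul]
  -- The linear form `X i - v i` vanishes on `W`, so by double annihilation in finite dimension it
  -- is the linear part of an element of `I`.
  have hXv : ∀ i, ∃ h ∈ I, X i - v i - h ∈ M ^ 2 := by
    intro i
    have hann : linearPart (X i - v i) ∈ W.dualAnnihilator := by
      rw [Submodule.mem_dualAnnihilator]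
      intro x hx
      rw [linearPart_apply]
      simp only [coeff_sub, hcoeffv, coeff_X, sub_mul, Finset.sum_sub_distrib]
      have h1 : ∑ j, (if Finsupp.single i 1 = Finsupp.single j 1 then (1 : k) else 0) * x j =
          x i := by
        rw [Finset.sum_eq_single i]
        · simp
        · intro j _ hj
          rw [if_neg, zero_mul]
          intro h
          exact hj (Finsupp.single_left_injective one_ne_zero h).symm
        · simp
      have h2 : ∑ j, π (Pi.single j 1) i * x j = π x i := by
        rw [← hveval x i]
        simp [v]
      rw [h1, h2, hπW x hx, sub_self]
    rw [hW, Subspace.dualCoannihilator_dualAnnihilator_eq] at hann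
    obtain ⟨h, hhI, hh⟩ := hann
    refine ⟨h, hhI, sub_mem_sq ?_ ?_⟩
    · rw [h0 h hhI, coeff_sub, hcoeffv0, coeff_zero_X, sub_zero]
    · intro j
      have := congrArg (fun φ : Module.Dual k (ι → k) => φ (Pi.single j 1)) hh
      simp only [linearPart_apply] at this
      simpa [Pi.single_apply] using this.symm
  apply hr2
  have hmkX : ∀ i, Ideal.Quotient.mk I (X i) ∈ m := fun i =>
    Ideal.mem_map_of_mem _ (Ideal.subset_span ⟨i, rfl⟩)
  have hPm : Ideal.Quotient.mk I P ∈ m ^ (r + 1) := by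
    have h1 := aeval_sub_aeval_mem m (u := fun i => Ideal.Quotient.mk I (X i))
      (v := fun i => Ideal.Quotient.mk I (v i)) hmkX (fun i => ?_) hPhom
    · have h2 : ∀ w : ι → MvPolynomial ι k,
          aeval (fun i => Ideal.Quotient.mk I (w i)) P = Ideal.Quotient.mk I (aeval w P) := by
        intro w
        exact (MvPolynomial.comp_aeval_apply w (Ideal.Quotient.mkₐ k I) P).symm
      rw [h2, h2, hvP, map_zero, sub_zero, aeval_X_left_apply] at h1
      exact h1
    · obtain ⟨h, hhI, hh⟩ := hXv i
      rw [hm, ← Ideal.map_pow, ← map_sub]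
      have h3 := Ideal.mem_map_of_mem (Ideal.Quotient.mk I) hh
      rwa [map_sub, Ideal.Quotient.eq_zero_iff_mem.2 hhI, sub_zero] at h3
  have hQm : Ideal.Quotient.mk I (f' - P) ∈ m ^ (r + 1) := by
    rw [hm, ← Ideal.map_pow]
    exact Ideal.mem_map_of_mem _ hQ
  have hfin : Ideal.Quotient.mk I f = Ideal.Quotient.mk I P + Ideal.Quotient.mk I (f' - P) := by
    rw [← map_add, add_sub_cancel]
    exact Ideal.Quotient.eq.2 hff'
  rw [hfin]
  exact Ideal.add_mem _ hPm hQm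

end Tangent

/-! ### Connected groups are irreducible in the Zariski topology -/

section Irreducible

open TopologicalSpace

/-- A homogeneous Noetherian space without nontrivial clopen sets is irreducible. -/
theorem isIrreducible_univ_of_homogeneous {X : Type*} [TopologicalSpace X] [NoetherianSpace X]
    (x₀ : X) (hconn : ∀ C : Set X, IsClopen C → C.Nonempty → C = Set.univ)
    (hhom : ∀ x y : X, ∃ e : X ≃ₜ X, e x = y) : IsIrreducible (Set.univ : Set X) := by
  set Z := irreducibleComponent x₀ with hZ
  have hZirr : IsIrreducible Z := isIrreducible_irreducibleComponent
  have hZcomp : Z ∈ irreducibleComponents X := irreducibleComponent_mem_irreducibleComponents x₀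
  have hZclosed : IsClosed Z := isClosed_irreducibleComponent
  -- The point `x` has a neighbourhood inside `Z`, so `Z` contains every irreducible set through
  -- `x`. Moving `x` by homeomorphisms to each point of `Z` shows that `Z` is open, hence
  -- everything.
  obtain ⟨o, ho, ⟨x, hx⟩, hoZ⟩ :=
    NoetherianSpace.exists_isOpen_nonempty_subset_irreducibleComponent Z hZcomp
  have huniq : ∀ W : Set X, IsIrreducible W → x ∈ W → W ⊆ Z := by
    intro W hW hxW
    exact (subset_closure_inter_of_isPreirreducible_of_isOpen hW.2 ho ⟨x, hxW, hx⟩).trans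
      (closure_minimal (Set.inter_subset_right.trans hoZ) hZclosed)
  have hopen : IsOpen Z := by
    rw [isOpen_iff_mem_nhds]
    intro z hz
    obtain ⟨e, he⟩ := hhom x z
    have heZ : e '' Z = Z := by
      have h1 : Z ⊆ e '' Z := by
        have h2 : e.symm '' Z ⊆ Z := huniq _ (hZirr.image e.symm e.symm.continuous.continuousOn)
          ⟨z, hz, by rw [← he, e.symm_apply_apply]⟩
        intro y hy
        exact ⟨e.symm y, h2 ⟨y, hy, rfl⟩, e.apply_symm_apply y⟩
      exact (hZcomp.le_of_ge (hZirr.image e e.continuous.continuousOn) h1).antisymm h1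
    refine Filter.mem_of_superset ((e.isOpenMap o ho).mem_nhds ⟨x, hx, he⟩) ?_
    rw [← heZ]
    exact Set.image_mono hoZ
  rw [← hconn Z ⟨hZclosed, hopen⟩ hZirr.nonempty]
  exact hZirr

variable {k : Type*} [Field k] {n : ℕ} (G : Subgroup (GL (Fin n) k))

/-- The Zariski topology on a subgroup of the general linear group. -/
@[reducible] noncomputable def zariskiTopology : TopologicalSpace G :=
  TopologicalSpace.induced
    (fun g : G => (⟨RingHom.ker (MvPolynomial.eval (coords (g : GL (Fin n) k))),
      RingHom.ker_isPrime _⟩ : PrimeSpectrum (MvPolynomial (Coord n) k))) inferInstance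

theorem isClosed_zariski_iff (S : Set G) : @IsClosed G (zariskiTopology G) S ↔
    ∃ I : Set (MvPolynomial (Coord n) k), S = {g : G | ∀ f ∈ I, evalReg f (g : GL (Fin n) k) = 0} := by
  unfold zariskiTopology
  rw [isClosed_induced_iff]
  constructor
  · rintro ⟨t, ht, rfl⟩
    obtain ⟨I, rfl⟩ := (PrimeSpectrum.isClosed_iff_zeroLocus t).1 ht
    exact ⟨I, rfl⟩
  · rintro ⟨I, rfl⟩
    exact ⟨PrimeSpectrum.zeroLocus I, PrimeSpectrum.isClosed_zeroLocus I, rfl⟩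

theorem noetherianSpace_zariski : @NoetherianSpace G (zariskiTopology G) :=
  let _ := zariskiTopology G
  Topology.IsInducing.noetherianSpace (Topology.IsInducing.mk rfl : Topology.IsInducing
    (fun g : G => (⟨RingHom.ker (MvPolynomial.eval (coords (g : GL (Fin n) k))),
      RingHom.ker_isPrime _⟩ : PrimeSpectrum (MvPolynomial (Coord n) k))))

/-- The polynomial map giving left translation by `g`. -/
noncomputable def leftTranslate (g : GL (Fin n) k) :
    MvPolynomial (Coord n) k →ₐ[k] MvPolynomial (Coord n) k :=
  MvPolynomial.aeval (Sum.elim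
    (fun ij => ∑ l, MvPolynomial.C ((g : Matrix (Fin n) (Fin n) k) ij.1 l) *
      MvPolynomial.X (Sum.inl (l, ij.2)))
    (fun ij => ∑ l, MvPolynomial.X (Sum.inr (ij.1, l)) *
      MvPolynomial.C (((g⁻¹ : GL (Fin n) k) : Matrix (Fin n) (Fin n) k) l ij.2)))

theorem evalReg_leftTranslate (g x : GL (Fin n) k) (f : MvPolynomial (Coord n) k) :
    evalReg (leftTranslate g f) x = evalReg f (g * x) := by
  unfold evalReg leftTranslate
  rw [← MvPolynomial.coe_aeval_eq_eval, RingHom.coe_coe, MvPolynomial.comp_aeval_apply,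
    ← MvPolynomial.coe_aeval_eq_eval, RingHom.coe_coe]
  congr 2
  funext c
  rcases c with ij | ij
  · simp [coords, Matrix.mul_apply]
  · simp only [coords, Sum.elim_inr, mul_inv_rev, Units.val_mul, Matrix.mul_apply, map_sum,
      map_mul, MvPolynomial.aeval_X, MvPolynomial.aeval_C]
    rfl

theorem continuous_mul_left_zariski (g : G) :
    @Continuous G G (zariskiTopology G) (zariskiTopology G) fun x => g * x := by
  let _ := zariskiTopology G
  rw [continuous_iff_isClosed]
  intro S hS
  obtain ⟨I, rfl⟩ := (isClosed_zariski_iff G S).1 hS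
  refine (isClosed_zariski_iff G _).2 ⟨leftTranslate (g : GL (Fin n) k) '' I, ?_⟩
  ext x
  constructor
  · rintro h _ ⟨f, hf, rfl⟩
    rw [evalReg_leftTranslate]
    exact h f hf
  · intro h f hf
    have := h _ ⟨f, hf, rfl⟩
    rwa [evalReg_leftTranslate] at this

variable {G}

/-- The regular functions on a Zariski connected group form a domain. -/
theorem evalReg_eq_zero_or (hG : IsZariskiConnected (G : Set (GL (Fin n) k)))
    {f₁ f₂ : MvPolynomial (Coord n) k} (h : ∀ g ∈ G, evalReg f₁ g * evalReg f₂ g = 0) :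
    (∀ g ∈ G, evalReg f₁ g = 0) ∨ (∀ g ∈ G, evalReg f₂ g = 0) := by
  let _ := zariskiTopology G
  have := noetherianSpace_zariski G
  have hirr : IsIrreducible (Set.univ : Set G) := by
    -- Homogeneity comes from left translations; connectedness enters through closed equations for a
    -- clopen set and its complement.
    refine isIrreducible_univ_of_homogeneous 1 (fun C hC hne => ?_) fun x y => ?_
    · obtain ⟨I, hI⟩ := (isClosed_zariski_iff G C).1 hC.1
      obtain ⟨J, hJ⟩ := (isClosed_zariski_iff G Cᶜ).1 hC.compl.1
      have hCI : ∀ x (hx : x ∈ G), (⟨x, hx⟩ : G) ∈ C ↔ ∀ f ∈ I, evalReg f x = 0 := fun x hx => by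
        rw [hI]; rfl
      have hCJ : ∀ x (hx : x ∈ G), (⟨x, hx⟩ : G) ∈ Cᶜ ↔ ∀ f ∈ J, evalReg f x = 0 := fun x hx => by
        rw [hJ]; rfl
      have hcover : (G : Set (GL (Fin n) k)) ⊆
          {g | ∀ f ∈ I, evalReg f g = 0} ∪ {g | ∀ f ∈ J, evalReg f g = 0} := by
        intro x hx
        by_cases hxC : (⟨x, hx⟩ : G) ∈ C
        · exact Or.inl ((hCI x hx).1 hxC)
        · exact Or.inr ((hCJ x hx).1 hxC)
      have hdisj : (G : Set (GL (Fin n) k)) ∩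
          ({g | ∀ f ∈ I, evalReg f g = 0} ∩ {g | ∀ f ∈ J, evalReg f g = 0}) = ∅ := by
        refine Set.eq_empty_iff_forall_notMem.2 ?_
        rintro x ⟨hx, hxI, hxJ⟩
        exact (hCJ x hx).2 hxJ ((hCI x hx).2 hxI)
      rcases hG.2 _ _ ⟨I, rfl⟩ ⟨J, rfl⟩ hcover hdisj with hsub | hsub
      · exact Set.eq_univ_of_forall fun x => (hCI x x.2).2 (hsub x.2)
      · obtain ⟨x, hx⟩ := hne
        exact absurd hx ((hCJ x x.2).2 (hsub x.2))
    · refine ⟨⟨Equiv.mulLeft (y * x⁻¹), continuous_mul_left_zariski G _, ?_⟩, ?_⟩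
      · exact continuous_mul_left_zariski G (y * x⁻¹)⁻¹
      · change y * x⁻¹ * x = y
        rw [inv_mul_cancel_right]
  have hclosed : ∀ f : MvPolynomial (Coord n) k,
      IsClosed {g : G | evalReg f (g : GL (Fin n) k) = 0} := fun f =>
    (isClosed_zariski_iff G _).2 ⟨{f}, by simp⟩
  have hcover : (Set.univ : Set G) ⊆ {g : G | evalReg f₁ (g : GL (Fin n) k) = 0} ∪
      {g : G | evalReg f₂ (g : GL (Fin n) k) = 0} := fun g _ => mul_eq_zero.1 (h g g.2)
  have hor := isPreirreducible_iff_isClosed_union_isClosed.1 hirr.2 _ _ (hclosed f₁) (hclosed f₂)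
    hcover
  refine hor.imp (fun h g hg => ?_) fun h g hg => ?_
  · exact (h (Set.mem_univ (⟨g, hg⟩ : G)) :)
  · exact (h (Set.mem_univ (⟨g, hg⟩ : G)) :)

end Irreducible

/-! ### A density criterion by curves through the identity -/

section Density

open MvPolynomial

variable {k : Type*} [Field k] {n : ℕ}

/-- The entries of a matrix, as a function of the pair of indices. -/
def entries {C : Type*} (γ : Matrix (Fin n) (Fin n) C) (ij : Fin n × Fin n) : C := γ ij.1 ij.2

/-- Translation of polynomials in matrix entries by the identity matrix. -/
noncomputable def shiftOne :
    MvPolynomial (Fin n × Fin n) k →ₐ[k] MvPolynomial (Fin n × Fin n) k :=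
  aeval fun ij => X ij + C (entries 1 ij)

theorem aeval_shiftOne {S : Type*} [CommRing S] [Algebra k S] (γ : Matrix (Fin n) (Fin n) S)
    (f : MvPolynomial (Fin n × Fin n) k) :
    aeval (entries (γ - 1)) (shiftOne f) = aeval (entries γ) f := by
  rw [shiftOne, MvPolynomial.comp_aeval_apply]
  congr 2
  funext ij
  by_cases h : ij.1 = ij.2
  · simp [entries, Matrix.one_apply, h]
  · simp [entries, h]

theorem aeval_unshiftOne {S : Type*} [CommRing S] [Algebra k S] (γ : Matrix (Fin n) (Fin n) S)
    (f : MvPolynomial (Fin n × Fin n) k) :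
    aeval (entries γ) (aeval (fun ij => X ij - C (entries 1 ij)) f :
      MvPolynomial (Fin n × Fin n) k) = aeval (entries (γ - 1)) f := by
  rw [MvPolynomial.comp_aeval_apply]
  congr 2
  funext ij
  by_cases h : ij.1 = ij.2
  · simp [entries, Matrix.one_apply, h]
  · simp [entries, h]

/-- This identifies the linear parts of the equations of the group, with the origin moved to `1`,
with the differentials that define `lieAlgebra`. -/
theorem coeff_single_shiftOne (f : MvPolynomial (Fin n × Fin n) k) (ij : Fin n × Fin n) :
    coeff (Finsupp.single ij 1) (shiftOne f) = eval (entries 1) (pderiv ij f) := by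
  have h1 : ∀ g : MvPolynomial (Fin n × Fin n) k,
      coeff (Finsupp.single ij 1) g = coeff 0 (pderiv ij g) := fun g => by
    simp [coeff_pderiv]
  have h2 : ∀ g : MvPolynomial (Fin n × Fin n) k,
      pderiv ij (shiftOne g) = shiftOne (pderiv ij g) := by
    intro g
    induction g using MvPolynomial.induction_on with
    | C a => simp [shiftOne, algebraMap_eq]
    | add f g hf hg => simp only [map_add, hf, hg]
    | mul_X f i hf =>
      simp only [map_mul, pderiv_mul, hf, map_add]
      congr 2
      classical
      rw [pderiv_X]
      simp only [shiftOne, aeval_X, map_add, pderiv_X, pderiv_C, add_zero, Pi.single_apply]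
      split_ifs <;> simp
  have h3 : ∀ g : MvPolynomial (Fin n × Fin n) k,
      coeff 0 (shiftOne g) = eval (entries 1) g := by
    intro g
    rw [← constantCoeff_eq, shiftOne]
    induction g using MvPolynomial.induction_on with
    | C a => simp
    | add f g hf hg => simp only [map_add, hf, hg]
    | mul_X f i hf =>
      rw [map_mul, map_mul, map_mul, hf]
      simp
  rw [h1, h2, h3]

/-- A subset `Ω` of the connected group `G` is dense if each tangent vector at `1` is the derivative
of a curve through `1` whose generic point satisfies the equations of `Ω`. -/
theorem eval_eq_zero_of_curves [Infinite k] {G : Subgroup (GL (Fin n) k)}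
    (hG : IsZariskiConnected (G : Set (GL (Fin n) k))) {Ω : Set (GL (Fin n) k)}
    (hΩ : Ω ⊆ G)
    (hcurve : ∀ x ∈ lieAlgebra G, ∃ (S : Type) (_ : CommRing S) (_ : Algebra k S) (ε : S →ₐ[k] k)
      (s : S) (γ : Matrix (Fin n) (Fin n) S), (∀ c, s * c = 0 → c = 0) ∧ ε s = 0 ∧
      (∀ ij, entries (γ - 1) ij - s * algebraMap k S (x ij.1 ij.2) ∈ Ideal.span {s} ^ 2) ∧
      ∀ f : MvPolynomial (Fin n × Fin n) k,
        (∀ g ∈ Ω, eval (entries (g : Matrix (Fin n) (Fin n) k)) f = 0) → aeval (entries γ) f = 0)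
    {f : MvPolynomial (Fin n × Fin n) k}
    (hf : ∀ g ∈ Ω, eval (entries (g : Matrix (Fin n) (Fin n) k)) f = 0) :
    ∀ g ∈ G, eval (entries (g : Matrix (Fin n) (Fin n) k)) f = 0 := by
  have eval_eq : ∀ (v : Fin n × Fin n → k) (h : MvPolynomial (Fin n × Fin n) k),
      eval v h = aeval v h := fun v h => rfl
  -- The equations of `G` in the coordinates of `g - 1`; the ideal is prime since the regular
  -- functions on `G` form a domain.
  let I : Ideal (MvPolynomial (Fin n × Fin n) k) :=
    { carrier := {h | ∀ g ∈ G, eval (entries ((g : Matrix (Fin n) (Fin n) k) - 1)) h = 0}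
      add_mem' := fun {a b} ha hb g hg => by rw [map_add, ha g hg, hb g hg, add_zero]
      zero_mem' := fun g _ => map_zero _
      smul_mem' := fun c a ha g hg => by rw [smul_eq_mul, map_mul, ha g hg, mul_zero] }
  have hI : ∀ h, h ∈ I ↔ ∀ g ∈ G, eval (entries ((g : Matrix (Fin n) (Fin n) k) - 1)) h = 0 :=
    fun h => Iff.rfl
  have hprime : I.IsPrime := by
    constructor
    · intro htop
      have h1 : (1 : MvPolynomial (Fin n × Fin n) k) ∈ I := htop ▸ Submodule.mem_top
      simpa using h1 1 G.one_mem
    · intro a b hab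
      let t : MvPolynomial (Fin n × Fin n) k →ₐ[k] MvPolynomial (Coord n) k :=
        (rename Sum.inl).comp (aeval fun ij => X ij - C (entries 1 ij))
      have ht : ∀ h (g : GL (Fin n) k), evalReg (t h) g =
          eval (entries ((g : Matrix (Fin n) (Fin n) k) - 1)) h := by
        intro h g
        rw [eval_eq, ← aeval_unshiftOne]
        simp only [t, evalReg, AlgHom.comp_apply, eval_rename]
        rfl
      refine (evalReg_eq_zero_or hG (f₁ := t a) (f₂ := t b) fun g hg => ?_).imp
        (fun h g hg => (ht a g).symm.trans (h g hg)) fun h g hg => (ht b g).symm.trans (h g hg)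
      rw [ht, ht, ← map_mul]
      exact hab g hg
  by_contra hne
  have hfI : shiftOne f ∉ I := by
    intro hmem
    apply hne
    intro g hg
    have := hmem g hg
    rwa [eval_eq, aeval_shiftOne, ← eval_eq] at this
  have h0 : ∀ h ∈ I, coeff 0 h = 0 := by
    intro h hh
    have h1 := hh 1 G.one_mem
    rw [Units.val_one, sub_self, show entries (0 : Matrix (Fin n) (Fin n) k) = 0 from rfl,
      MvPolynomial.eval_zero] at h1
    rwa [← constantCoeff_eq]
  obtain ⟨r, P, Q, h, x, hP, hQ, hh, hsum, htan, hPx⟩ := exists_leading_form I h0 hfI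
  have hxLie : (fun i j => x (i, j) : Matrix (Fin n) (Fin n) k) ∈ lieAlgebra G := by
    intro f' hf'
    have h1 : shiftOne f' ∈ I := by
      intro g hg
      rw [eval_eq, aeval_shiftOne, ← eval_eq]
      exact hf' g hg
    have h2 := htan _ h1
    rw [linearPart_apply] at h2
    simp only [coeff_single_shiftOne] at h2
    exact h2
  obtain ⟨S, _, _, ε, s, γ, hs, hε, hγ, hvan⟩ := hcurve _ hxLie
  have hfz := hvan f hf
  have hhz : aeval (entries (γ - 1)) h = 0 := by
    have h1 := hvan (aeval (fun ij => X ij - C (entries 1 ij)) h) fun g hg => by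
      rw [eval_eq, aeval_unshiftOne, ← eval_eq]
      exact hh g (hΩ hg)
    rwa [aeval_unshiftOne] at h1
  set m : Ideal S := Ideal.span {s}
  have hsm : s ∈ m := Ideal.mem_span_singleton_self s
  have hγm : ∀ ij, entries (γ - 1) ij ∈ m := fun ij => by
    have h1 := m.add_mem (Ideal.pow_le_self two_ne_zero (hγ ij))
      (m.mul_mem_right (algebraMap k S (x (ij.1, ij.2))) hsm)
    rwa [sub_add_cancel] at h1
  have h1 := aeval_sub_aeval_mem m hγm hγ hP
  have h2 := aeval_mem_pow m hγm hQ
  have h3 : aeval (entries (γ - 1)) P = -aeval (entries (γ - 1)) Q := by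
    rw [← aeval_shiftOne, hsum, map_add, map_add, hhz, add_zero] at hfz
    exact eq_neg_of_add_eq_zero_left hfz
  have h4 : aeval (fun ij : Fin n × Fin n => s * algebraMap k S (x (ij.1, ij.2))) P =
      s ^ r * algebraMap k S (eval x P) := by
    have hterm : ∀ d ∈ P.support, d.prod (fun ij a => (s * algebraMap k S (x (ij.1, ij.2))) ^ a) =
        s ^ r * algebraMap k S (d.prod fun ij a => x ij ^ a) := by
      intro d hd
      have hdr : d.degree = r := by
        by_contra hc
        exact (mem_support_iff.1 hd) (hP.coeff_eq_zero hc)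
      simp only [Finsupp.prod, mul_pow, Finset.prod_mul_distrib, map_prod, map_pow]
      rw [Finset.prod_pow_eq_pow_sum, ← Finsupp.degree_apply, hdr]
    conv_lhs => rw [P.as_sum]
    conv_rhs => rw [P.as_sum]
    rw [map_sum, map_sum, map_sum, Finset.mul_sum]
    refine Finset.sum_congr rfl fun d hd => ?_
    rw [aeval_monomial, eval_monomial, map_mul, hterm d hd]
    ring
  -- Along the curve, the leading form contributes `s ^ r P(x)` and everything else lies in `(s ^ (r
  -- + 1))`. Cancelling `s ^ r` and setting `s = 0` by `ε` forces `P(x) = 0`, contrary to the choice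
  -- of `x`.
  have h5 : s ^ r * algebraMap k S (eval x P) ∈ m ^ (r + 1) := by
    rw [← h4]
    have h6 := (m ^ (r + 1)).sub_mem ((m ^ (r + 1)).neg_mem h2) h1
    rw [← h3, sub_sub_cancel] at h6
    exact h6
  rw [Ideal.span_singleton_pow, Ideal.mem_span_singleton] at h5
  obtain ⟨c, hc⟩ := h5
  have h6 : ∀ t : ℕ, ∀ c : S, s ^ t * c = 0 → c = 0 := by
    intro t
    induction t with
    | zero => simp
    | succ t ih =>
      intro c hc
      rw [pow_succ, mul_assoc] at hc
      exact hs c (ih _ hc)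
  have h7 : algebraMap k S (eval x P) - s * c = 0 := h6 r _ (by rw [mul_sub, hc]; ring)
  have h8 := congrArg ε h7
  rw [map_sub, map_mul, hε, zero_mul, sub_zero, map_zero, AlgHom.commutes] at h8
  exact hPx h8

end Density

/-! ### Minors invariant under unitriangular factors -/

section Unitriangular

variable {k : Type*} [Field k] {n : ℕ}

/-- The entry of `u` at `(a, b)` is that of the identity matrix unless `d b < d a`. -/
def IsUnitriangular (d : Fin n → ℤ) (u : Matrix (Fin n) (Fin n) k) : Prop :=
  ∀ a b, ¬ d b < d a → u a b = (1 : Matrix (Fin n) (Fin n) k) a b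

theorem isUnitriangular_one (d : Fin n → ℤ) :
    IsUnitriangular d (1 : Matrix (Fin n) (Fin n) k) := fun _ _ _ => rfl

theorem IsUnitriangular.mul {d : Fin n → ℤ} {u v : Matrix (Fin n) (Fin n) k}
    (hu : IsUnitriangular d u) (hv : IsUnitriangular d v) : IsUnitriangular d (u * v) := by
  intro a b hab
  rw [Matrix.mul_apply, Finset.sum_eq_single a]
  · rw [hu a a (lt_irrefl _), Matrix.one_apply_eq, one_mul, hv a b hab]
  · intro x _ hxa
    by_cases hx : d x < d a
    · rw [hv x b (by omega), Matrix.one_apply_ne, mul_zero]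
      rintro rfl
      exact hab hx
    · rw [hu a x hx, Matrix.one_apply_ne hxa.symm, zero_mul]
  · simp

variable {κ : Type*} [Fintype κ] [DecidableEq κ]

/-- Sorted by level, the submatrix is block triangular with identity blocks on the diagonal. -/
theorem IsUnitriangular.det_submatrix {d : Fin n → ℤ} {u : Matrix (Fin n) (Fin n) k}
    (hu : IsUnitriangular d u) {r : κ → Fin n} (hr : Function.Injective r) :
    (u.submatrix r r).det = 1 := by
  have hone : ∀ a b, ¬ d (r b) < d (r a) → u (r a) (r b) = if a = b then 1 else 0 := by
    intro a b h
    rw [hu _ _ h, Matrix.one_apply]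
    simp only [hr.eq_iff]
  have hbt : (u.submatrix r r).BlockTriangular fun o => -d (r o) := by
    intro a b hab
    have hab' : d (r a) < d (r b) := by simpa using hab
    rw [Matrix.submatrix_apply, hone a b (by omega), if_neg]
    rintro rfl
    exact lt_irrefl _ hab'
  rw [hbt.det]
  refine Finset.prod_eq_one fun c _ => ?_
  have : (u.submatrix r r).toSquareBlock (fun o => -d (r o)) c = 1 := by
    ext ⟨a, ha⟩ ⟨b, hb⟩
    have hab : d (r a) = d (r b) := by
      have := ha.trans hb.symm
      simpa using this
    rw [Matrix.toSquareBlock_def, Matrix.of_apply, Matrix.submatrix_apply,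
      hone a b (by omega), Matrix.one_apply]
    simp only [Subtype.mk.injEq]
  rw [this, Matrix.det_one]

/-- Multiplication with unitriangular matrices does not change suitable minors. -/
theorem det_submatrix_mul_mul {d : Fin n → ℤ} {u v g : Matrix (Fin n) (Fin n) k}
    (hu : IsUnitriangular (fun a => -d a) u) (hv : IsUnitriangular d v) {r r' : κ → Fin n}
    (hr : Function.Injective r) (hr' : Function.Injective r')
    (hup : ∀ o x, d (r o) < d x → x ∈ Set.range r)
    (hup' : ∀ o x, d (r' o) < d x → x ∈ Set.range r') :
    ((u * g * v).submatrix r r').det = (g.submatrix r r').det := by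
  -- The chosen rows and columns contain all indices of higher level, and these are the only ones
  -- that `u` and `v` mix in; so taking the submatrix commutes with the products.
  have h1 : (u * g * v).submatrix r r' =
      u.submatrix r r * g.submatrix r r' * v.submatrix r' r' := by
    have h2 : (u * g).submatrix r r' = u.submatrix r r * g.submatrix r r' := by
      ext a b
      rw [Matrix.submatrix_apply, Matrix.mul_apply, Matrix.mul_apply]
      refine (Fintype.sum_of_injective r hr _ _ (fun x hx => ?_) fun _ => rfl).symm
      rw [hu, Matrix.one_apply_ne, zero_mul]
      · rintro rfl
        exact hx ⟨a, rfl⟩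
      · intro hlt
        exact hx (hup a x (by simpa using hlt))
    rw [← h2]
    ext a b
    rw [Matrix.submatrix_apply, Matrix.mul_apply, Matrix.mul_apply]
    refine (Fintype.sum_of_injective r' hr' _ _ (fun x hx => ?_) fun _ => rfl).symm
    rw [hv, Matrix.one_apply_ne, mul_zero]
    · rintro rfl
      exact hx ⟨b, rfl⟩
    · intro hlt
      exact hx (hup' b x hlt)
  rw [h1, Matrix.det_mul, Matrix.det_mul, hu.det_submatrix hr, hv.det_submatrix hr', one_mul,
    mul_one]

/-- The rows above the level of `i`, together with `i`. -/
def levelRow (d : Fin n → ℤ) (c : ℤ) (i : Fin n) : Unit ⊕ {a // c < d a} → Fin n :=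
  Sum.elim (fun _ => i) Subtype.val

theorem levelRow_injective {d : Fin n → ℤ} {c : ℤ} {i : Fin n} (hi : d i = c) :
    Function.Injective (levelRow d c i) := by
  rintro (⟨⟩ | ⟨a, ha⟩) (⟨⟩ | ⟨b, hb⟩) h
  · rfl
  · exact absurd hb (by rw [← show i = b from h]; omega)
  · exact absurd ha (by rw [show a = i from h]; omega)
  · exact congrArg Sum.inr (Subtype.ext h)

theorem mem_range_levelRow {d : Fin n → ℤ} {c : ℤ} {i : Fin n} (hi : d i = c)
    (o : Unit ⊕ {a // c < d a}) (x : Fin n) (h : d (levelRow d c i o) < d x) :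
    x ∈ Set.range (levelRow d c i) := by
  refine ⟨Sum.inr ⟨x, ?_⟩, rfl⟩
  rcases o with _ | ⟨a, ha⟩
  · exact hi ▸ h
  · exact ha.trans h

/-- The minor of the rows above level `c`. -/
def levelMinor {S : Type*} [CommRing S] (d : Fin n → ℤ) (c : ℤ) (g : Matrix (Fin n) (Fin n) S) :
    S :=
  (g.submatrix (Subtype.val : {a // c < d a} → Fin n) Subtype.val).det

/-- The minor of the rows above level `c` and of `i`, and of the columns above level `c` and
of `j`. -/
def borderedMinor {S : Type*} [CommRing S] (d : Fin n → ℤ) (c : ℤ) (i j : Fin n)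
    (g : Matrix (Fin n) (Fin n) S) : S :=
  (g.submatrix (levelRow d c i) (levelRow d c j)).det

theorem map_levelMinor {S T : Type*} [CommRing S] [CommRing T] (φ : S →+* T) (d : Fin n → ℤ)
    (c : ℤ) (g : Matrix (Fin n) (Fin n) S) :
    φ (levelMinor d c g) = levelMinor d c (g.map φ) := by
  rw [levelMinor, RingHom.map_det]
  rfl

theorem map_borderedMinor {S T : Type*} [CommRing S] [CommRing T] (φ : S →+* T) (d : Fin n → ℤ)
    (c : ℤ) (i j : Fin n) (g : Matrix (Fin n) (Fin n) S) :
    φ (borderedMinor d c i j g) = borderedMinor d c i j (g.map φ) := by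
  rw [borderedMinor, RingHom.map_det]
  rfl

theorem levelMinor_mul_mul {d : Fin n → ℤ} {u v : Matrix (Fin n) (Fin n) k}
    (hu : IsUnitriangular (fun a => -d a) u) (hv : IsUnitriangular d v) (c : ℤ)
    (g : Matrix (Fin n) (Fin n) k) : levelMinor d c (u * g * v) = levelMinor d c g := by
  refine det_submatrix_mul_mul hu hv Subtype.val_injective Subtype.val_injective ?_ ?_ <;>
  · intro o x h
    exact ⟨⟨x, o.2.trans h⟩, rfl⟩

theorem borderedMinor_mul_mul {d : Fin n → ℤ} {u v : Matrix (Fin n) (Fin n) k}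
    (hu : IsUnitriangular (fun a => -d a) u) (hv : IsUnitriangular d v) {c : ℤ} {i j : Fin n}
    (hi : d i = c) (hj : d j = c) (g : Matrix (Fin n) (Fin n) k) :
    borderedMinor d c i j (u * g * v) = borderedMinor d c i j g :=
  det_submatrix_mul_mul hu hv (levelRow_injective hi) (levelRow_injective hj)
    (mem_range_levelRow hi) (mem_range_levelRow hj)

/-- A matrix that respects the levels. -/
def IsLevelDiagonal (d : Fin n → ℤ) (g : Matrix (Fin n) (Fin n) k) : Prop :=
  ∀ a b, d a ≠ d b → g a b = 0

theorem isLevelDiagonal_diagonal (d : Fin n → ℤ) (t : Fin n → k) :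
    IsLevelDiagonal d (Matrix.diagonal t) := by
  intro a b hab
  rw [Matrix.diagonal_apply_ne]
  rintro rfl
  exact hab rfl

/-- The row of `i` is zero in all columns of higher level, so the determinant is block triangular.
-/
theorem IsLevelDiagonal.borderedMinor {d : Fin n → ℤ} {g : Matrix (Fin n) (Fin n) k}
    (hg : IsLevelDiagonal d g) {c : ℤ} {i : Fin n} (hi : d i = c) (j : Fin n) :
    borderedMinor d c i j g = g i j * levelMinor d c g := by
  have h : g.submatrix (levelRow d c i) (levelRow d c j) =
      Matrix.fromBlocks (Matrix.of fun _ _ : Unit => g i j) 0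
        (Matrix.of fun (a : {a // c < d a}) (_ : Unit) => g a j)
        (g.submatrix (Subtype.val : {a // c < d a} → Fin n) Subtype.val) := by
    ext (⟨⟩ | ⟨a, ha⟩) (⟨⟩ | ⟨b, hb⟩)
    · rfl
    · exact hg i b (by omega)
    · rfl
    · rfl
  rw [LinAlgGroup.borderedMinor, h, Matrix.det_fromBlocks_zero₁₂, levelMinor]
  simp

theorem IsLevelDiagonal.levelMinor_ne_zero {d : Fin n → ℤ} {g g' : Matrix (Fin n) (Fin n) k}
    (hg : IsLevelDiagonal d g) (h : g * g' = 1) (c : ℤ) : levelMinor d c g ≠ 0 := by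
  let r : {a // c < d a} → Fin n := Subtype.val
  have h1 : g.submatrix r r * g'.submatrix r r = 1 := by
    ext a b
    have h2 : (g * g') a b = (1 : Matrix (Fin n) (Fin n) k) a b := by rw [h]
    rw [Matrix.mul_apply] at h2
    have h3 : ∑ o, g (r a) (r o) * g' (r o) (r b) = ∑ x, g (r a) x * g' x (r b) := by
      refine Fintype.sum_of_injective r Subtype.val_injective _ _ (fun x hx => ?_) fun _ => rfl
      rw [hg, zero_mul]
      intro hax
      exact hx ⟨⟨x, hax ▸ a.2⟩, rfl⟩
    rw [Matrix.mul_apply]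
    refine (h3.trans h2).trans ?_
    simp only [Matrix.one_apply, Subtype.ext_iff]
  have h3 := congrArg Matrix.det h1
  rw [Matrix.det_mul, Matrix.det_one] at h3
  exact left_ne_zero_of_mul_eq_one h3

end Unitriangular

/-! ### Weights of the torus -/

section Torus

variable {k : Type} [Field k] [Infinite k] {n : ℕ}

theorem eq_of_eval_units_eq {f g : Polynomial k}
    (h : ∀ s : kˣ, f.eval (s : k) = g.eval (s : k)) : f = g := by
  have h1 : Polynomial.X * f = Polynomial.X * g := by
    apply Polynomial.funext
    intro r
    by_cases hr : r = 0
    · simp [hr]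
    · simpa [hr] using h (Units.mk0 r hr)
  exact mul_left_cancel₀ Polynomial.X_ne_zero h1

theorem exists_units_pow_ne_one {m : ℕ} (hm : m ≠ 0) : ∃ s : kˣ, s ^ m ≠ 1 := by
  by_contra hall
  push Not at hall
  have h : (Polynomial.X ^ m : Polynomial k) = 1 := eq_of_eval_units_eq fun s => by
    have := congrArg Units.val (hall s)
    simpa using this
  have h2 := congrArg Polynomial.natDegree h
  rw [Polynomial.natDegree_X_pow, Polynomial.natDegree_one] at h2
  exact hm h2

theorem exists_units_zpow_ne_one {m : ℤ} (hm : m ≠ 0) : ∃ s : kˣ, s ^ m ≠ 1 := by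
  obtain ⟨s, hs⟩ := exists_units_pow_ne_one (k := k) (Int.natAbs_ne_zero.2 hm)
  refine ⟨s, ?_⟩
  rcases Int.natAbs_eq m with h | h
  · rwa [h, zpow_natCast]
  · rwa [h, zpow_neg, zpow_natCast, Ne, inv_eq_one]

variable {ι X Y : Type*} [AddCommGroup X] [AddCommGroup Y] {P : RootDatum ι X Y}

omit [Infinite k] in
theorem charValue_cocharValue (y : Y) (s : kˣ) (x : X) :
    charValue (cocharValue P y s) x = ((s ^ P.toLinearMap x y : kˣ) : k) := rfl

omit [Infinite k] in
theorem charValue_add (t : SplitTorus k X) (x y : X) :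
    charValue t (x + y) = charValue t x * charValue t y := by
  unfold charValue
  rw [ofAdd_add, map_mul, Units.val_mul]

omit [Infinite k] in
theorem charValue_zero (t : SplitTorus k X) : charValue t (0 : X) = 1 := by
  unfold charValue
  rw [ofAdd_zero, map_one, Units.val_one]

omit [Infinite k] in
theorem charValue_neg (t : SplitTorus k X) (x : X) : charValue t (-x) = charValue t⁻¹ x := by
  unfold charValue
  rw [ofAdd_neg, map_inv, MonoidHom.inv_apply]

/-- Evaluation at `x`, as a linear character of the torus. -/
def charHom (k : Type) [Field k] {X : Type*} [AddCommGroup X] (x : X) : SplitTorus k X →* k where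
  toFun t := charValue t x
  map_one' := rfl
  map_mul' s t := by
    change ((s (Multiplicative.ofAdd x) * t (Multiplicative.ofAdd x) : kˣ) : k) = _
    rw [Units.val_mul]
    rfl

variable (P) in
theorem exists_toLinearMap_ne_zero {x : X} (hx : x ≠ 0) : ∃ y, P.toLinearMap x y ≠ 0 := by
  by_contra hall
  push Not at hall
  have hinj : Function.Injective P.toLinearMap := (P.isPerfPair_toLinearMap.bijective_left).1
  exact hx (hinj (by rw [map_zero]; exact LinearMap.ext hall))

variable (P) in
include P in
theorem charHom_injective : Function.Injective (charHom k : X → SplitTorus k X →* k) := by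
  intro x x' h
  by_contra hne
  obtain ⟨y, hy⟩ := exists_toLinearMap_ne_zero P (sub_ne_zero.2 hne)
  obtain ⟨s, hs⟩ := exists_units_zpow_ne_one (k := k) hy
  apply hs
  have h1 : charValue (cocharValue P y s) x = charValue (cocharValue P y s) x' :=
    DFunLike.congr_fun h _
  rw [charValue_cocharValue, charValue_cocharValue, Units.val_inj] at h1
  rw [map_sub, LinearMap.sub_apply, zpow_sub, h1, mul_inv_cancel]

variable (P) in
include P in
-- Dedekind's independence of characters. Distinct elements of `X` give distinct characters, as
-- cocharacters separate them over an infinite field.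
theorem linearIndependent_charHom :
    LinearIndependent k (fun (x : X) (t : SplitTorus k X) => charValue t x) :=
  (linearIndependent_monoidHom (SplitTorus k X) k).comp _ (charHom_injective P)

/-- The weights of the torus: in some basis, the torus acts by diagonal matrices. -/
structure IsDiagonalization {G : Subgroup (GL (Fin n) k)} (D : HasRootDatum G P)
    (h : GL (Fin n) k) (χ : Fin n → X) : Prop where
  conj_eq : ∀ t, ((h⁻¹ * D.torus t * h : GL (Fin n) k) : Matrix (Fin n) (Fin n) k) =
    Matrix.diagonal fun i => charValue t (χ i)

variable {G : Subgroup (GL (Fin n) k)} (D : HasRootDatum G P)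

open Matrix in
-- Expand the matrices of the torus as `∑ x, x(t) E x`. Comparing coefficients in `torus (t * t')`
-- shows that the columns of `E x` are weight vectors for `x`, and `∑ x, E x = 1` shows that they
-- span.
theorem exists_isDiagonalization : ∃ h χ, IsDiagonalization D h χ := by
  classical
  choose c hc using D.torus_regular
  let S : Finset X := Finset.univ.biUnion fun ab : Fin n × Fin n => (c ab.1 ab.2).support
  let E : X → Matrix (Fin n) (Fin n) k := fun x => Matrix.of fun a b => c a b x
  have hT : ∀ t, (D.torus t : Matrix (Fin n) (Fin n) k) = ∑ x ∈ S, charValue t x • E x := by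
    intro t
    ext a b
    rw [hc, Finsupp.sum_of_support_subset (s := S) _
      (Finset.subset_biUnion_of_mem (fun ab : Fin n × Fin n => (c ab.1 ab.2).support)
        (Finset.mem_univ (a, b))) _ (by simp), Matrix.sum_apply]
    refine Finset.sum_congr rfl fun x _ => ?_
    simp [E, mul_comm]
  have hE : ∀ t, ∀ x ∈ S, (D.torus t : Matrix (Fin n) (Fin n) k) * E x = charValue t x • E x := by
    intro t x hx
    ext a b
    have hlin := linearIndependent_iff'.1 (linearIndependent_charHom (k := k) P) S
      (fun x => ((D.torus t : Matrix (Fin n) (Fin n) k) * E x - charValue t x • E x) a b) ?_ x hx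
    · simpa [sub_eq_zero] using hlin
    · funext t'
      have h1 : (D.torus (t * t') : Matrix (Fin n) (Fin n) k) =
          (D.torus t : Matrix (Fin n) (Fin n) k) * D.torus t' := by rw [map_mul]; rfl
      rw [hT t', hT (t * t'), Finset.mul_sum] at h1
      have h2 := congrFun (congrFun h1 a) b
      simp only [Matrix.sum_apply, Matrix.mul_smul, Matrix.smul_apply, smul_eq_mul] at h2
      simp only [Finset.sum_apply, Pi.smul_apply, smul_eq_mul, Matrix.sub_apply,
        Matrix.smul_apply, sub_mul, Finset.sum_sub_distrib, Pi.zero_apply]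
      rw [sub_eq_zero]
      calc _ = ∑ x ∈ S, charValue t' x * ((D.torus t : Matrix (Fin n) (Fin n) k) * E x) a b :=
            Finset.sum_congr rfl fun x _ => mul_comm _ _
        _ = _ := h2.symm
        _ = _ := Finset.sum_congr rfl fun x _ => by
            have : charValue (t * t') x = charValue t x * charValue t' x :=
              (charHom k x).map_mul t t'
            rw [this]
            ring
  let V : Set (Fin n → k) :=
    {v | ∃ x, ∀ t, (D.torus t : Matrix (Fin n) (Fin n) k) *ᵥ v = charValue t x • v}
  have hV : ⊤ ≤ Submodule.span k V := by
    intro v _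
    have h1 : v = ∑ x ∈ S, E x *ᵥ v := by
      have h2 : (1 : Matrix (Fin n) (Fin n) k) *ᵥ v = v := Matrix.one_mulVec v
      rw [← Units.val_one, ← map_one D.torus, hT 1, Matrix.sum_mulVec] at h2
      conv_lhs => rw [← h2]
      refine Finset.sum_congr rfl fun x _ => ?_
      rw [show charValue (1 : SplitTorus k X) x = 1 from rfl, one_smul]
    rw [h1]
    refine Submodule.sum_mem _ fun x hx => Submodule.subset_span ⟨x, fun t => ?_⟩
    rw [Matrix.mulVec_mulVec, hE t x hx, Matrix.smul_mulVec]
  let b₀ := Module.Basis.ofSpan hV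
  have hfin : Finite ((linearIndepOn_empty k id).extend (Set.empty_subset V)) :=
    Module.Finite.finite_basis b₀
  let _ := Fintype.ofFinite ((linearIndepOn_empty k id).extend (Set.empty_subset V))
  have hcard : Fintype.card ((linearIndepOn_empty k id).extend (Set.empty_subset V)) = n := by
    rw [← Module.finrank_eq_card_basis b₀, Module.finrank_fin_fun]
  let b : Module.Basis (Fin n) k (Fin n → k) := b₀.reindex (Fintype.equivFinOfCardEq hcard)
  have hb : ∀ i, b i ∈ V := by
    intro i
    rw [Module.Basis.reindex_apply]
    exact Module.Basis.ofSpan_subset hV ⟨_, rfl⟩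
  choose χ hχ using hb
  let h : GL (Fin n) k :=
    { val := (Pi.basisFun k (Fin n)).toMatrix b
      inv := b.toMatrix (Pi.basisFun k (Fin n))
      val_inv := Module.Basis.toMatrix_mul_toMatrix_flip _ _
      inv_val := Module.Basis.toMatrix_mul_toMatrix_flip _ _ }
  refine ⟨h, χ, ⟨fun t => ?_⟩⟩
  have h1 : (D.torus t : Matrix (Fin n) (Fin n) k) * (h : Matrix (Fin n) (Fin n) k) =
      (h : Matrix (Fin n) (Fin n) k) * Matrix.diagonal fun i => charValue t (χ i) := by
    ext a i
    have h2 := congrFun (hχ i t) a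
    rw [Matrix.mul_diagonal, Matrix.mul_apply]
    simp only [h, Module.Basis.toMatrix_apply, Pi.basisFun_repr]
    rw [mul_comm]
    exact h2
  rw [Units.val_mul, Units.val_mul, mul_assoc, h1, ← mul_assoc, ← Units.val_mul,
    inv_mul_cancel, Units.val_one, one_mul]

variable {D} {h : GL (Fin n) k} {χ : Fin n → X} (hχ : IsDiagonalization D h χ)
include hχ

omit [Infinite k] in
theorem IsDiagonalization.torus_eq (t : SplitTorus k X) :
    (D.torus t : Matrix (Fin n) (Fin n) k) =
      h * (Matrix.diagonal fun i => charValue t (χ i)) *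
        ((h⁻¹ : GL (Fin n) k) : Matrix (Fin n) (Fin n) k) := by
  rw [← hχ.conj_eq t, ← Units.val_mul, ← Units.val_mul]
  congr 1
  group

/-- The weights generate the character group. -/
theorem IsDiagonalization.span_weights : Submodule.span ℤ (Set.range χ) = ⊤ := by
  set X' := Submodule.span ℤ (Set.range χ) with hX'
  let v : X → SplitTorus k X → k := fun x t => charValue t x
  -- The span of the characters in `X'` is closed under products and inversion of `t`, and contains
  -- the matrix entries, hence all regular functions on the torus. By independence it contains no
  -- character outside `X'`.
  let W : Submodule k (SplitTorus k X → k) := Submodule.span k (v '' X')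
  have hone : (1 : SplitTorus k X → k) ∈ W :=
    Submodule.subset_span ⟨0, X'.zero_mem, funext fun t => charValue_zero t⟩
  have hmul : ∀ f g, f ∈ W → g ∈ W → f * g ∈ W := by
    intro f g hf hg
    induction hf, hg using Submodule.span_induction₂ with
    | mem_mem f g hf hg =>
      obtain ⟨x, hx, rfl⟩ := hf
      obtain ⟨y, hy, rfl⟩ := hg
      exact Submodule.subset_span ⟨x + y, X'.add_mem hx hy, funext fun t => charValue_add t x y⟩
    | zero_left => rw [zero_mul]; exact W.zero_mem
    | zero_right => rw [mul_zero]; exact W.zero_mem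
    | add_left f g e _ _ _ h1 h2 => rw [add_mul]; exact W.add_mem h1 h2
    | add_right f g e _ _ _ h1 h2 => rw [mul_add]; exact W.add_mem h1 h2
    | smul_left r f g _ _ h1 => rw [smul_mul_assoc]; exact W.smul_mem r h1
    | smul_right r f g _ _ h1 => rw [mul_smul_comm]; exact W.smul_mem r h1
  have hentry : ∀ a b, (fun t => (D.torus t : Matrix (Fin n) (Fin n) k) a b) ∈ W := by
    intro a b
    have h1 : (fun t => (D.torus t : Matrix (Fin n) (Fin n) k) a b) =
        ∑ i, ((h : Matrix (Fin n) (Fin n) k) a i *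
          ((h⁻¹ : GL (Fin n) k) : Matrix (Fin n) (Fin n) k) i b) • v (χ i) := by
      funext t
      rw [hχ.torus_eq t, Matrix.mul_apply, Finset.sum_apply]
      refine Finset.sum_congr rfl fun i _ => ?_
      rw [Matrix.mul_diagonal, Pi.smul_apply, smul_eq_mul]
      ring
    rw [h1]
    exact W.sum_mem fun i _ => W.smul_mem _
      (Submodule.subset_span ⟨χ i, Submodule.subset_span ⟨i, rfl⟩, rfl⟩)
  have hinv : ∀ f ∈ W, (fun t => f t⁻¹) ∈ W := by
    intro f hf
    induction hf using Submodule.span_induction with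
    | mem f hf =>
      obtain ⟨x, hx, rfl⟩ := hf
      exact Submodule.subset_span ⟨-x, X'.neg_mem hx, funext fun t => charValue_neg t x⟩
    | zero => exact W.zero_mem
    | add f g _ _ h1 h2 => exact W.add_mem h1 h2
    | smul c f _ h1 => exact W.smul_mem c h1
  have hreg : ∀ q : MvPolynomial (Coord n) k, (fun t => evalReg q (D.torus t)) ∈ W := by
    intro q
    induction q using MvPolynomial.induction_on with
    | C a =>
      have : (fun t => evalReg (MvPolynomial.C a) (D.torus t)) =
          a • (1 : SplitTorus k X → k) := by
        funext t
        simp [evalReg]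
      rw [this]
      exact W.smul_mem a hone
    | add p q hp hq =>
      have : (fun t => evalReg (p + q) (D.torus t)) =
          (fun t => evalReg p (D.torus t)) + fun t => evalReg q (D.torus t) := by
        funext t
        simp [evalReg]
      rw [this]
      exact W.add_mem hp hq
    | mul_X p c hp =>
      have : (fun t => evalReg (p * MvPolynomial.X c) (D.torus t)) =
          (fun t => evalReg p (D.torus t)) * fun t => coords (D.torus t) c := by
        funext t
        simp [evalReg]
      rw [this]
      refine hmul _ _ hp ?_
      rcases c with ij | ij
      · exact hentry ij.1 ij.2
      · have h2 := hinv _ (hentry ij.1 ij.2)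
        have h3 : (fun t => coords (D.torus t) (Sum.inr ij)) =
            fun t => (D.torus t⁻¹ : Matrix (Fin n) (Fin n) k) ij.1 ij.2 := by
          funext t
          have h4 : (D.torus t)⁻¹ = D.torus t⁻¹ := by
            have h5 : t * t⁻¹ = 1 := MonoidHom.ext fun x => mul_inv_cancel (t x)
            exact inv_eq_of_mul_eq_one_right (by rw [← map_mul, h5, map_one])
          exact congrArg
            (fun g : GL (Fin n) k => (g : Matrix (Fin n) (Fin n) k) ij.1 ij.2) h4
        rw [h3]
        exact h2
  refine eq_top_iff.2 fun x _ => ?_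
  obtain ⟨q, hq⟩ := D.torus_regular_inv x
  by_contra hx
  refine (linearIndependent_charHom (k := k) P).notMem_span_image (s := (X' : Set X)) hx ?_
  have h3 : (fun t => charValue t x) = fun t => evalReg q (D.torus t) := funext hq
  rw [h3]
  exact hreg q

/-- A family that satisfies the relations between the weights extends to the character group. -/
theorem IsDiagonalization.exists_hom {B : Type*} [AddCommGroup B] (y : Fin n → B)
    (hy : ∀ m : Fin n → ℤ, ∑ i, m i • χ i = 0 → ∑ i, m i • y i = 0) :
    ∃ η : X →+ B, ∀ i, η (χ i) = y i := by
  let φ : (Fin n → ℤ) →ₗ[ℤ] X := Fintype.linearCombination ℤ χ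
  let ψ : (Fin n → ℤ) →ₗ[ℤ] B := Fintype.linearCombination ℤ y
  have hφ : Function.Surjective φ := by
    rw [← LinearMap.range_eq_top, Fintype.range_linearCombination, hχ.span_weights]
  have hker : LinearMap.ker φ ≤ LinearMap.ker ψ := by
    intro m hm
    rw [LinearMap.mem_ker] at hm ⊢
    exact hy m hm
  let η : X →ₗ[ℤ] B := (LinearMap.ker φ).liftQ ψ hker ∘ₗ (φ.quotKerEquivOfSurjective hφ).symm
  have hη : ∀ m, η (φ m) = ψ m := by
    intro m
    have h1 : (φ.quotKerEquivOfSurjective hφ).symm (φ m) = Submodule.Quotient.mk m := by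
      rw [LinearEquiv.symm_apply_eq]
      rfl
    simp only [η, LinearMap.comp_apply, LinearEquiv.coe_coe, h1]
    rfl
  refine ⟨η.toAddMonoidHom, fun i => ?_⟩
  have h2 := hη (Pi.single i 1)
  simp only [φ, ψ, Fintype.linearCombination_apply_single, one_smul] at h2
  exact h2

end Torus

/-! ### Regular cocharacters and the big cell -/

section BigCell

variable {k : Type} [Field k] [Infinite k] {n : ℕ} {ι X Y : Type*} [AddCommGroup X]
  [AddCommGroup Y] {P : RootDatum ι X Y} {G : Subgroup (GL (Fin n) k)}

theorem root_ne_zero' (P : RootDatum ι X Y) (α : ι) : P.root α ≠ 0 := by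
  intro h
  have h1 := P.root_coroot_two α
  rw [h, map_zero, LinearMap.zero_apply] at h1
  exact absurd h1 (by norm_num)

/-- There is a cocharacter that is orthogonal to no root. -/
theorem exists_regular [Finite ι] (P : RootDatum ι X Y) :
    ∃ y : Y, ∀ α, P.toLinearMap (P.root α) y ≠ 0 := by
  classical
  let _ := Fintype.ofFinite ι
  suffices h : ∀ s : Finset ι, ∃ y : Y, ∀ α ∈ s, P.toLinearMap (P.root α) y ≠ 0 by
    obtain ⟨y, hy⟩ := h Finset.univ
    exact ⟨y, fun α => hy α (Finset.mem_univ α)⟩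
  intro s
  induction s using Finset.induction_on with
  | empty => exact ⟨0, by simp⟩
  | insert β s _ ih =>
    obtain ⟨y, hy⟩ := ih
    by_cases hβ : P.toLinearMap (P.root β) y = 0
    · obtain ⟨w, hw⟩ := exists_toLinearMap_ne_zero P (root_ne_zero' P β)
      -- Larger than all pairings of `w` with roots in `s`, so that the multiple of `y` dominates
      -- there, while `β` sees only `w`.
      set N : ℤ := 1 + ∑ α ∈ s, |P.toLinearMap (P.root α) w|
      refine ⟨w + N • y, fun α hα => ?_⟩
      rw [map_add, map_zsmul, smul_eq_mul]
      rcases Finset.mem_insert.1 hα with rfl | hα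
      · rwa [hβ, mul_zero, add_zero]
      · intro h0
        have h1 : |P.toLinearMap (P.root α) w| ≤ ∑ α ∈ s, |P.toLinearMap (P.root α) w| :=
          Finset.single_le_sum (f := fun α => |P.toLinearMap (P.root α) w|)
            (fun _ _ => abs_nonneg _) hα
        have h2 : |P.toLinearMap (P.root α) w| = N * |P.toLinearMap (P.root α) y| := by
          rw [eq_neg_of_add_eq_zero_left h0, abs_neg, abs_mul,
            abs_of_nonneg (by have := abs_nonneg (P.toLinearMap (P.root α) w); omega)]
        have h3 : 1 ≤ |P.toLinearMap (P.root α) y| := Int.one_le_abs (hy α hα)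
        have h4 := abs_nonneg (P.toLinearMap (P.root α) w)
        nlinarith
    · exact ⟨y, fun α hα => (Finset.mem_insert.1 hα).elim (fun h => h ▸ hβ) (hy α)⟩

variable (D : HasRootDatum G P)

/-- The products of elements of the root subgroups for the roots that are positive on `y`. -/
def posUnip (y : Y) : Submonoid (GL (Fin n) k) :=
  Submonoid.closure {g | ∃ α c, 0 < P.toLinearMap (P.root α) y ∧ D.sl α (slUpper c) = g}

omit [Infinite k] in
theorem sl_mem_posUnip {y : Y} {α : ι} (h : 0 < P.toLinearMap (P.root α) y) (c : k) :
    D.sl α (slUpper c) ∈ posUnip D y :=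
  Submonoid.subset_closure ⟨α, c, h, rfl⟩

omit [Infinite k] in
theorem posUnip_le (y : Y) : posUnip D y ≤ G.toSubmonoid :=
  Submonoid.closure_le.2 fun _ ⟨α, _, _, h⟩ => h ▸ D.sl_mem α _

/-- The products of an element for the negative roots, a torus element and an element for the
positive roots. -/
def bigCell (y : Y) : Set (GL (Fin n) k) :=
  {g | ∃ u ∈ posUnip D (-y), ∃ t, ∃ v ∈ posUnip D y, u * D.torus t * v = g}

omit [Infinite k] in
theorem bigCell_subset (y : Y) : bigCell D y ⊆ G := by
  rintro _ ⟨u, hu, t, v, hv, rfl⟩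
  exact G.mul_mem (G.mul_mem (posUnip_le D _ hu) (D.torus_mem t)) (posUnip_le D _ hv)

omit [Infinite k] in
theorem slUpper_zero : slUpper (0 : k) = 1 := by
  ext i j
  fin_cases i <;> fin_cases j <;> rfl

variable {D} {h : GL (Fin n) k} {χ : Fin n → X} (hχ : IsDiagonalization D h χ)
include hχ

/-- Conjugation by the torus element `y(s)` multiplies the root parameter by `s ^ N` with `N > 0`.
For entries that do not raise the level this gives `p(c) = s ^ m p(s ^ N c)` with `m ≥ 0`. As a
polynomial identity it holds at `s = 0` too, where it gives the entry of the identity matrix. -/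
theorem IsDiagonalization.isUnitriangular {y : Y} {g : GL (Fin n) k} (hg : g ∈ posUnip D y) :
    IsUnitriangular (fun i => P.toLinearMap (χ i) y)
      ((h⁻¹ * g * h : GL (Fin n) k) : Matrix (Fin n) (Fin n) k) := by
  induction hg using Submonoid.closure_induction with
  | one =>
    rw [mul_one, inv_mul_cancel]
    exact isUnitriangular_one _
  | mul x y' _ _ hx hy =>
    have h1 : h⁻¹ * (x * y') * h = (h⁻¹ * x * h) * (h⁻¹ * y' * h) := by group
    rw [h1, Units.val_mul]
    exact hx.mul hy
  | mem g hg =>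
    obtain ⟨α, c, hpos, rfl⟩ := hg
    intro a b hab
    obtain ⟨N, hN⟩ := Int.eq_ofNat_of_zero_le hpos.le
    have hN0 : N ≠ 0 := by rintro rfl; rw [hN] at hpos; simp at hpos
    obtain ⟨m, hm⟩ := Int.eq_ofNat_of_zero_le (sub_nonneg.2 (not_lt.1 hab))
    replace hm : P.toLinearMap (χ b) y = P.toLinearMap (χ a) y + m := by
      rw [← hm, add_sub_cancel]
    let p : Polynomial k := ∑ x, ∑ x', Polynomial.C
      (((h⁻¹ : GL (Fin n) k) : Matrix (Fin n) (Fin n) k) a x *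
        (h : Matrix (Fin n) (Fin n) k) x' b) * D.rootPoly α x x'
    have hp : ∀ c, ((h⁻¹ * D.sl α (slUpper c) * h : GL (Fin n) k) : Matrix (Fin n) (Fin n) k) a b =
        p.eval c := by
      intro c
      rw [Units.val_mul, Units.val_mul, D.rootPoly_eval, Matrix.mul_apply]
      simp only [Matrix.mul_apply, Finset.sum_mul, p, Polynomial.eval_finsetSum,
        Polynomial.eval_mul, Polynomial.eval_C, Matrix.map_apply]
      rw [Finset.sum_comm]
      exact Finset.sum_congr rfl fun x _ => Finset.sum_congr rfl fun x' _ => by ring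
    have hs : ∀ s : kˣ, p.eval c = (s : k) ^ m * p.eval ((s : k) ^ N * c) := by
      intro s
      have h1 := D.torus_upper α (cocharValue P y s) c
      have hN' : charValue (cocharValue P y s) (P.root α) = (s : k) ^ N := by
        rw [charValue_cocharValue, hN]
        simp
      rw [hN', mul_inv_eq_iff_eq_mul] at h1
      have h2 : (h⁻¹ * D.torus (cocharValue P y s) * h) * (h⁻¹ * D.sl α (slUpper c) * h) =
          (h⁻¹ * D.sl α (slUpper ((s : k) ^ N * c)) * h) *
            (h⁻¹ * D.torus (cocharValue P y s) * h) := by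
        calc _ = h⁻¹ * (D.torus (cocharValue P y s) * D.sl α (slUpper c)) * h := by group
          _ = _ := by rw [h1]; group
      have h3 := congrArg (fun g : GL (Fin n) k => (g : Matrix (Fin n) (Fin n) k) a b) h2
      simp only [Units.val_mul _ (h⁻¹ * D.torus (cocharValue P y s) * h),
        Units.val_mul (h⁻¹ * D.torus (cocharValue P y s) * h)] at h3
      rw [hχ.conj_eq, Matrix.diagonal_mul, Matrix.mul_diagonal, hp, hp, charValue_cocharValue,
        charValue_cocharValue, hm, zpow_add, Units.val_mul] at h3
      apply mul_left_cancel₀ (Units.ne_zero (s ^ P.toLinearMap (χ a) y))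
      rw [h3]
      simp only [zpow_natCast, Units.val_pow_eq_pow_val]
      ring
    have hpoly : Polynomial.C (p.eval c) =
        Polynomial.X ^ m * p.comp (Polynomial.C c * Polynomial.X ^ N) :=
      eq_of_eval_units_eq fun s => by
        simp only [Polynomial.eval_C, Polynomial.eval_mul, Polynomial.eval_pow, Polynomial.eval_X,
          Polynomial.eval_comp]
        rw [mul_comm c]
        exact hs s
    have h0 := congrArg (Polynomial.eval 0) hpoly
    simp only [Polynomial.eval_C, Polynomial.eval_mul, Polynomial.eval_pow, Polynomial.eval_X,
      Polynomial.eval_comp, zero_pow hN0, mul_zero] at h0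
    rw [hp, h0, ← hp, slUpper_zero, map_one, mul_one, inv_mul_cancel, Units.val_one]
    rcases Nat.eq_zero_or_pos m with rfl | hm0
    · rw [pow_zero, one_mul]
    · rw [zero_pow hm0.ne', zero_mul, Matrix.one_apply_ne]
      rintro rfl
      omega

end BigCell

open MvPolynomial

/-! ### First-order deformations of the identity -/

section FirstOrder

variable {k : Type*} [Field k] {R : Type*} [CommRing R] [Algebra k R] {n : ℕ}

/-- For an element `e` of square zero, the units `1 + y e`. -/
def tangentUnit (k : Type*) [Field k] [Algebra k R] {e : R} (he : e * e = 0) :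
    Multiplicative k →* Rˣ :=
  MonoidHom.toHomUnits
    { toFun := fun y => 1 + e * algebraMap k R (Multiplicative.toAdd y)
      map_one' := by rw [toAdd_one, map_zero, mul_zero, add_zero]
      map_mul' := fun y z => by
        rw [toAdd_mul, map_add]
        linear_combination (-algebraMap k R (Multiplicative.toAdd y) *
          algebraMap k R (Multiplicative.toAdd z)) * he }

theorem val_tangentUnit {e : R} (he : e * e = 0) (y : k) :
    (tangentUnit k he (Multiplicative.ofAdd y) : R) = 1 + e * algebraMap k R y := rfl

/-- Taylor's formula, which stops at first order because `e` has square zero. -/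
theorem aeval_one_add {e : R} (he : e * e = 0) (x : Matrix (Fin n) (Fin n) k)
    (f : MvPolynomial (Fin n × Fin n) k) :
    aeval (entries (1 + e • x.map (algebraMap k R))) f =
      algebraMap k R (eval (entries 1) f) +
        e * algebraMap k R (∑ ij, eval (entries 1) (pderiv ij f) * x ij.1 ij.2) := by
  induction f using MvPolynomial.induction_on with
  | C a => simp
  | add p q hp hq =>
    rw [map_add, hp, hq, map_add, map_add]
    simp only [map_add, add_mul, Finset.sum_add_distrib]
    ring
  | mul_X p ij hp =>
    have h1 : ∑ ab, eval (entries 1) (pderiv ab (p * X ij)) * x ab.1 ab.2 =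
        entries 1 ij * (∑ ab, eval (entries 1) (pderiv ab p) * x ab.1 ab.2) +
          eval (entries 1) p * x ij.1 ij.2 := by
      simp only [Derivation.leibniz, smul_eq_mul, map_add, map_mul, eval_X, add_mul,
        Finset.sum_add_distrib, pderiv_X, Finset.mul_sum]
      rw [add_comm]
      congr 1
      · exact Finset.sum_congr rfl fun _ _ => by ring
      · rw [Finset.sum_eq_single ij]
        · simp
        · intro ab _ hab
          rw [Pi.single_eq_of_ne hab.symm]
          simp
        · simp
    have h2 : entries (1 + e • x.map (algebraMap k R)) ij =
        algebraMap k R (entries 1 ij) + e * algebraMap k R (x ij.1 ij.2) := by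
      simp only [entries, Matrix.add_apply, Matrix.smul_apply, Matrix.map_apply, smul_eq_mul,
        Matrix.one_apply]
      split_ifs <;> simp
    rw [map_mul, hp, aeval_X, h1, h2, map_mul, eval_X, map_mul, map_add, map_mul, map_mul]
    linear_combination (algebraMap k R (∑ ij, eval (entries 1) (pderiv ij p) * x ij.1 ij.2) *
      algebraMap k R (x ij.1 ij.2)) * he

/-- Polynomials in the entries of `h⁻¹ X h`, as polynomials in the entries of `X`. -/
noncomputable def conjPoly (h : GL (Fin n) k) :
    MvPolynomial (Fin n × Fin n) k →ₐ[k] MvPolynomial (Fin n × Fin n) k :=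
  aeval (entries (((h⁻¹ : GL (Fin n) k) : Matrix (Fin n) (Fin n) k).map C *
    Matrix.of (fun i j => X (i, j)) * (h : Matrix (Fin n) (Fin n) k).map C))

theorem aeval_conjPoly (h : GL (Fin n) k) (M : Matrix (Fin n) (Fin n) R)
    (F : MvPolynomial (Fin n × Fin n) k) :
    aeval (entries M) (conjPoly h F) =
      aeval (entries (((h⁻¹ : GL (Fin n) k) : Matrix (Fin n) (Fin n) k).map (algebraMap k R) * M *
        (h : Matrix (Fin n) (Fin n) k).map (algebraMap k R))) F := by
  rw [← AlgHom.comp_apply]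
  congr 1
  ext ij
  simp only [conjPoly, AlgHom.comp_apply, aeval_X, entries, Matrix.mul_apply, map_sum, map_mul,
    Matrix.map_apply, Matrix.of_apply]
  simp [← MvPolynomial.algebraMap_eq]

theorem eval_conjPoly (h : GL (Fin n) k) (g : GL (Fin n) k)
    (F : MvPolynomial (Fin n × Fin n) k) :
    eval (entries (g : Matrix (Fin n) (Fin n) k)) (conjPoly h F) =
      eval (entries ((h⁻¹ * g * h : GL (Fin n) k) : Matrix (Fin n) (Fin n) k)) F :=
  aeval_conjPoly h (g : Matrix (Fin n) (Fin n) k) F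

theorem aeval_eq_zero_of_mem_lieAlgebra {G : Subgroup (GL (Fin n) k)}
    {x : Matrix (Fin n) (Fin n) k} (hx : x ∈ lieAlgebra G) {e : R} (he : e * e = 0)
    {f : MvPolynomial (Fin n × Fin n) k}
    (hf : ∀ g ∈ G, eval (entries (g : Matrix (Fin n) (Fin n) k)) f = 0) :
    aeval (entries (1 + e • x.map (algebraMap k R))) f = 0 := by
  have h1 : ∑ ij, eval (entries 1) (pderiv ij f) * x ij.1 ij.2 = 0 := hx f hf
  have h2 : eval (entries 1) f = 0 := hf 1 G.one_mem
  rw [aeval_one_add he, h1, h2]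
  simp

end FirstOrder

/-! ### The Lie algebra of the torus -/

section TorusTangent

/-- Splitting the exponents into positive and negative parts turns a relation between weights into a
polynomial equation, which can be tested on matrices that are not yet known to lie in the torus. -/
theorem prod_charValue_pow_eq {k : Type*} [Field k] {X : Type*} [AddCommGroup X] {n : ℕ}
    {χ : Fin n → X} {m : Fin n → ℤ} (hm : ∑ i, m i • χ i = 0)
    (t : SplitTorus k X) :
    ∏ i, charValue t (χ i) ^ (m i).toNat = ∏ i, charValue t (χ i) ^ (-m i).toNat := by
  have h1 : ∀ e : Fin n → ℕ, ∏ i, charValue t (χ i) ^ e i = charValue t (∑ i, e i • χ i) := by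
    intro e
    change _ = ((t (Multiplicative.ofAdd _) : kˣ) : k)
    rw [ofAdd_sum, map_prod, Units.coe_prod]
    refine Finset.prod_congr rfl fun i _ => ?_
    rw [ofAdd_nsmul, map_pow, Units.val_pow_eq_pow_val]
    rfl
  rw [h1, h1]
  congr 1
  rw [← sub_eq_zero, ← Finset.sum_sub_distrib, ← hm]
  refine Finset.sum_congr rfl fun i _ => ?_
  rw [← natCast_zsmul, ← natCast_zsmul, ← sub_smul, Int.toNat_sub_toNat_neg]

variable {k : Type} [Field k] [Infinite k] {n : ℕ} {ι X Y : Type*} [AddCommGroup X]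
  [AddCommGroup Y] {P : RootDatum ι X Y} {G : Subgroup (GL (Fin n) k)} {D : HasRootDatum G P}
  {h : GL (Fin n) k} {χ : Fin n → X} (hχ : IsDiagonalization D h χ)
include hχ

/-- The Lie algebra of the torus. -/
theorem IsDiagonalization.exists_of_mem_lieAlgebra {x : Matrix (Fin n) (Fin n) k}
    (hx : x ∈ lieAlgebra D.torus.range) :
    ∃ η : X →+ k, x = (h : Matrix (Fin n) (Fin n) k) * (Matrix.diagonal fun i => η (χ i)) *
      ((h⁻¹ : GL (Fin n) k) : Matrix (Fin n) (Fin n) k) := by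
  set y : Matrix (Fin n) (Fin n) k :=
    ((h⁻¹ : GL (Fin n) k) : Matrix (Fin n) (Fin n) k) * x * (h : Matrix (Fin n) (Fin n) k)
  have hxy : x = (h : Matrix (Fin n) (Fin n) k) * y *
      ((h⁻¹ : GL (Fin n) k) : Matrix (Fin n) (Fin n) k) := by
    have h1 : (h : Matrix (Fin n) (Fin n) k) *
      ((h⁻¹ : GL (Fin n) k) : Matrix (Fin n) (Fin n) k) = 1 := by
      rw [← Units.val_mul, mul_inv_cancel, Units.val_one]
    simp only [y]
    calc x = ((h : Matrix (Fin n) (Fin n) k) *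
            ((h⁻¹ : GL (Fin n) k) : Matrix (Fin n) (Fin n) k)) * x *
            ((h : Matrix (Fin n) (Fin n) k) *
            ((h⁻¹ : GL (Fin n) k) : Matrix (Fin n) (Fin n) k)) := by rw [h1, one_mul, mul_one]
      _ = _ := by simp only [mul_assoc]
  let e : DualNumber k := DualNumber.eps
  have he : e * e = 0 := DualNumber.eps_mul_eps
  have hinj : ∀ a : k, e * algebraMap k (DualNumber k) a = 0 → a = 0 := by
    intro a ha
    have h1 := congrArg TrivSqZeroExt.snd ha
    rw [TrivSqZeroExt.algebraMap_eq_inl] at h1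
    simpa only [e, DualNumber.eps, TrivSqZeroExt.snd_mul, TrivSqZeroExt.fst_inr,
      TrivSqZeroExt.snd_inr, TrivSqZeroExt.fst_inl, TrivSqZeroExt.snd_inl, smul_zero, zero_add,
      MulOpposite.smul_eq_mul_unop, MulOpposite.unop_op, one_mul, TrivSqZeroExt.snd_zero] using h1
  have hconj : ((h⁻¹ : GL (Fin n) k) : Matrix (Fin n) (Fin n) k).map
        (algebraMap k (DualNumber k)) * (1 + e • x.map (algebraMap k (DualNumber k))) *
      (h : Matrix (Fin n) (Fin n) k).map (algebraMap k (DualNumber k)) =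
      1 + e • y.map (algebraMap k (DualNumber k)) := by
    rw [mul_add, add_mul, mul_one, Matrix.mul_smul, Matrix.smul_mul]
    simp only [← Matrix.map_mul]
    rw [← Units.val_mul, inv_mul_cancel, Units.val_one, Matrix.map_one _ (map_zero _) (map_one _)]
  -- Equations of the diagonalized torus hold at `1 + e y` over the dual numbers. The coordinates
  -- off the diagonal show that `y` is diagonal, and the binomials of `prod_charValue_pow_eq` give
  -- the additive relations between its entries.
  have key : ∀ F : MvPolynomial (Fin n × Fin n) k,
      (∀ t : SplitTorus k X, eval (entries (Matrix.diagonal fun i => charValue t (χ i))) F = 0) →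
      aeval (entries (1 + e • y.map (algebraMap k (DualNumber k)))) F = 0 := by
    intro F hF
    rw [← hconj, ← aeval_conjPoly]
    refine aeval_eq_zero_of_mem_lieAlgebra hx he ?_
    rintro _ ⟨t, rfl⟩
    rw [eval_conjPoly, hχ.conj_eq]
    exact hF t
  have hoff : ∀ i j, i ≠ j → y i j = 0 := by
    intro i j hij
    have h1 := key (MvPolynomial.X (i, j)) fun t => by
      rw [eval_X]
      exact Matrix.diagonal_apply_ne _ hij
    rw [aeval_X] at h1
    apply hinj
    simpa [entries, Matrix.one_apply_ne hij] using h1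
  have hrel : ∀ m : Fin n → ℤ, ∑ i, m i • χ i = 0 → ∑ i, m i • y i i = 0 := by
    intro m hm
    have h1 := key (∏ i, MvPolynomial.X (i, i) ^ (m i).toNat -
        ∏ i, MvPolynomial.X (i, i) ^ (-m i).toNat) fun t => by
      simp only [map_sub, map_prod, map_pow, eval_X, entries, Matrix.diagonal_apply_eq]
      rw [prod_charValue_pow_eq hm, sub_self]
    have h2 : ∀ i, entries (1 + e • y.map (algebraMap k (DualNumber k))) (i, i) =
        (tangentUnit k he (Multiplicative.ofAdd (y i i)) : DualNumber k) := by
      intro i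
      simp [entries, val_tangentUnit]
    have h3 : ∀ c : Fin n → ℕ, ∏ i, (tangentUnit k he (Multiplicative.ofAdd (y i i)) :
        DualNumber k) ^ c i = 1 + e * algebraMap k (DualNumber k) (∑ i, c i • y i i) := by
      intro c
      rw [← val_tangentUnit he, ofAdd_sum, map_prod, Units.coe_prod]
      refine Finset.prod_congr rfl fun i _ => ?_
      rw [ofAdd_nsmul, map_pow, Units.val_pow_eq_pow_val]
    simp only [map_sub, map_prod, map_pow, aeval_X, h2] at h1
    rw [h3, h3, add_sub_add_left_eq_sub, ← mul_sub, ← map_sub, ← Finset.sum_sub_distrib] at h1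
    rw [← hinj _ h1]
    refine Finset.sum_congr rfl fun i _ => ?_
    rw [← natCast_zsmul, ← natCast_zsmul, ← sub_smul, Int.toNat_sub_toNat_neg]
  obtain ⟨η, hη⟩ := hχ.exists_hom (fun i => y i i) hrel
  refine ⟨η, ?_⟩
  rw [hxy]
  congr 2
  ext i j
  rcases eq_or_ne i j with rfl | hij
  · rw [Matrix.diagonal_apply_eq, hη]
  · rw [Matrix.diagonal_apply_ne _ hij, hoff i j hij]

end TorusTangent

/-! ### Functions on the affine line without finitely many points -/

section Line

variable {k : Type} [Field k] (q : Polynomial k)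

/-- The coordinate on the affine line, as a function on the complement of the zeros of `q`. -/
noncomputable def lineCoord : Localization.Away q :=
  algebraMap (Polynomial k) (Localization.Away q) Polynomial.X

variable {q} in
/-- Evaluation of functions on the complement of the zeros of `q`. -/
noncomputable def lineEval {r : k} (hr : q.eval r ≠ 0) : Localization.Away q →ₐ[k] k :=
  IsLocalization.liftAlgHom (M := Submonoid.powers q) (f := Polynomial.aeval r) (by
    rintro ⟨_, m, rfl⟩
    refine IsUnit.mk0 _ ?_
    rw [Polynomial.coe_aeval_eq_eval, Polynomial.eval_pow]
    exact pow_ne_zero _ hr)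

variable {q}

theorem lineEval_algebraMap {r : k} (hr : q.eval r ≠ 0) (p : Polynomial k) :
    lineEval hr (algebraMap _ _ p) = p.eval r := by
  unfold lineEval
  rw [IsLocalization.liftAlgHom_apply, IsLocalization.lift_eq]
  exact Polynomial.coe_aeval_eq_eval r ▸ rfl

theorem lineEval_lineCoord {r : k} (hr : q.eval r ≠ 0) : lineEval hr (lineCoord q) = r := by
  rw [lineCoord, lineEval_algebraMap, Polynomial.eval_X]

theorem algebraMap_line_injective (hq : q ≠ 0) :
    Function.Injective (algebraMap (Polynomial k) (Localization.Away q)) :=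
  IsLocalization.injective _ (Submonoid.powers_le.2 (mem_nonZeroDivisors_of_ne_zero hq))

theorem lineCoord_mul_eq_zero (hq : q ≠ 0) (c : Localization.Away q) (hc : lineCoord q * c = 0) :
    c = 0 := by
  have hdom : IsDomain (Localization.Away q) :=
    IsLocalization.isDomain_localization
      (Submonoid.powers_le.2 (mem_nonZeroDivisors_of_ne_zero hq))
  refine (mul_eq_zero.1 hc).resolve_left fun h0 => Polynomial.X_ne_zero (R := k) ?_
  exact algebraMap_line_injective hq (h0.trans (map_zero _).symm)

theorem eq_zero_of_lineEval [Infinite k] (hq : q ≠ 0) (c : Localization.Away q)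
    (hc : ∀ r (hr : q.eval r ≠ 0), lineEval hr c = 0) : c = 0 := by
  obtain ⟨m, a, ha⟩ := IsLocalization.Away.surj q c
  have h1 : a * q = 0 := by
    apply Polynomial.funext
    intro r
    rw [Polynomial.eval_mul, Polynomial.eval_zero]
    by_cases hr : q.eval r = 0
    · rw [hr, mul_zero]
    · have h2 := congrArg (lineEval hr) ha
      rw [map_mul, hc r hr, zero_mul, lineEval_algebraMap] at h2
      rw [← h2, zero_mul]
  have h3 : a = 0 := (mul_eq_zero.1 h1).resolve_right hq
  rw [h3, map_zero, ← map_pow] at ha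
  exact ((IsLocalization.Away.algebraMap_isUnit (S := Localization.Away q) q).pow m
    |>.mul_left_eq_zero).1 (by rw [← map_pow]; exact ha)

end Line

/-! ### Matrices over a ring of functions and their tangent vectors -/

section Tangent

variable {k : Type*} [Field k] {S : Type*} [CommRing S] [Algebra k S] {n : ℕ} {s : S}

/-- Modulo the square of the parameter `s`, the matrix `γ` is `1 + s x`. -/
def IsTangent (s : S) (γ : Matrix (Fin n) (Fin n) S) (x : Matrix (Fin n) (Fin n) k) : Prop :=
  γ.map (Ideal.Quotient.mk (Ideal.span {s} ^ 2)) = 1 + Ideal.Quotient.mk (Ideal.span {s} ^ 2) s •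
    x.map (algebraMap k (S ⧸ (Ideal.span {s} ^ 2)))

variable (s) in
theorem mk_mul_mk_self : Ideal.Quotient.mk (Ideal.span {s} ^ 2) s *
    Ideal.Quotient.mk (Ideal.span {s} ^ 2) s = 0 := by
  rw [← map_mul, Ideal.Quotient.eq_zero_iff_mem, ← sq]
  exact Ideal.pow_mem_pow (Ideal.mem_span_singleton_self s) 2

theorem IsTangent.entries_sub_mem {γ : Matrix (Fin n) (Fin n) S} {x : Matrix (Fin n) (Fin n) k}
    (h : IsTangent s γ x) (ij : Fin n × Fin n) :
    entries (γ - 1) ij - s * algebraMap k S (x ij.1 ij.2) ∈ Ideal.span {s} ^ 2 := by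
  rw [← Ideal.Quotient.eq_zero_iff_mem]
  have h1 := congrFun (congrFun h ij.1) ij.2
  rw [Matrix.map_apply, Matrix.add_apply, Matrix.smul_apply, Matrix.map_apply, smul_eq_mul] at h1
  rw [entries, Matrix.sub_apply, map_sub, map_sub, h1, map_mul]
  have h2 : Ideal.Quotient.mk (Ideal.span {s} ^ 2) ((1 : Matrix (Fin n) (Fin n) S) ij.1 ij.2) =
      (1 : Matrix (Fin n) (Fin n) (S ⧸ (Ideal.span {s} ^ 2))) ij.1 ij.2 := by
    rw [Matrix.one_apply, Matrix.one_apply]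
    split_ifs
    · exact map_one _
    · exact map_zero _
  rw [h2, Ideal.Quotient.mk_algebraMap, add_sub_cancel_left, sub_self]

theorem isTangent_one : IsTangent s (1 : Matrix (Fin n) (Fin n) S)
    (0 : Matrix (Fin n) (Fin n) k) := by
  unfold IsTangent
  rw [Matrix.map_one _ (map_zero _) (map_one _), Matrix.map_zero _ (map_zero _), smul_zero,
    add_zero]

theorem IsTangent.mul {γ γ' : Matrix (Fin n) (Fin n) S} {x x' : Matrix (Fin n) (Fin n) k}
    (h : IsTangent s γ x) (h' : IsTangent s γ' x') : IsTangent s (γ * γ') (x + x') := by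
  unfold IsTangent at *
  rw [Matrix.map_mul, h, h', Matrix.map_add _ (map_add _), add_mul, mul_add, mul_add, one_mul,
    mul_one, one_mul, smul_mul_smul_comm, mk_mul_mk_self, zero_smul, add_zero, smul_add]
  abel

theorem IsTangent.list_prod {ι : Type*} {γ : ι → Matrix (Fin n) (Fin n) S}
    {x : ι → Matrix (Fin n) (Fin n) k} (h : ∀ α, IsTangent s (γ α) (x α)) (L : List ι) :
    IsTangent s (L.map γ).prod (L.map x).sum := by
  induction L with
  | nil => exact isTangent_one
  | cons α L ih =>
    rw [List.map_cons, List.map_cons, List.prod_cons, List.sum_cons]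
    exact (h α).mul ih

theorem IsTangent.conj {γ : Matrix (Fin n) (Fin n) S} {x : Matrix (Fin n) (Fin n) k}
    (h : IsTangent s γ x) (g : GL (Fin n) k) :
    IsTangent s ((g : Matrix (Fin n) (Fin n) k).map (algebraMap k S) * γ *
      ((g⁻¹ : GL (Fin n) k) : Matrix (Fin n) (Fin n) k).map (algebraMap k S))
      ((g : Matrix (Fin n) (Fin n) k) * x * ((g⁻¹ : GL (Fin n) k) : Matrix (Fin n) (Fin n) k)) := by
  unfold IsTangent at *
  have h1 : ∀ a : Matrix (Fin n) (Fin n) k,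
      (a.map (algebraMap k S)).map (Ideal.Quotient.mk (Ideal.span {s} ^ 2)) =
        a.map (algebraMap k (S ⧸ (Ideal.span {s} ^ 2))) := fun a => rfl
  rw [Matrix.map_mul, Matrix.map_mul, h, h1, h1, mul_add, add_mul, mul_one, Matrix.mul_smul,
    Matrix.smul_mul]
  simp only [← Matrix.map_mul]
  rw [← Units.val_mul, mul_inv_cancel, Units.val_one, Matrix.map_one _ (map_zero _) (map_one _)]

/-- Writing a polynomial as its first two coefficients plus a multiple of `X ^ 2`, only the linear
term survives modulo the square of `s`. -/
theorem isTangent_map_aeval {M : Matrix (Fin n) (Fin n) (Polynomial k)}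
    (hM : M.map (fun f => f.coeff 0) = 1) (c : k) :
    IsTangent s (M.map (Polynomial.aeval (algebraMap k S c * s)))
      (c • M.map (fun f => f.coeff 1)) := by
  unfold IsTangent
  ext i j
  have h1 := congrFun (congrFun hM i) j
  have h2 : (1 : Matrix (Fin n) (Fin n) (S ⧸ (Ideal.span {s} ^ 2))) i j =
      algebraMap k _ ((1 : Matrix (Fin n) (Fin n) k) i j) := by
    rw [Matrix.one_apply, Matrix.one_apply]
    split_ifs <;> simp
  rw [Matrix.map_apply, Matrix.map_apply, Matrix.add_apply, Matrix.smul_apply, Matrix.map_apply,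
    Matrix.smul_apply, Matrix.map_apply, h2, ← h1, Matrix.map_apply]
  conv_lhs => rw [← Polynomial.divX_mul_X_add (M i j), ← Polynomial.divX_mul_X_add (M i j).divX]
  simp only [map_add, map_mul, Polynomial.aeval_X, Polynomial.aeval_C, Polynomial.coeff_divX,
    Ideal.Quotient.mk_algebraMap, smul_eq_mul, zero_add]
  linear_combination (Ideal.Quotient.mk (Ideal.span {s} ^ 2)
    (Polynomial.aeval (algebraMap k S c * s) (M i j).divX.divX) *
      algebraMap k _ c * algebraMap k _ c) * mk_mul_mk_self s

end Tangent

/-! ### Curves in the big cell with prescribed tangent vector -/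

section Curves

variable {k : Type} [Field k] [Infinite k] {n : ℕ} {ι X Y : Type*} [AddCommGroup X]
  [AddCommGroup Y] {P : RootDatum ι X Y} {G : Subgroup (GL (Fin n) k)}

theorem free_of_rootDatum (P : RootDatum ι X Y) [Module.Finite ℤ X] : Module.Free ℤ X := by
  have : Module.IsReflexive ℤ X := Module.IsReflexive.of_isPerfPair P.toLinearMap
  exact Module.free_of_finite_type_torsion_free'

section RootCurve

variable {S : Type*} [CommRing S] [Algebra k S] (D : HasRootDatum G P)

/-- The root homomorphism of `α` at the element `c s`. -/
noncomputable def rootCurve (s : S) (c : ι → k) (α : ι) : Matrix (Fin n) (Fin n) S :=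
  (D.rootPoly α).map (Polynomial.aeval (algebraMap k S (c α) * s))

omit [Infinite k] in
theorem isTangent_rootCurve (s : S) (c : ι → k) (α : ι) :
    IsTangent s (rootCurve D s c α) (c α • (D.rootPoly α).map fun f => f.coeff 1) := by
  refine isTangent_map_aeval ?_ (c α)
  have h1 := D.rootPoly_eval α 0
  rw [slUpper_zero, map_one, Units.val_one] at h1
  rw [h1]
  ext i j
  rw [Matrix.map_apply, Matrix.map_apply, Polynomial.coeff_zero_eq_eval_zero]

omit [Infinite k] in
theorem map_rootCurve (φ : S →ₐ[k] k) (s : S) (c : ι → k) (α : ι) :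
    (rootCurve D s c α).map φ = D.sl α (slUpper (c α * φ s)) := by
  rw [D.rootPoly_eval]
  ext i j
  have h1 := Polynomial.aeval_algHom_apply φ (algebraMap k S (c α) * s) (D.rootPoly α i j)
  rw [map_mul, φ.commutes] at h1
  exact h1.symm

omit [Infinite k] in
theorem map_list_prod_rootCurve (φ : S →ₐ[k] k) (s : S) (c : ι → k) (L : List ι) :
    (L.map (rootCurve D s c)).prod.map φ =
      ((L.map fun α => D.sl α (slUpper (c α * φ s))).prod : GL (Fin n) k) := by
  induction L with
  | nil => exact Matrix.map_one _ (map_zero φ) (map_one φ)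
  | cons α L ih =>
    rw [List.map_cons, List.map_cons, List.prod_cons, List.prod_cons, Matrix.map_mul, ih,
      map_rootCurve, Units.val_mul]

end RootCurve

variable {D : HasRootDatum G P} {h : GL (Fin n) k} {χ : Fin n → X}
  (hχ : IsDiagonalization D h χ)

/-- Since `e` has square zero, both sides are homomorphisms from `X` to the units, so it is enough
to compare them on a basis. -/
theorem map_toMul_eq_one_add {k R R' X J : Type*} [Field k] [CommRing R] [CommRing R']
    [Algebra k R'] [AddCommGroup X] (b : Module.Basis J ℤ X) {e : R'} (he : e * e = 0) (η : X →+ k)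
    (f : R →+* R') (u : X →+ Additive Rˣ)
    (h : ∀ j, f ((u (b j)).toMul : R) = 1 + e * algebraMap k R' (η (b j))) (x : X) :
    f ((u x).toMul : R) = 1 + e * algebraMap k R' (η x) := by
  let ψ : X →ₗ[ℤ] Additive R'ˣ :=
    (AddMonoidHom.mk' (fun x => Additive.ofMul (Units.map f.toMonoidHom (u x).toMul))
      fun x x' => by rw [map_add, toMul_add, map_mul, ofMul_mul]).toIntLinearMap
  let ψ' : X →ₗ[ℤ] Additive R'ˣ :=
    (AddMonoidHom.mk' (fun x => Additive.ofMul (tangentUnit k he (Multiplicative.ofAdd (η x))))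
      fun x x' => by rw [map_add, ofAdd_add, map_mul, ofMul_mul]).toIntLinearMap
  have h1 : ψ = ψ' := b.ext fun j => Additive.toMul.injective (Units.ext (h j))
  exact congrArg (fun z : Additive R'ˣ => (z.toMul : R')) (LinearMap.congr_fun h1 x)

omit [Infinite k] in
/-- A curve in the torus over an affine line without some points, with prescribed derivative. -/
theorem exists_torus_curve [Module.Finite ℤ X] [Module.Free ℤ X] (η : X →+ k) :
    ∃ q : Polynomial k, q.eval 0 ≠ 0 ∧ ∃ u : X →+ Additive (Localization.Away q)ˣ, ∀ x,
      Ideal.Quotient.mk (Ideal.span {lineCoord q} ^ 2) ((u x).toMul : Localization.Away q) =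
        1 + Ideal.Quotient.mk (Ideal.span {lineCoord q} ^ 2) (lineCoord q) *
          algebraMap k _ (η x) := by
  let b := Module.Free.chooseBasis ℤ X
  -- The curve takes the value `1 + η (b j) X` on the basis element `b j`. Inverting the product `q`
  -- of these makes them units, and `q(0) = 1` keeps the origin on the line.
  let w : Module.Free.ChooseBasisIndex ℤ X → Polynomial k :=
    fun j => 1 + Polynomial.C (η (b j)) * Polynomial.X
  let q := ∏ j, w j
  have hw : ∀ j, IsUnit (algebraMap (Polynomial k) (Localization.Away q) (w j)) := fun j =>
    isUnit_of_dvd_unit (map_dvd _ (Finset.dvd_prod_of_mem w (Finset.mem_univ j)))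
      (IsLocalization.Away.algebraMap_isUnit q)
  let φ : X →ₗ[ℤ] Additive (Localization.Away q)ˣ :=
    b.constr ℤ fun j => Additive.ofMul (hw j).unit
  have hφ : ∀ j, φ (b j) = Additive.ofMul (hw j).unit := fun j => b.constr_basis ℤ _ j
  refine ⟨q, ?_, φ.toAddMonoidHom, ?_⟩
  · simp [q, w, Polynomial.eval_prod]
  · refine map_toMul_eq_one_add b (mk_mul_mk_self (lineCoord q)) η _ φ.toAddMonoidHom fun j => ?_
    change Ideal.Quotient.mk (Ideal.span {lineCoord q} ^ 2)
      ((φ (b j)).toMul : Localization.Away q) = _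
    rw [hφ]
    change Ideal.Quotient.mk (Ideal.span {lineCoord q} ^ 2)
      (algebraMap (Polynomial k) (Localization.Away q) (w j)) = _
    simp only [w, map_add, map_one, map_mul]
    rw [mul_comm]
    rfl

include hχ in
/-- The big cell contains enough curves through `1` to reach all the tangent vectors. -/
theorem IsDiagonalization.exists_curve [Finite ι] [Module.Finite ℤ X] {y : Y}
    (hy : ∀ α, P.toLinearMap (P.root α) y ≠ 0) {x : Matrix (Fin n) (Fin n) k}
    (hx : x ∈ lieAlgebra G) :
    ∃ (S : Type) (_ : CommRing S) (_ : Algebra k S) (ε : S →ₐ[k] k) (s : S)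
      (γ : Matrix (Fin n) (Fin n) S), (∀ c, s * c = 0 → c = 0) ∧ ε s = 0 ∧
      (∀ ij, entries (γ - 1) ij - s * algebraMap k S (x ij.1 ij.2) ∈ Ideal.span {s} ^ 2) ∧
      ∀ f : MvPolynomial (Fin n × Fin n) k, (∀ g ∈ bigCell D y,
        MvPolynomial.eval (entries (g : Matrix (Fin n) (Fin n) k)) f = 0) →
        MvPolynomial.aeval (entries γ) f = 0 := by
  classical
  let _ := Fintype.ofFinite ι
  have := free_of_rootDatum P
  rw [D.lieAlgebra_eq] at hx
  obtain ⟨x₀, hx₀, x₁, hx₁, rfl⟩ := Submodule.mem_sup.1 hx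
  obtain ⟨η, rfl⟩ := hχ.exists_of_mem_lieAlgebra hx₀
  obtain ⟨c, rfl⟩ := (Submodule.mem_span_range_iff_exists_fun k).1 hx₁
  obtain ⟨q, hq0, u, hu⟩ := exists_torus_curve (k := k) η
  have hq : q ≠ 0 := by
    rintro rfl
    exact hq0 Polynomial.eval_zero
  set s := lineCoord q
  -- A product of root curves for the negative roots, a torus curve, and root curves for the
  -- positive roots: the derivatives add up to the given tangent vector, whatever the order of the
  -- factors.
  let Lp : List ι := (Finset.univ.filter fun α => 0 < P.toLinearMap (P.root α) y).toList
  let Ln : List ι := (Finset.univ.filter fun α => ¬ 0 < P.toLinearMap (P.root α) y).toList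
  let τ : Matrix (Fin n) (Fin n) (Localization.Away q) :=
    Matrix.diagonal fun i => ((u (χ i)).toMul : Localization.Away q)
  let τ' : Matrix (Fin n) (Fin n) (Localization.Away q) :=
    (h : Matrix (Fin n) (Fin n) k).map (algebraMap k _) * τ *
      ((h⁻¹ : GL (Fin n) k) : Matrix (Fin n) (Fin n) k).map (algebraMap k _)
  have hτ : IsTangent s τ (Matrix.diagonal fun i => η (χ i)) := by
    unfold IsTangent
    ext i j
    rw [Matrix.map_apply, Matrix.add_apply, Matrix.smul_apply, Matrix.map_apply, smul_eq_mul]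
    simp only [τ]
    rcases eq_or_ne i j with rfl | hij
    · rw [Matrix.diagonal_apply_eq, Matrix.diagonal_apply_eq, Matrix.one_apply_eq, hu]
    · rw [Matrix.diagonal_apply_ne _ hij, Matrix.diagonal_apply_ne _ hij, Matrix.one_apply_ne hij,
        map_zero, map_zero, mul_zero, add_zero]
  have htan : IsTangent s ((Ln.map (rootCurve D s c)).prod * τ' * (Lp.map (rootCurve D s c)).prod)
      ((h : Matrix (Fin n) (Fin n) k) * (Matrix.diagonal fun i => η (χ i)) *
        ((h⁻¹ : GL (Fin n) k) : Matrix (Fin n) (Fin n) k) +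
        ∑ α, c α • (D.rootPoly α).map fun f => f.coeff 1) := by
    have h1 := ((IsTangent.list_prod (isTangent_rootCurve D s c) Ln).mul (hτ.conj h)).mul
      (IsTangent.list_prod (isTangent_rootCurve D s c) Lp)
    rw [Finset.sum_map_toList, Finset.sum_map_toList] at h1
    rw [← Finset.sum_filter_add_sum_filter_not Finset.univ
      (fun α => 0 < P.toLinearMap (P.root α) y)]
    convert h1 using 1
    abel
  refine ⟨Localization.Away q, inferInstance, inferInstance, lineEval hq0, s, _,
    lineCoord_mul_eq_zero hq, lineEval_lineCoord hq0, htan.entries_sub_mem, fun f hf => ?_⟩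
  -- Over an infinite field a function on this line is determined by its values, and each value of
  -- the curve is a point of the big cell.
  refine eq_zero_of_lineEval hq _ fun r hr => ?_
  let t : SplitTorus k X :=
    { toFun := fun x => Units.map (lineEval hr).toMonoidHom (u x.toAdd).toMul
      map_one' := by rw [toAdd_one, map_zero, toMul_zero, map_one]
      map_mul' := fun a b => by rw [toAdd_mul, map_add, toMul_add, map_mul] }
  have hτr : τ'.map (lineEval hr) = D.torus t := by
    rw [hχ.torus_eq, Matrix.map_mul, Matrix.map_mul]
    have h2 : ∀ a : Matrix (Fin n) (Fin n) k, (a.map (algebraMap k (Localization.Away q))).map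
        (lineEval hr) = a := by
      intro a
      ext i j
      exact (lineEval hr).commutes _
    rw [h2, h2, Matrix.diagonal_map (map_zero _)]
    rfl
  have hmem : ∀ (L : List ι) (y : Y), (∀ α ∈ L, 0 < P.toLinearMap (P.root α) y) →
      (L.map fun α => D.sl α (slUpper (c α * lineEval hr s))).prod ∈ posUnip D y := by
    intro L y hL
    refine Submonoid.list_prod_mem _ fun g hg => ?_
    obtain ⟨α, hα, rfl⟩ := List.mem_map.1 hg
    exact sl_mem_posUnip D (hL α hα) _
  have h3 := hf _ ⟨_, hmem Ln (-y) (fun α hα => ?_), t, _, hmem Lp y (fun α hα => ?_), rfl⟩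
  · rw [Units.val_mul, Units.val_mul, ← map_list_prod_rootCurve, ← map_list_prod_rootCurve, ← hτr,
      ← Matrix.map_mul, ← Matrix.map_mul] at h3
    rw [← AlgHom.comp_apply, MvPolynomial.comp_aeval]
    exact h3
  · have h4 := (Finset.mem_filter.1 (Finset.mem_toList.1 hα)).2
    rw [map_neg]
    have := hy α
    omega
  · exact (Finset.mem_filter.1 (Finset.mem_toList.1 hα)).2

end Curves

/-! ### The centre lies in the torus -/

section Center

variable {k : Type} [Field k] [Infinite k] {n : ℕ} {ι X Y : Type*} [AddCommGroup X]
  [AddCommGroup Y] {P : RootDatum ι X Y} {G : Subgroup (GL (Fin n) k)} {D : HasRootDatum G P}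
  {h : GL (Fin n) k} {χ : Fin n → X}

/-- Polynomials that vanish on the big cell vanish on the group. -/
theorem IsDiagonalization.eval_conj_eq_zero (hχ : IsDiagonalization D h χ)
    (hG : IsZariskiConnected (G : Set (GL (Fin n) k))) [Finite ι]
    [Module.Finite ℤ X] {y : Y} (hy : ∀ α, P.toLinearMap (P.root α) y ≠ 0)
    {F : MvPolynomial (Fin n × Fin n) k}
    (hF : ∀ u v t, IsUnitriangular (fun i => -P.toLinearMap (χ i) y) u →
      IsUnitriangular (fun i => P.toLinearMap (χ i) y) v →
      MvPolynomial.eval (entries (u * (Matrix.diagonal fun i => charValue t (χ i)) * v)) F = 0)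
    {g : GL (Fin n) k} (hg : g ∈ G) :
    MvPolynomial.eval (entries ((h⁻¹ * g * h : GL (Fin n) k) : Matrix (Fin n) (Fin n) k)) F = 0 := by
  rw [← eval_conjPoly]
  refine eval_eq_zero_of_curves hG (bigCell_subset D y) (fun x hx => hχ.exists_curve hy hx) ?_ g hg
  rintro _ ⟨u, hu, t, v, hv, rfl⟩
  rw [eval_conjPoly]
  have h1 : h⁻¹ * (u * D.torus t * v) * h =
      (h⁻¹ * u * h) * (h⁻¹ * D.torus t * h) * (h⁻¹ * v * h) := by group
  rw [h1, Units.val_mul, Units.val_mul _ (h⁻¹ * D.torus t * h), hχ.conj_eq]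
  refine hF _ _ _ ?_ (hχ.isUnitriangular hv)
  have h2 := hχ.isUnitriangular hu
  simpa only [map_neg] using h2

/-- The matrix of indeterminates. -/
noncomputable def genericMatrix (k : Type*) [Field k] (n : ℕ) :
    Matrix (Fin n) (Fin n) (MvPolynomial (Fin n × Fin n) k) :=
  Matrix.of fun i j => MvPolynomial.X (i, j)

omit [Infinite k] in
theorem map_genericMatrix (M : Matrix (Fin n) (Fin n) k) :
    (genericMatrix k n).map (MvPolynomial.eval (entries M)) = M := by
  ext i j
  rw [Matrix.map_apply, genericMatrix, Matrix.of_apply, MvPolynomial.eval_X]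
  rfl

/-- Elements of the group that commute with the torus are diagonal, and their entries satisfy the
relations between the weights. -/
theorem IsDiagonalization.exists_torus_eq (hχ : IsDiagonalization D h χ)
    (hG : IsZariskiConnected (G : Set (GL (Fin n) k)))
    [Finite ι] [Module.Finite ℤ X] {z : GL (Fin n) k} (hz : z ∈ G)
    (hcomm : ∀ t, z * D.torus t = D.torus t * z) : ∃ t, D.torus t = z := by
  obtain ⟨y, hy⟩ := exists_regular P
  set d : Fin n → ℤ := fun i => P.toLinearMap (χ i) y with hd
  set z' : GL (Fin n) k := h⁻¹ * z * h with hz'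
  set M : Matrix (Fin n) (Fin n) k := (z' : Matrix (Fin n) (Fin n) k) with hM
  -- Commuting with the values of the cocharacter `y` already forces the entries between different
  -- levels to vanish.
  have hlevel : IsLevelDiagonal d M := by
    intro a b hab
    obtain ⟨s, hs⟩ := exists_units_zpow_ne_one (k := k) (sub_ne_zero.2 hab)
    have h1 : z' * (h⁻¹ * D.torus (cocharValue P y s) * h) =
        (h⁻¹ * D.torus (cocharValue P y s) * h) * z' := by
      calc _ = h⁻¹ * (z * D.torus (cocharValue P y s)) * h := by rw [hz']; group
        _ = _ := by rw [hcomm, hz']; group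
    have h2 := congrArg (fun g : GL (Fin n) k => (g : Matrix (Fin n) (Fin n) k) a b) h1
    simp only [Units.val_mul z', Units.val_mul _ z'] at h2
    rw [hχ.conj_eq, Matrix.mul_diagonal, Matrix.diagonal_mul, charValue_cocharValue,
      charValue_cocharValue] at h2
    by_contra hne
    apply hs
    rw [zpow_sub, mul_inv_eq_one]
    apply Units.ext
    exact mul_right_cancel₀ hne (h2.symm.trans (mul_comm _ _))
  have hminor : ∀ c, levelMinor d c M ≠ 0 := by
    intro c
    refine hlevel.levelMinor_ne_zero (g' := ((z'⁻¹ : GL (Fin n) k) : Matrix (Fin n) (Fin n) k)) ?_ c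
    rw [hM, ← Units.val_mul, mul_inv_cancel, Units.val_one]
  -- For `i ≠ j` of the same level the bordered minor vanishes on the big cell, hence on `G`. At `M`
  -- it is the entry `M i j` times a nonzero minor.
  have hdiag : ∀ i j, i ≠ j → M i j = 0 := by
    intro i j hij
    by_cases hdij : d i = d j
    · have h1 := hχ.eval_conj_eq_zero hG hy (F := borderedMinor d (d i) i j (genericMatrix k n))
        (fun u v t hu hv => by
          rw [map_borderedMinor, map_genericMatrix, borderedMinor_mul_mul hu hv rfl hdij.symm,
            (isLevelDiagonal_diagonal d _).borderedMinor rfl, Matrix.diagonal_apply_ne _ hij,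
            zero_mul]) hz
      rw [map_borderedMinor, map_genericMatrix, hlevel.borderedMinor rfl] at h1
      exact (mul_eq_zero.1 h1).resolve_right (hminor _)
    · exact hlevel i j hdij
  have hMdiag : M = Matrix.diagonal fun i => M i i := by
    ext i j
    rcases eq_or_ne i j with rfl | hij
    · rw [Matrix.diagonal_apply_eq]
    · rw [Matrix.diagonal_apply_ne _ hij, hdiag i j hij]
  have hne : ∀ i, M i i ≠ 0 := by
    intro i h0
    have h1 : (z'⁻¹ * z' : GL (Fin n) k) = 1 := inv_mul_cancel z'
    have h2 := congrArg (fun g : GL (Fin n) k => (g : Matrix (Fin n) (Fin n) k) i i) h1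
    simp only [Units.val_mul] at h2
    rw [← hM, hMdiag, Matrix.mul_diagonal, h0, mul_zero] at h2
    simp at h2
  have hrel : ∀ m : Fin n → ℤ, ∑ i, m i • χ i = 0 →
      ∏ i, M i i ^ (m i).toNat = ∏ i, M i i ^ (-m i).toNat := by
    intro m hm
    -- On the big cell the quotient `A i / B i` is the weight `χ i` of the torus factor; at `M` it
    -- is `M i i`. The relation between the weights, with denominators cleared, is a polynomial
    -- identity that carries over to `M`.
    let A : Fin n → MvPolynomial (Fin n × Fin n) k := fun i =>
      borderedMinor d (d i) i i (genericMatrix k n)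
    let B : Fin n → MvPolynomial (Fin n × Fin n) k := fun i => levelMinor d (d i) (genericMatrix k n)
    have h1 := hχ.eval_conj_eq_zero hG hy
      (F := ∏ i, (A i ^ (m i).toNat * B i ^ (-m i).toNat) -
        ∏ i, (A i ^ (-m i).toNat * B i ^ (m i).toNat))
      (fun u v t hu hv => by
        have h5 : ∀ i, borderedMinor d (d i) i i
            (u * (Matrix.diagonal fun i => charValue t (χ i)) * v) = charValue t (χ i) *
              levelMinor d (d i) (Matrix.diagonal fun i => charValue t (χ i)) := fun i => by
          rw [borderedMinor_mul_mul hu hv rfl rfl,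
            (isLevelDiagonal_diagonal d _).borderedMinor rfl, Matrix.diagonal_apply_eq]
        have h6 : ∀ c, levelMinor d c (u * (Matrix.diagonal fun i => charValue t (χ i)) * v) =
            levelMinor d c (Matrix.diagonal fun i => charValue t (χ i)) :=
          fun c => levelMinor_mul_mul hu hv c _
        simp only [map_sub, map_prod, map_mul, map_pow, A, B, map_borderedMinor, map_levelMinor,
          map_genericMatrix, h5, h6, mul_pow, Finset.prod_mul_distrib]
        rw [prod_charValue_pow_eq hm]
        ring) hz
    simp only [map_sub, map_prod, map_mul, map_pow, A, B, map_borderedMinor, map_levelMinor,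
      map_genericMatrix, ← hz', ← hM, hlevel.borderedMinor rfl, mul_pow,
      Finset.prod_mul_distrib] at h1
    have h2 : (∏ i, levelMinor d (d i) M ^ (m i).toNat) *
        ∏ i, levelMinor d (d i) M ^ (-m i).toNat ≠ 0 :=
      mul_ne_zero (Finset.prod_ne_zero_iff.2 fun i _ => pow_ne_zero _ (hminor _))
        (Finset.prod_ne_zero_iff.2 fun i _ => pow_ne_zero _ (hminor _))
    apply mul_right_cancel₀ h2
    linear_combination h1
  obtain ⟨η, hη⟩ := hχ.exists_hom (fun i => Additive.ofMul (Units.mk0 _ (hne i))) (by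
    intro m hm
    apply Additive.toMul.injective
    rw [toMul_sum, toMul_zero]
    have h1 : ∀ i, (m i • Additive.ofMul (Units.mk0 _ (hne i))).toMul =
        Units.mk0 _ (hne i) ^ (m i).toNat / Units.mk0 _ (hne i) ^ (-m i).toNat := by
      intro i
      rw [toMul_zsmul, toMul_ofMul, ← zpow_natCast, ← zpow_natCast, div_eq_mul_inv, ← zpow_sub,
        Int.toNat_sub_toNat_neg]
    simp only [h1]
    rw [Finset.prod_div_distrib, div_eq_one]
    apply Units.ext
    simpa only [Units.coe_prod, Units.val_pow_eq_pow_val, Units.val_mk0] using hrel m hm)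
  refine ⟨AddMonoidHom.toMultiplicativeLeft η, Units.ext ?_⟩
  rw [hχ.torus_eq]
  have h1 : (Matrix.diagonal fun i => charValue (AddMonoidHom.toMultiplicativeLeft η) (χ i)) = M := by
    rw [hMdiag]
    congr 1
    funext i
    exact congrArg (fun w : Additive kˣ => (w.toMul : k)) (hη i)
  rw [h1, hM, ← Units.val_mul, ← Units.val_mul, hz']
  congr 1
  group

/-- The elements of the centre lie in the torus, and the roots are trivial on them. -/
theorem exists_torus_eq_of_forall_commute (D : HasRootDatum G P)
    (hG : IsZariskiConnected (G : Set (GL (Fin n) k))) [Finite ι]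
    [Module.Finite ℤ X] {z : GL (Fin n) k} (hz : z ∈ G) (hcomm : ∀ g ∈ G, z * g = g * z) :
    ∃ t, D.torus t = z ∧ ∀ α, charValue t (P.root α) = 1 := by
  obtain ⟨h, χ, hχ⟩ := exists_isDiagonalization D
  obtain ⟨t, rfl⟩ := hχ.exists_torus_eq hG hz fun t => hcomm _ (D.torus_mem t)
  refine ⟨t, rfl, fun α => ?_⟩
  by_contra hne
  refine D.rootVector_ne_zero α ?_
  ext i j
  -- A central element fixes the root homomorphism, so rescaling its parameter by the value of `α`
  -- changes nothing. Comparing linear coefficients, this value must be `1` as the root vector is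
  -- nonzero.
  have h1 : D.rootPoly α i j =
      (D.rootPoly α i j).comp (Polynomial.C (charValue t (P.root α)) * Polynomial.X) := by
    apply Polynomial.funext
    intro c
    have h2 := D.torus_upper α t c
    rw [hcomm _ (D.sl_mem α _), mul_inv_cancel_right] at h2
    have h3 := congrArg (fun g : GL (Fin n) k => (g : Matrix (Fin n) (Fin n) k) i j) h2
    simp only [D.rootPoly_eval, Matrix.map_apply] at h3
    rw [h3]
    simp
  have h4 := congrArg (fun f => Polynomial.coeff f 1) h1
  simp only [Polynomial.comp_C_mul_X_coeff, pow_one] at h4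
  rw [Matrix.map_apply, Matrix.zero_apply]
  by_contra h0
  exact hne (mul_left_cancel₀ h0 (by rw [← h4, mul_one]))

end Center

/-! ### Kernels of the Cartan matrices of types B, C and E₇ over any abelian group -/

section Cartan

variable {V : Type*} [AddCommGroup V]

/-- The unknowns are shifted to `b 1, ..., b l` and padded with zeros on both sides, so that the
first and last rows need no separate form. -/
theorem sum_tridiagonal {l : ℕ} (b : ℕ → V) (hb : ∀ j, l < j → b j = 0) (j : Fin l) (u v : ℤ)
    (A : Fin l → ℤ) (hA : ∀ i : Fin l, A i =
      if (i : ℕ) = j then 2 else if (i : ℕ) = j + 1 then u else if (i : ℕ) + 1 = j then v else 0)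
    (h0 : b 0 = 0) :
    ∑ i, A i • b (i + 1) = v • b j + 2 • b (j + 1) + u • b (j + 2) := by
  have h1 : ∀ i : Fin l, A i • b (i + 1) =
      (if (i : ℕ) + 1 = j then v • b j else 0) + (if (i : ℕ) = j then 2 • b (j + 1) else 0) +
        (if (i : ℕ) = j + 1 then u • b (j + 2) else 0) := by
    intro i
    rw [hA]
    by_cases c1 : (i : ℕ) = j
    · rw [if_pos c1, if_neg (by omega), if_pos c1, if_neg (by omega), c1]
      simp [two_zsmul, two_nsmul]
    · by_cases c2 : (i : ℕ) = j + 1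
      · rw [if_neg c1, if_pos c2, if_neg (by omega), if_neg c1, if_pos c2, c2]
        simp
      · by_cases c3 : (i : ℕ) + 1 = j
        · rw [if_neg c1, if_neg c2, if_pos c3, if_pos c3, if_neg c1, if_neg c2, c3]
          simp
        · rw [if_neg c1, if_neg c2, if_neg c3, if_neg c3, if_neg c1, if_neg c2]
          simp
  rw [Finset.sum_congr rfl fun i _ => h1 i, Finset.sum_add_distrib, Finset.sum_add_distrib,
    Fin.sum_univ_eq_sum_range (fun i => if i + 1 = (j : ℕ) then v • b j else 0) l,
    Fin.sum_univ_eq_sum_range (fun i => if i = (j : ℕ) then 2 • b (j + 1) else 0) l,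
    Fin.sum_univ_eq_sum_range (fun i => if i = (j : ℕ) + 1 then u • b (j + 2) else 0) l,
    Finset.sum_ite_eq', Finset.sum_ite_eq', if_pos (Finset.mem_range.2 j.2)]
  congr 1
  · congr 1
    rcases Nat.eq_zero_or_eq_succ_pred (j : ℕ) with hj | hj
    · rw [hj, h0, smul_zero]
      simp
    · rw [Finset.sum_eq_single ((j : ℕ) - 1)]
      · rw [if_pos (by omega)]
      · intro i _ hi
        rw [if_neg (by omega)]
      · intro hi
        exact absurd (Finset.mem_range.2 (by omega)) hi
  · split_ifs with hj
    · rfl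
    · rw [hb (j + 2) (by rw [Finset.mem_range] at hj; omega), smul_zero]

theorem eq_smul_of_recurrence (b : ℕ → V) (h0 : b 0 = 0) (N : ℕ)
    (h : ∀ j, j + 2 ≤ N → (-1 : ℤ) • b j + 2 • b (j + 1) + (-1 : ℤ) • b (j + 2) = 0) :
    ∀ j ≤ N, b j = j • b 1 := by
  intro j
  induction j using Nat.twoStepInduction with
  | zero => intro _; rw [h0, zero_smul]
  | one => intro _; rw [one_smul]
  | more j ih ih' =>
    intro hj
    have h1 := h j hj
    rw [ih (by omega), ih' (by omega)] at h1
    have h2 : b (j + 2) = 2 • (j + 1) • b 1 - j • b 1 := by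
      rw [neg_one_zsmul, neg_one_zsmul] at h1
      rw [← sub_eq_zero, ← neg_eq_zero, ← h1]
      abel
    rw [h2]
    module

theorem solutions_cartanMatrix_B {l : ℕ} (hl : 1 ≤ l) (a : Fin l → V)
    (ha : ∀ j, ∑ i, CartanMatrix.B l j i • a i = 0) :
    ∃ ε : V, 2 • ε = 0 ∧ ∀ i : Fin l, a i = (if (i : ℕ) = l - 1 then 1 else 0 : ℕ) • ε := by
  let b : ℕ → V := fun j => if h : 0 < j ∧ j ≤ l then a ⟨j - 1, by omega⟩ else 0
  have hb : ∀ j, l < j → b j = 0 := fun j hj => dif_neg (by omega)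
  have h0 : b 0 = 0 := dif_neg (by omega)
  have hab : ∀ i : Fin l, a i = b (i + 1) := fun i => by
    simp only [b]
    rw [dif_pos ⟨by omega, i.2⟩]
    rfl
  have hrow : ∀ j < l, (-1 : ℤ) • b j + 2 • b (j + 1) +
      (if j + 1 = l - 1 then -2 else -1 : ℤ) • b (j + 2) = 0 := by
    intro j hj
    have h1 := ha ⟨j, hj⟩
    simp only [hab] at h1
    rw [sum_tridiagonal b hb ⟨j, hj⟩ (if j + 1 = l - 1 then -2 else -1) (-1) _ _ h0] at h1
    · exact h1
    · intro i
      simp only [CartanMatrix.B, Matrix.of_apply, Fin.ext_iff]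
      grind
  have hlin := eq_smul_of_recurrence b h0 (l - 1) fun j hj => by
    have h1 := hrow j (by omega)
    rwa [if_neg (by omega)] at h1
  have hlast := hrow (l - 1) (by omega)
  rw [if_neg (by omega), hb (l - 1 + 2) (by omega), smul_zero, add_zero,
    hlin (l - 1) le_rfl] at hlast
  have h1 : (l - 1) • b 1 = 0 ∧ (1 < l → b 1 = 0) := by
    rcases Nat.lt_or_ge 1 l with h | h
    · have h2 := hrow (l - 2) (by omega)
      rw [if_pos (by omega), hlin (l - 2) (by omega), show l - 2 + 1 = l - 1 by omega,
        show l - 2 + 2 = l - 1 + 1 by omega, hlin (l - 1) le_rfl] at h2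
      obtain ⟨c, rfl⟩ : ∃ c, l = c + 2 := ⟨l - 2, by omega⟩
      simp only [Nat.add_sub_cancel, show c + 2 - 1 = c + 1 by omega] at h2 hlast ⊢
      -- With `b j = j • b 1` for `j ≤ l - 1`, the last two rows read `l • b 1 = 2 • b l` and `(l -
      -- 1) • b 1 = 2 • b l`.
      have h3 : b 1 = 0 := by
        linear_combination (norm := module) h2 + hlast
      exact ⟨by rw [h3, smul_zero], fun _ => h3⟩
    · exact ⟨by rw [show l - 1 = 0 by omega, zero_smul], fun h' => absurd h' (by omega)⟩
  refine ⟨b l, ?_, fun i => ?_⟩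
  · rw [h1.1, smul_zero, zero_add, Nat.sub_add_cancel hl] at hlast
    exact hlast
  · rw [hab]
    split_ifs with hi
    · rw [one_smul, hi, Nat.sub_add_cancel hl]
    · rw [zero_smul, hlin (i + 1) (by omega), h1.2 (by omega), smul_zero]

theorem solutions_cartanMatrix_C {l : ℕ} (hl : 1 ≤ l) (a : Fin l → V)
    (ha : ∀ j, ∑ i, CartanMatrix.C l j i • a i = 0) :
    ∃ ε : V, 2 • ε = 0 ∧ ∀ i : Fin l, a i = ((i : ℕ) + 1) • ε := by
  let b : ℕ → V := fun j => if h : 0 < j ∧ j ≤ l then a ⟨j - 1, by omega⟩ else 0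
  have hb : ∀ j, l < j → b j = 0 := fun j hj => dif_neg (by omega)
  have h0 : b 0 = 0 := dif_neg (by omega)
  have hab : ∀ i : Fin l, a i = b (i + 1) := fun i => by
    simp only [b]
    rw [dif_pos ⟨by omega, i.2⟩]
    rfl
  have hrow : ∀ j < l, (if j = l - 1 then -2 else -1 : ℤ) • b j + 2 • b (j + 1) +
      (-1 : ℤ) • b (j + 2) = 0 := by
    intro j hj
    have h1 := ha ⟨j, hj⟩
    simp only [hab] at h1
    rw [sum_tridiagonal b hb ⟨j, hj⟩ (-1) (if j = l - 1 then -2 else -1) _ _ h0] at h1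
    · exact h1
    · intro i
      simp only [CartanMatrix.C, Matrix.of_apply, Fin.ext_iff]
      grind
  have hlin := eq_smul_of_recurrence b h0 l fun j hj => by
    have h1 := hrow j (by omega)
    rwa [if_neg (by omega)] at h1
  have hlast := hrow (l - 1) (by omega)
  rw [if_pos rfl, hb (l - 1 + 2) (by omega), smul_zero, add_zero, hlin (l - 1) (by omega),
    hlin (l - 1 + 1) (by omega)] at hlast
  -- All `b j` are `j • b 1`, and the last row becomes `(2 l - 2 (l - 1)) • b 1 = 0`.
  refine ⟨b 1, ?_, fun i => by rw [hab, hlin _ i.2]⟩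
  rw [← hlast]
  module

theorem solutions_cartanMatrix_E₇ (a : Fin 7 → V)
    (ha : ∀ j, ∑ i, CartanMatrix.E₇ j i • a i = 0) :
    ∃ ε : V, 2 • ε = 0 ∧ ∀ i : Fin 7, a i = (![0, 1, 0, 0, 1, 0, 1] i : ℕ) • ε := by
  have h0 := ha 0
  have h1 := ha 1
  have h2 := ha 2
  have h3 := ha 3
  have h4 := ha 4
  have h5 := ha 5
  have h6 := ha 6
  simp [CartanMatrix.E₇, Fin.sum_univ_succ] at h0 h1 h2 h3 h4 h5 h6
  -- The multipliers express elements of the root lattice in simple roots, in Bourbaki's numbering: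
  -- `2 ω₇` here, and below `ω₁`, `ω₂ - ω₇`, `ω₃`, `ω₄`, `ω₅ - ω₇`, `ω₆`.
  refine ⟨a 6, ?_, fun i => ?_⟩
  · linear_combination (norm := module) 2 • h0 + 3 • h1 + 4 • h2 + 6 • h3 + 5 • h4 + 4 • h5 + 3 • h6
  · fin_cases i <;> simp
    · linear_combination (norm := module) 2 • h0 + 2 • h1 + 3 • h2 + 4 • h3 + 3 • h4 + 2 • h5 + h6
    · linear_combination (norm := module) h0 + 2 • h1 + 2 • h2 + 3 • h3 + 2 • h4 + h5
    · linear_combination (norm := module) 3 • h0 + 4 • h1 + 6 • h2 + 8 • h3 + 6 • h4 + 4 • h5 + 2 • h6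
    · linear_combination (norm := module) 4 • h0 + 6 • h1 + 8 • h2 + 12 • h3 + 9 • h4 + 6 • h5 + 3 • h6
    · linear_combination (norm := module) 2 • h0 + 3 • h1 + 4 • h2 + 6 • h3 + 5 • h4 + 3 • h5 + h6
    · linear_combination (norm := module) 2 • h0 + 3 • h1 + 4 • h2 + 6 • h3 + 5 • h4 + 4 • h5 + 2 • h6

end Cartan

/-! ### At most one nontrivial central element -/

section UniqueCentralElement

/-- For the Cartan matrices of types `B`, `C` and `E₇`, the solutions of the homogeneous system of
linear equations in any abelian group are the multiples, by fixed coefficients, of an element that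
is annihilated by `2`. -/
theorem exists_solutions_of_isTypeBCE7 {ι X Y : Type*} [AddCommGroup X] [AddCommGroup Y]
    {P : RootDatum ι X Y} (htype : IsTypeBCE7 P) :
    ∃ (l : ℕ) (b : P.Base) (e : Fin l ≃ b.support) (m : Fin l → ℕ), ∀ (V : Type)
      [AddCommGroup V] (a : Fin l → V), (∀ j, ∑ i, P.pairing (e j) (e i) • a i = 0) →
      ∃ ε : V, 2 • ε = 0 ∧ ∀ i, a i = m i • ε := by
  rcases htype with ⟨l, hl, b, e, h⟩ | ⟨l, hl, b, e, h⟩ | ⟨b, e, h⟩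
  · refine ⟨l, b, e, _, fun V _ a ha => solutions_cartanMatrix_B hl a ?_⟩
    simpa only [h] using ha
  · refine ⟨l, b, e, _, fun V _ a ha => solutions_cartanMatrix_C hl a ?_⟩
    simpa only [h] using ha
  · refine ⟨7, b, e, _, fun V _ a ha => solutions_cartanMatrix_E₇ a ?_⟩
    simpa only [h] using ha

variable {ι X Y : Type*} [AddCommGroup X] [AddCommGroup Y] {P : RootDatum ι X Y}

/-- The weights that are dual to the simple coroots. -/
theorem exists_fundamental_weights (hsc : IsSimplyConnectedDatum P) {l : ℕ} {b : P.Base}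
    (e : Fin l ≃ b.support) :
    ∃ ω : Fin l → X, ∀ x, x = ∑ i, P.toLinearMap x (P.coroot (e i)) • ω i := by
  classical
  have hli : LinearIndependent ℤ fun i => P.coroot (e i) :=
    b.linearIndepOn_coroot.comp e e.injective
  have hspan : ⊤ ≤ Submodule.span ℤ (Set.range fun i => P.coroot (e i)) := by
    have h1 : (Set.range fun i => P.coroot (e i)) = P.coroot '' b.support := by
      ext y
      constructor
      · rintro ⟨i, rfl⟩
        exact ⟨e i, (e i).2, rfl⟩
      · rintro ⟨α, hα, rfl⟩
        exact ⟨e.symm ⟨α, hα⟩, by simp⟩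
    rw [h1, b.span_int_coroot_support]
    exact hsc.ge
  let B := Module.Basis.mk hli hspan
  have hB : ∀ i, B i = P.coroot (e i) := fun i => Module.Basis.mk_apply hli hspan i
  -- Simple connectedness makes the simple coroots a basis of `Y`; the perfect pairing realizes the
  -- dual basis by elements of `X`.
  choose ω hω using fun i => P.isPerfPair_toLinearMap.bijective_left.2 (B.coord i)
  refine ⟨ω, fun x => P.isPerfPair_toLinearMap.bijective_left.1 (B.ext fun j => ?_)⟩
  rw [map_sum, LinearMap.sum_apply]
  simp only [map_zsmul, LinearMap.smul_apply, hω, Module.Basis.coord_apply,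
    Module.Basis.repr_self, ← hB]
  rw [Finset.sum_eq_single j]
  · simp
  · intro i _ hi
    rw [Finsupp.single_eq_of_ne hi]
    simp
  · simp

theorem val_eq_neg_one_of_two_nsmul_eq_zero {k : Type*} [Field k] {ε : Additive kˣ}
    (h : 2 • ε = 0) (h0 : ε ≠ 0) : (ε.toMul : k) = -1 := by
  have h1 : (ε.toMul : kˣ) ^ 2 = 1 := h
  have h2 : (ε.toMul : k) ^ 2 = 1 := by
    rw [← Units.val_pow_eq_pow_val, h1, Units.val_one]
  rw [sq] at h2
  refine (mul_self_eq_one_iff.1 h2).resolve_left fun h3 => ?_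
  apply h0
  exact Additive.toMul.injective (Units.ext h3)

/-- A simple root is the combination of the `ω i` with coefficients a row of the Cartan matrix. So
the values `t (ω i)` solve its homogeneous system in `kˣ` and are fixed powers of one `ε` with `ε² =
1`. If `t ≠ 1`, then `ε = -1`, which determines `t`. -/
theorem torus_eq_of_root_eq_one {k : Type} [Field k] (hsc : IsSimplyConnectedDatum P)
    (htype : IsTypeBCE7 P) {t t' : SplitTorus k X} (ht : ∀ α, charValue t (P.root α) = 1)
    (ht' : ∀ α, charValue t' (P.root α) = 1) (h : t ≠ 1) (h' : t' ≠ 1) : t = t' := by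
  obtain ⟨l, b, e, m, hm⟩ := exists_solutions_of_isTypeBCE7 htype
  obtain ⟨ω, hω⟩ := exists_fundamental_weights hsc e
  have key : ∀ t : SplitTorus k X, (∀ α, charValue t (P.root α) = 1) → t ≠ 1 →
      ∃ ε : Additive kˣ, (ε.toMul : k) = -1 ∧ ∀ x, Additive.ofMul (t (Multiplicative.ofAdd x)) =
        ∑ i, P.toLinearMap x (P.coroot (e i)) • m i • ε := by
    intro t ht hne
    have hsum : ∀ x, Additive.ofMul (t (Multiplicative.ofAdd x)) =
        ∑ i, P.toLinearMap x (P.coroot (e i)) •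
          Additive.ofMul (t (Multiplicative.ofAdd (ω i))) := by
      intro x
      conv_lhs => rw [hω x]
      rw [ofAdd_sum, map_prod, ofMul_prod]
      refine Finset.sum_congr rfl fun i _ => ?_
      rw [ofAdd_zsmul, map_zpow, ofMul_zpow]
    obtain ⟨ε, hε, ha⟩ := hm (Additive kˣ) (fun i => Additive.ofMul (t (Multiplicative.ofAdd (ω i))))
      (fun j => by
        have h1 := hsum (P.root (e j))
        have h2 : t (Multiplicative.ofAdd (P.root (e j))) = 1 := Units.ext (ht (e j))
        rw [h2, ofMul_one] at h1
        exact h1.symm)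
    have hx : ∀ x, Additive.ofMul (t (Multiplicative.ofAdd x)) =
        ∑ i, P.toLinearMap x (P.coroot (e i)) • m i • ε := by
      intro x
      rw [hsum x]
      simp only [ha]
    refine ⟨ε, val_eq_neg_one_of_two_nsmul_eq_zero hε ?_, hx⟩
    rintro rfl
    refine hne (MonoidHom.ext fun x => ?_)
    have h3 := hx x.toAdd
    simp only [smul_zero, Finset.sum_const_zero] at h3
    exact Additive.ofMul.injective h3
  obtain ⟨ε, hε, hx⟩ := key t ht h
  obtain ⟨ε', hε', hx'⟩ := key t' ht' h'
  have hεε' : ε = ε' := Additive.toMul.injective (Units.ext (hε.trans hε'.symm))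
  refine MonoidHom.ext fun x => Additive.ofMul.injective ?_
  exact (hx x.toAdd).trans ((hεε' ▸ hx' x.toAdd).symm)

/-- In the groups of types `B`, `C` and `E₇`, there is at most one nontrivial central element. -/
theorem eq_of_mem_center {k : Type} [Field k] [Infinite k] {n : ℕ} {G : Subgroup (GL (Fin n) k)}
    (D : HasRootDatum G P) (hG : IsZariskiConnected (G : Set (GL (Fin n) k))) [Finite ι]
    [Module.Finite ℤ X] (hsc : IsSimplyConnectedDatum P) (htype : IsTypeBCE7 P) {z w : G}
    (hz : z ∈ Subgroup.center G) (hw : w ∈ Subgroup.center G) (hz1 : z ≠ 1) (hw1 : w ≠ 1) :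
    z = w := by
  have key : ∀ z ∈ Subgroup.center G, z ≠ 1 → ∃ t, D.torus t = z ∧
      (∀ α, charValue t (P.root α) = 1) ∧ t ≠ 1 := by
    intro z hz hz1
    obtain ⟨t, ht, htα⟩ := exists_torus_eq_of_forall_commute D hG z.2 fun g hg =>
      (congrArg Subtype.val (Subgroup.mem_center_iff.1 hz ⟨g, hg⟩)).symm
    refine ⟨t, ht, htα, ?_⟩
    rintro rfl
    exact hz1 (Subtype.ext (by rw [← ht, map_one]; rfl))
  obtain ⟨t, ht, htα, ht1⟩ := key z hz hz1
  obtain ⟨t', ht', htα', ht1'⟩ := key w hw hw1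
  apply Subtype.ext
  rw [← ht, ← ht', torus_eq_of_root_eq_one hsc htype htα htα' ht1 ht1']

end UniqueCentralElement

end LinAlgGroup

/-! ### The theorem -/

open LinAlgGroup in
theorem proposition2p2 (p : ℕ) [Fact p.Prime] (hp : p ≠ 2)
    -- a simple simply connected algebraic group of type B, C or E₇
    {n : ℕ} (G : Subgroup (GL (Fin n) (AlgebraicClosure (ZMod p)))) (hG : IsSimpleAlgebraic G)
    {ι X Y : Type*} [Finite ι] [AddCommGroup X] [AddCommGroup Y] [Module.Finite ℤ X]
    [Module.Finite ℤ Y] (P : RootDatum ι X Y) [P.IsReduced] (hGP : Nonempty (HasRootDatum G P))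
    (hsc : IsSimplyConnectedDatum P) (htype : IsTypeBCE7 P)
    -- its Frobenius endomorphisms
    (F₀ : Monoid.End G) (hF₀ : IsFrobenius p G F₀) (m : ℕ) (hm : 0 < m)
    -- a regular embedding, with an extension of the Frobenius endomorphism
    {n' : ℕ} (Gt : Subgroup (GL (Fin n') (AlgebraicClosure (ZMod p)))) (f : G →* Gt)
    (hf : IsRegularEmbedding G Gt f) (Ft₀ : Monoid.End Gt) (hFt₀ : IsFrobenius p Gt Ft₀)
    (hext : ∀ g : G, f (F₀ g) = Ft₀ (f g)) :
    (∀ (a : ℕ) (ha : a ∣ m) (δ : MulAut (fixedPts (F₀ ^ m))),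
      IsNoninteriorDiagonal f (F₀ ^ m) (Ft₀ ^ m) δ →
      (invariantClasses (δ * powAut F₀ hm ha) : ℚ) =
        ((finiteImage f (F₀ ^ m) (Ft₀ ^ m)).index : ℚ)⁻¹ *
          stableFullOrbitChars (finiteImage f (F₀ ^ m) (Ft₀ ^ m)) (powAut Ft₀ hm ha)) ↔
    (∀ (a : ℕ) (ha : a ∣ m) (δ : MulAut (fixedPts (F₀ ^ m))),
      IsNoninteriorDiagonal f (F₀ ^ m) (Ft₀ ^ m) δ →
      ∀ χ ∈ Irr (fixedPts (F₀ ^ m)),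
        conjChar χ (powAut F₀ hm ha) = conjChar χ δ →
          χ = conjChar χ (powAut F₀ hm ha) ∧ χ = conjChar χ δ) := by
  have : Finite (fixedPts (F₀ ^ m)) := hF₀.finite_fixedPts hm
  have : Finite (fixedPts (Ft₀ ^ m)) := hFt₀.finite_fixedPts hm
  obtain ⟨D⟩ := hGP
  have hinj : Function.Injective f := fun a b hab =>
    hf.embedding.injective (congrArg Gt.subtype hab)
  have hextPow : ∀ a g, f ((F₀ ^ a) g) = (Ft₀ ^ a) (f g) := by
    intro a
    induction a with
    | zero => exact fun _ => rfl
    | succ a ih =>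
      intro g
      rw [pow_succ', pow_succ']
      exact (hext _).trans (congrArg Ft₀ (ih g))
  have hcenter : ∀ z ∈ Subgroup.center G, ∀ w ∈ Subgroup.center G, z ≠ 1 → w ≠ 1 → z = w :=
    fun z hz w hw => eq_of_mem_center D hG.connected hsc htype hz hw
  have := normal_range_fixedPtsHom hinj (hextPow m) hf.sup_center
  -- The equivalence is proved for each pair of a diagonal automorphism and a power of Frobenius on
  -- its own.
  refine forall_congr' fun a => forall_congr' fun ha => forall_congr' fun δ =>
    forall_congr' fun ⟨x, hx, hδ⟩ => ?_
  rw [← range_fixedPtsHom (hextPow m)] at hx ⊢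
  refine invariantClasses_eq_iff (Z := fixedCenter (Ft₀ ^ m))
    (σ := powAut F₀ hm ha) (τ := powAut Ft₀ hm ha)
    (fixedPtsHom_injective hinj (hextPow m))
    (commutator_mem_range_fixedPtsHom hinj (hextPow m) hf.sup_center) (fixedCenter_le_center)
    (mul_inv_mem_range_sup_fixedCenter hinj (hextPow m) hf.sup_center (hFt₀.surjective_pow m)
      hcenter) (fun g => Subtype.ext (hextPow a g)) δ (x := x) ?_ fun g => Subtype.ext (hδ g)
  -- Fixed points in the centre centralize everything, so an element outside `N C(N)` is also
  -- outside `N Z`.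
  exact fun h => hx (sup_le_sup_left
    (fixedCenter_le_center.trans (Subgroup.center_le_centralizer _)) _ h)
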